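/- **Setting.** The base field is $K=\mathbb Q(q,t)$. Let $V_k=\operatorname{Sym}[X]\otimes K[y_1,\dots,y_k]$ and $V_*=\bigoplus_{k\ge 0}V_k$, with operators given in plethystic notation by $$T_iF=\frac{(q-1)y_iF+(y_{i+1}-qy_i)\,F|_{y_i\leftrightarrow y_{i+1}}}{y_{i+1}-y_i}\quad(F\in V_k,\ 1\le i<k),$$ $$d_-F=F[X-(q-1)y_k;y_1,\dots,y_k]\,\exp\Bigl(-\sum_{r\ge1}\tfrac{p_r[X]}{r}y_k^{-r}\Bigr)\Big|_{y_k^0}\ \ (F\in V_k,\ k\ge 1),\qquad d_-|_{V_0}=0,$$ $$d_+F=-T_1T_2\cdots T_k\bigl(y_{k+1}F[X+(q-1)y_{k+1};y_1,\dots,y_k]\bigr)\ \ (F\in V_k),$$ and let $\Delta=\frac{d_-d_+-d_+d_-}{q-1}$. Let $m_1,n_1\ge1$ be coprime, $g\ge1$, $m=gm_1$, $n=gn_1$, and $s_-=\frac{n_1}{m_1}-\varepsilon$ with $\varepsilon>0$ and $\varepsilon\, m_1(m+1)<1$. The height of a point $(x,y)$ is $y-s_-x$; the reading order orders lattice points by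 height. An $(m,n)$-Dyck path is a North-East lattice path from $(0,0)$ to $(m,n)$ staying weakly above the diagonal. **Statistics.** For an $(m,n)$-Dyck path $\pi$: $\operatorname{area}(\pi)$ is the number of unit cells between $\pi$ and the diagonal. $\operatorname{dinv}(\pi)$ is the number of pairs of an East step and a North step to its right, with $a$ and $l$ the horizontal and vertical distances from the end of the East step to the beginning of the North step, such that $\frac a{l+1}\le\frac mn<\frac{a+1}{l}$ (the last inequality is void for $l=0$). North steps are identified with their starting points; $P$ attacks $Q$ if $Q$ is after $P$ but before $P+(0,1)$ in the reading order. A word parking function is a map $w$ from the North steps to $\mathbb Z_{>0}$ with $w_P>w_{P+(0,1)}$ whenever $P$ and $P+(0,1)$ are both North steps; $\operatorname{maxtdinv}(\pi)$ is the maximum over all of these $w$ of the number of pairs with $P$ attacking $Q$ and $w_P>w_Q$. Number the North steps by $1,\dots,n$ in the reading order; $\pi'$ is the $(n,n)$-Dyck path such that, for $i<j$, the cell in column $i$ and row $j$ is below $\pi'$ if and only if $i$ attacks $j$, and $S_\pi$ is the set of pairs $(i,j)$ such that the $j$-th North step is directly above the $i$-th. For an $(n,n)$-Dyck path $\rho$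 and a set $S$ of pairs, $\chi(\rho,S)=\sum_w q^{\operatorname{inv}(\rho,w)}x_{w_1}\cdots x_{w_n}$, the sum being over $w\in\mathbb Z_{>0}^n$ with $w_i>w_j$ for all $(i,j)\in S$, where $\operatorname{inv}(\rho,w)$ is the number of $i<j$ with $w_i>w_j$ and the cell in column $i$ and row $j$ below $\rho$. Put $$D_\pi=t^{\operatorname{area}(\pi)}q^{\operatorname{dinv}(\pi)-\operatorname{maxtdinv}(\pi)}\chi(\pi',S_\pi).$$ **Sweep process.** Start with $\varphi=1\in V_0$ and move a line of slope $s_-$ downwards, from above the path to $y=s_-x-\varepsilon$. Whenever it passes a lattice point $P$ of $[0,m]\times[0,n]$ weakly below $\pi$, apply to $\varphi$: (A) $d_+$, if $\pi$ enters $P$ by a North step and leaves it by an East step; (B) $d_-$, if it enters by an East and leaves by a North step, or $P=(0,0)$; (C) $q^{-a}\Delta$, if it enters and leaves by North steps; (D) $q^a$, if it enters and leaves by East steps; (E) $t$, if $P$ is strictly below $\pi$. At $(m,n)$ nothing is done. Here $a$ is the number of North steps which the line crosses to the right of $P$. **Colorings.** Let $l_h=\{y=s_-x+h\}$, where $h>n-ms_-$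 is generic, that is, $l_h$ contains no lattice point of $[0,m]\times[0,n]$. An admissible coloring of $l_h$ is a finite set of non-overlapping intervals $[a_i,b_i]\subset l_h\cap[0,m]\times[0,n]$ with $x(a_i)\in\mathbb Z$ and $y(b_i)\in\mathbb Z$; colorings of different lines with the same pairs $(x(a_i),y(b_i))$ are identified. When a descending line with a coloring passes a lattice point $P$ of the rectangle, the following happens. If $P$ is not in the coloring (neither inside it nor on its boundary), then either nothing happens or (A) a new small interval appears at $P$. If one interval ends at $P$ and another one starts at $P$, (B) they are joined. If an interval starts at $P$ and none ends there, (C); if an interval ends at $P$ and none starts there, (D); if $P$ is in the interior of an interval, (E); in these three cases the intervals continue. Let $D_{s,c}=D_{s,c}(h)$ be the sum, over all families of colorings which arise in this way from the empty coloring of a line above the rectangle and end at the coloring $c$ of $l_h$, of the elements of $V_*$ obtained from $1\in V_0$ by applying the operators (A)-(E) above in turn, with $a$ the number of intervals to the right of $P$. **Theorem.** 1. For every $(m,n)$-Dyck path $\pi$ the final state of the sweep process lies in $V_0=\operatorname{Sym}[X]$ and equals $D_\pi$. 2. For every generic $h>n-ms_-$ and every admissible coloring $c$ of $l_h$ with $k$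 intervals, $D_{s,c}\in V_k$. One has $D_{s,\emptyset}=1$. If $c\ne\emptyset$, let $P=(x_0,y_0)$ be the first lattice point inside $c$ or on its boundary that is hit when $l_h$ is moved upwards, let $l_{h'}$ be a generic line just above $P$ (no lattice point of the rectangle has a height strictly between that of $P$ and $h'$), and let $a$ be the number of intervals of $c$ to the right of $P$. Then the following hold, and the colorings of $l_{h'}$ on the right-hand sides are admissible: - (A) if an interval of $c$ shrinks to $P$ and $c'$ is $c$ without it, $D_{s,c}=d_+D_{s,c'}$; - (C) if $P$ is only the left end of an interval, $D_{s,c}=q^{-a}\Delta D_{s,c'}$, where $c'$ is $c$ on $l_{h'}$; - (D) if $P$ is only the right end of an interval, $D_{s,c}=q^{a}D_{s,c'}$, where $c'$ is $c$ on $l_{h'}$; - (BE) if $P$ is in the interior of an interval, $D_{s,c}=d_-D_{s,c'}+t\,D_{s,c''}$, where $c''$ is $c$ on $l_{h'}$ and $c'$ is obtained from $c''$ by cutting this interval at $P$ into one that ends on $y=y_0$ and one that starts on $x=x_0$. These rules, starting from $D_{s,\emptyset}=1$, determine all the elements $D_{s,c}$. -/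

import Mathlib

noncomputable section

namespace SweepProcess

/-! ## The base field, symmetric functions and the spaces `V_k` -/

/-- The base field `ℚ(q, t)`. -/
def K : Type := FractionRing (MvPolynomial (Fin 2) ℚ)

instance : Field K := inferInstanceAs (Field (FractionRing (MvPolynomial (Fin 2) ℚ)))

instance : Algebra (MvPolynomial (Fin 2) ℚ) K :=
  inferInstanceAs (Algebra (MvPolynomial (Fin 2) ℚ) (FractionRing (MvPolynomial (Fin 2) ℚ)))

instance : IsFractionRing (MvPolynomial (Fin 2) ℚ) K :=
  inferInstanceAs (IsFractionRing (MvPolynomial (Fin 2) ℚ)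
    (FractionRing (MvPolynomial (Fin 2) ℚ)))

instance : CharZero K :=
  charZero_of_injective_algebraMap (IsFractionRing.injective (MvPolynomial (Fin 2) ℚ) K)

/-- The parameter `q`. -/
def q : K := algebraMap (MvPolynomial (Fin 2) ℚ) K (MvPolynomial.X 0)

/-- The parameter `t`. -/
def t : K := algebraMap (MvPolynomial (Fin 2) ℚ) K (MvPolynomial.X 1)

/-- The ring `Sym[X]` of symmetric functions over `ℚ(q, t)`, as the polynomial ring on the power sums
`p_n[X]` (`n ≥ 1`): the variable `X n` stands for `p_n[X]`. -/
abbrev SymFun : Type := MvPolynomial ℕ+ K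

/-- The power sum `p_n = ∑_i x_i ^ n` as a formal power series in `x_1, x_2, …`. -/
def powerSum (n : ℕ+) : MvPowerSeries ℕ+ K :=
  open Classical in fun d => if ∃ i : ℕ+, d = Finsupp.single i (n : ℕ) then 1 else 0

/-- A symmetric function as a formal power series in `x_1, x_2, …`. -/
def toSeries : SymFun →ₐ[K] MvPowerSeries ℕ+ K := MvPolynomial.aeval powerSum

/-- `V_k = Sym[X] ⊗ ℚ(q, t)[y_1, …, y_k]`; the variable `y_{i+1}` is `X i`, `i : Fin k`. -/
abbrev V (k : ℕ) : Type := MvPolynomial (Fin k) SymFun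

instance (k : ℕ) : AddCommGroup (V k) := inferInstance
instance (k : ℕ) : AddCommMonoid (V k) := AddCommGroup.toAddCommMonoid
instance (k : ℕ) : Module K (V k) := inferInstance

/-- `V_* = ⨁_k V_k`. -/
abbrev VStar : Type := DirectSum ℕ V

/-- The summand `V_k` of `V_*`. -/
def summand (k : ℕ) : Submodule K VStar := LinearMap.range (DirectSum.lof K ℕ V k)

/-- The inclusion of `Sym[X] = V_0` into `V_*`. -/
def ofSym (F : SymFun) : VStar := DirectSum.lof K ℕ V 0 (MvPolynomial.C F)

/-! ## The operators `T_i`, `d_-`, `d_+` -/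

/-- The operator exchanging `y_i` and `y_j`. -/
def swapVars {k : ℕ} (i j : Fin k) : V k →ₐ[SymFun] V k := MvPolynomial.rename (Equiv.swap i j)

theorem dvd_sub_swapVars {k : ℕ} (i j : Fin k) (F : V k) :
    (MvPolynomial.X j - MvPolynomial.X i : V k) ∣ F - swapVars i j F := by
  rw [← Ideal.mem_span_singleton]
  refine Ideal.Quotient.eq.1 ?_
  set I : Ideal (V k) := Ideal.span {(MvPolynomial.X j - MvPolynomial.X i : V k)}
  have hij : Ideal.Quotient.mk I (MvPolynomial.X j) = Ideal.Quotient.mk I (MvPolynomial.X i) :=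
    Ideal.Quotient.eq.2 (Ideal.mem_span_singleton_self _)
  have h : Ideal.Quotient.mkₐ SymFun I = (Ideal.Quotient.mkₐ SymFun I).comp (swapVars i j) := by
    apply MvPolynomial.algHom_ext
    intro a
    simp only [AlgHom.comp_apply, swapVars, MvPolynomial.rename_X, Ideal.Quotient.mkₐ_eq_mk]
    by_cases h1 : a = i
    · rw [h1, Equiv.swap_apply_left, hij]
    · by_cases h2 : a = j
      · rw [h2, Equiv.swap_apply_right, hij]
      · rw [Equiv.swap_apply_of_ne_of_ne h1 h2]
  exact DFunLike.congr_fun h F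

/-- The numerator `(q - 1) y_i F + (y_{i+1} - q y_i) swap F` of `T_i F`. -/
def heckeNum {k : ℕ} (i : Fin k) : V (k + 1) →ₗ[K] V (k + 1) where
  toFun F := (q - 1) • (MvPolynomial.X i.castSucc * F) +
    (MvPolynomial.X i.succ - q • MvPolynomial.X i.castSucc) * swapVars i.castSucc i.succ F
  map_add' F G := by
    simp only [map_add, mul_add, smul_add]
    ring
  map_smul' c F := by
    have h : swapVars i.castSucc i.succ (c • F) = c • swapVars i.castSucc i.succ F :=
      map_smul ((swapVars i.castSucc i.succ).restrictScalars K) c F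
    rw [h, mul_smul_comm, mul_smul_comm, smul_comm (q - 1) c, RingHom.id_apply, smul_add]

theorem exists_hecke {k : ℕ} (i : Fin k) (F : V (k + 1)) :
    ∃ G : V (k + 1), (MvPolynomial.X i.succ - MvPolynomial.X i.castSucc) * G = heckeNum i F := by
  obtain ⟨H, hH⟩ := dvd_sub_swapVars i.castSucc i.succ F
  refine ⟨swapVars i.castSucc i.succ F + (q - 1) • (MvPolynomial.X i.castSucc * H), ?_⟩
  have hF : F = (MvPolynomial.X i.succ - MvPolynomial.X i.castSucc) * H +
      swapVars i.castSucc i.succ F := by rw [← hH]; ring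
  simp only [heckeNum, LinearMap.coe_mk, AddHom.coe_mk]
  generalize swapVars i.castSucc i.succ F = G at hF
  rw [hF]
  simp only [Algebra.smul_def, map_sub, map_one]
  ring

theorem X_sub_X_ne_zero {k : ℕ} (i : Fin k) :
    (MvPolynomial.X i.succ - MvPolynomial.X i.castSucc : V (k + 1)) ≠ 0 := by
  rw [sub_ne_zero]
  intro h
  exact (Fin.castSucc_lt_succ (i := i)).ne' (MvPolynomial.X_injective h)

/-- `T_i F = ((q - 1) y_i F + (y_{i+1} - q y_i) swap F) / (y_{i+1} - y_i)`. -/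
def hecke {k : ℕ} (i : Fin k) : Module.End K (V (k + 1)) where
  toFun F := (exists_hecke i F).choose
  map_add' F G := by
    apply mul_left_cancel₀ (X_sub_X_ne_zero i)
    rw [mul_add, (exists_hecke i _).choose_spec, (exists_hecke i _).choose_spec,
      (exists_hecke i _).choose_spec, map_add]
  map_smul' c F := by
    apply mul_left_cancel₀ (X_sub_X_ne_zero i)
    rw [mul_smul_comm, (exists_hecke i _).choose_spec, RingHom.id_apply,
      (exists_hecke i _).choose_spec, map_smul]

theorem hecke_spec {k : ℕ} (i : Fin k) (F : V (k + 1)) :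
    (MvPolynomial.X i.succ - MvPolynomial.X i.castSucc) * hecke i F =
      (q - 1) • (MvPolynomial.X i.castSucc * F) +
        (MvPolynomial.X i.succ - q • MvPolynomial.X i.castSucc) *
          swapVars i.castSucc i.succ F :=
  (exists_hecke i F).choose_spec

/-- `F ↦ F[X + (q - 1) y_{k+1}; y_1, …, y_k]`, i.e. `p_n ↦ p_n + (q ^ n - 1) y_{k+1} ^ n`. -/
def addLast (k : ℕ) : V k →ₐ[K] V (k + 1) :=
  MvPolynomial.aevalTower
    (MvPolynomial.aeval fun n : ℕ+ =>
      MvPolynomial.C (MvPolynomial.X n) +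
        (q ^ (n : ℕ) - 1) • (MvPolynomial.X (Fin.last k) : V (k + 1)) ^ (n : ℕ))
    fun i => MvPolynomial.X i.castSucc

/-- `d_+ F = - T_1 T_2 ⋯ T_k (y_{k+1} F[X + (q - 1) y_{k+1}; y_1, …, y_k])` on `V_k`. -/
def dPlusAt (k : ℕ) : V k →ₗ[K] V (k + 1) :=
  -((List.ofFn fun i : Fin k => hecke i).prod ∘ₗ
    LinearMap.mulLeft K (MvPolynomial.X (Fin.last k)) ∘ₗ (addLast k).toLinearMap)

/-- `F ↦ F[X - (q - 1) y_{k+1}; y_1, …, y_{k+1}]`, i.e. `p_n ↦ p_n - (q ^ n - 1) y_{k+1} ^ n`, where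
the result is written as a polynomial in `y_{k+1}` with coefficients in `V_k`. -/
def subLast (k : ℕ) : V (k + 1) →ₐ[K] Polynomial (V k) :=
  MvPolynomial.aevalTower
    (MvPolynomial.aeval fun n : ℕ+ =>
      Polynomial.C (MvPolynomial.C (MvPolynomial.X n)) -
        (q ^ (n : ℕ) - 1) • (Polynomial.X : Polynomial (V k)) ^ (n : ℕ))
    (Fin.lastCases Polynomial.X fun i => Polynomial.C (MvPolynomial.X i))

/-- `pExp[-u X] = exp(-∑_{n ≥ 1} p_n[X] u ^ n / n)` as a power series in `u`. -/
def pExpNeg : PowerSeries SymFun :=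
  (PowerSeries.exp SymFun).subst
    (PowerSeries.mk fun n : ℕ =>
      if h : 0 < n then -((n : K)⁻¹ • (MvPolynomial.X (n.toPNat h) : SymFun)) else 0)

/-- `d_- F = F[X - (q - 1) y_k; y_1, …, y_k] pExp[-y_k⁻¹ X]`, coefficient of `y_k ^ 0`: the
coefficient of `y_k ^ n` in the first factor meets that of `y_k ^ (-n)` in the second one. -/
def dMinusAt (k : ℕ) : V (k + 1) →ₗ[K] V k :=
  (Polynomial.lsum fun n : ℕ =>
    LinearMap.mulRight K (MvPolynomial.C (PowerSeries.coeff n pExpNeg) : V k)) ∘ₗ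
    (subLast k).toLinearMap

/-- `d_+` on `V_*`. -/
def dPlus : VStar →ₗ[K] VStar :=
  DirectSum.toModule K ℕ VStar fun k => DirectSum.lof K ℕ V (k + 1) ∘ₗ dPlusAt k

/-- `d_-` on `V_*`; no arrow `d_-` starts at the vertex `0`, so it kills `V_0`. -/
def dMinus : VStar →ₗ[K] VStar :=
  DirectSum.toModule K ℕ VStar fun k => match k with
    | 0 => 0
    | k + 1 => DirectSum.lof K ℕ V k ∘ₗ dMinusAt k

/-- The marked corner operator `(d_- d_+ - d_+ d_-) / (q - 1)`. -/
def corner : VStar →ₗ[K] VStar := (q - 1)⁻¹ • (dMinus ∘ₗ dPlus - dPlus ∘ₗ dMinus)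

/-! ## Dyck paths and their statistics -/

/-- An `(m, n)`-Dyck path: a lattice path from `(0, 0)` to `(m, n)` with North and East steps that
stays weakly above the diagonal. It is recorded by the height `ht i` of its East step from the line
`x = i` to the line `x = i + 1`; the endpoint `(i + 1, ht i)` of that step has to be weakly above
the diagonal. -/
@[ext]
structure DyckPath (m n : ℕ) where
  ht : Fin m → ℕ
  mono : Monotone ht
  le_top : ∀ i, ht i ≤ n
  above : ∀ i : Fin m, n * ((i : ℕ) + 1) ≤ m * ht i

/-- The height of a lattice point over the line through the origin of slope `s`: the point lies on the
line `y = s x + height s P`. For `s = s_-`, comparing heights is the reading order. -/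
def height (s : ℝ) (P : ℕ × ℕ) : ℝ := (P.2 : ℝ) - s * (P.1 : ℝ)

/-- The lattice point directly above. -/
def up (P : ℕ × ℕ) : ℕ × ℕ := (P.1, P.2 + 1)

/-- The reading order (the comparison of abscissas only serves to make this a total order for every
`s`; it plays no role when distinct points have distinct heights). -/
def readKey (s : ℝ) (P : ℕ × ℕ) : ℝ ×ₗ ℕ := toLex (height s P, P.1)

theorem readKey_injective (s : ℝ) : Function.Injective (readKey s) := by
  rintro ⟨a, b⟩ ⟨c, d⟩ h
  have h1 := toLex.injective h
  simp only [height, Prod.mk.injEq] at h1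
  obtain ⟨h2, rfl⟩ := h1
  have : b = d := by exact_mod_cast sub_left_injective h2
  rw [this]

def readLE (s : ℝ) (P Q : ℕ × ℕ) : Prop := readKey s P ≤ readKey s Q

instance (s : ℝ) : IsTrans (ℕ × ℕ) (readLE s) := ⟨fun _ _ _ => le_trans⟩
instance (s : ℝ) : Std.Antisymm (readLE s) :=
  ⟨fun _ _ h h' => readKey_injective s (le_antisymm h h')⟩
instance (s : ℝ) : Std.Total (readLE s) := ⟨fun _ _ => le_total _ _⟩
instance (s : ℝ) : DecidableRel (readLE s) := Classical.decRel _

theorem height_le_of_readLE {s : ℝ} {P Q : ℕ × ℕ} (h : readLE s P Q) :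
    height s P ≤ height s Q := by
  rcases (Prod.Lex.le_iff (x := readKey s P) (y := readKey s Q)).1 h with h | h
  · exact le_of_lt h
  · exact le_of_eq h.1

/-- The reading order reversed: the order in which a descending line meets the points. -/
def sweepLE (s : ℝ) (P Q : ℕ × ℕ) : Prop := readLE s Q P

instance (s : ℝ) : IsTrans (ℕ × ℕ) (sweepLE s) := ⟨fun _ _ _ h h' => le_trans h' h⟩
instance (s : ℝ) : Std.Antisymm (sweepLE s) :=
  ⟨fun _ _ h h' => readKey_injective s (le_antisymm h' h)⟩
instance (s : ℝ) : Std.Total (sweepLE s) := ⟨fun _ _ => le_total _ _⟩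
instance (s : ℝ) : DecidableRel (sweepLE s) := Classical.decRel _

/-- The lattice points of the rectangle `[0, m] × [0, n]`. -/
def rect (m n : ℕ) : Finset (ℕ × ℕ) := Finset.range (m + 1) ×ˢ Finset.range (n + 1)

namespace DyckPath

variable {m n : ℕ} (π : DyckPath m n)

/-- The lowest height at which the path meets the line of abscissa `x`. -/
def lo (x : ℕ) : ℕ := if h : x - 1 < m ∧ 0 < x then π.ht ⟨x - 1, h.1⟩ else 0

/-- The greatest height at which the path meets the line of abscissa `x`. -/
def hi (x : ℕ) : ℕ := if h : x < m then π.ht ⟨x, h⟩ else n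

/-- The North steps, identified with the lattice points of their beginnings. -/
def northSteps : Finset (ℕ × ℕ) := (rect m n).filter fun P => π.lo P.1 ≤ P.2 ∧ P.2 < π.hi P.1

/-- The number of cells between the path and the diagonal: the cell `[i, i+1] × [j, j+1]` is below the
path when `j + 1 ≤ ht i`, and above the diagonal when its corner `(i + 1, j)` is. -/
def area : ℕ :=
  ((Finset.univ ×ˢ Finset.range n : Finset (Fin m × ℕ)).filter fun c =>
    c.2 + 1 ≤ π.ht c.1 ∧ n * ((c.1 : ℕ) + 1) ≤ m * c.2).card

/-- The pairs of an East step `i` and a North step to its right with arm `a` and leg `l`, such that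
`a / (l + 1) ≤ m / n < (a + 1) / l`. -/
def dinv : ℕ :=
  ((Finset.univ ×ˢ π.northSteps : Finset (Fin m × (ℕ × ℕ))).filter fun c =>
    (c.1 : ℕ) + 1 ≤ c.2.1 ∧
      (c.2.1 - ((c.1 : ℕ) + 1)) * n ≤ m * (c.2.2 - π.ht c.1 + 1) ∧
      m * (c.2.2 - π.ht c.1) < n * (c.2.1 - ((c.1 : ℕ) + 1) + 1)).card

/-- The North step `P` attacks the North steps which appear after it in the reading order, but before
the lattice point directly above it. -/
def Attacks (s : ℝ) (P Q : ℕ × ℕ) : Prop :=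
  height s P < height s Q ∧ height s Q < height s (up P)

/-- Word parking functions: labels decrease along consecutive North steps. -/
def IsWordParking (w : π.northSteps → ℕ+) : Prop :=
  ∀ P Q : π.northSteps, (Q : ℕ × ℕ) = up P → w Q < w P

/-- The temporary dinv of a word parking function. -/
def tdinv (s : ℝ) (w : π.northSteps → ℕ+) : ℕ :=
  open Classical in
  ((Finset.univ : Finset (π.northSteps × π.northSteps)).filter fun c =>
    Attacks s c.1 c.2 ∧ w c.2 < w c.1).card

/-- The maximal value of `tdinv` over all word parking functions. -/
def maxtdinv (s : ℝ) : ℕ := sSup {d | ∃ w, π.IsWordParking w ∧ π.tdinv s w = d}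

/-- The number of inversions of a word with respect to an `(N, N)`-Dyck path: the pairs `i < j` with
`w_i > w_j` such that the cell in column `i` and row `j` is below the path. -/
def inv {N : ℕ} (ρ : DyckPath N N) (w : Fin N → ℕ+) : ℕ :=
  ((Finset.univ : Finset (Fin N × Fin N)).filter fun c =>
    c.1 < c.2 ∧ (c.2 : ℕ) < ρ.ht c.1 ∧ w c.2 < w c.1).card

/-- The characteristic function `χ(ρ, S) = ∑_w q ^ inv(ρ, w) x_{w_1} ⋯ x_{w_N}` of a marked
`(N, N)`-Dyck path, as a power series in `x_1, x_2, …`; the sum is over all words `w` with `w_i > w_j`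
for `(i, j) ∈ S`. -/
def chi {N : ℕ} (ρ : DyckPath N N) (S : Finset (Fin N × Fin N)) : MvPowerSeries ℕ+ K :=
  fun d => ∑ w ∈ (Fintype.piFinset fun _ : Fin N => d.support).filter
    (fun w => (∀ c ∈ S, w c.2 < w c.1) ∧ ∑ i, Finsupp.single (w i) 1 = d), q ^ inv ρ w

/-- The North steps listed in the reading order. -/
def northList (s : ℝ) : List (ℕ × ℕ) := π.northSteps.sort (readLE s)

/-- The `(n, n)`-Dyck path `π'` plotted by the attack relation: the cells below it in column `i` and above
the main diagonal are in the rows `j` of the North steps attacked by the `i`-th one, so the column has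
as many cells below the path as there are North steps preceding, in the reading order, the lattice
point directly above the `i`-th one. (The list of North steps has length `n`.) -/
def attackPath (s : ℝ) : DyckPath (π.northList s).length (π.northList s).length where
  ht i := open Classical in
    ((Finset.univ : Finset (Fin (π.northList s).length)).filter fun j =>
      height s ((π.northList s).get j) < height s (up ((π.northList s).get i))).card
  mono := by
    intro i j hij
    have h : height s ((π.northList s).get i) ≤ height s ((π.northList s).get j) := by
      apply height_le_of_readLE
      rcases hij.eq_or_lt with h | h
      · rw [h]; exact le_refl (readKey s _)
      · exact List.pairwise_iff_get.1 (Finset.pairwise_sort π.northSteps (readLE s)) i j h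
    apply Finset.card_le_card
    intro a ha
    simp only [Finset.mem_filter, Finset.mem_univ, true_and] at ha ⊢
    refine lt_of_lt_of_le ha ?_
    simp only [height, up, Nat.cast_add, Nat.cast_one] at h ⊢
    linarith
  le_top := by
    intro i
    exact (Finset.card_le_univ _).trans_eq (Fintype.card_fin _)
  above := by
    intro i
    apply Nat.mul_le_mul_left
    rw [← Fin.card_Iic]
    apply Finset.card_le_card
    intro a ha
    simp only [Finset.mem_filter, Finset.mem_univ, true_and, Finset.mem_Iic] at ha ⊢
    have h : height s ((π.northList s).get a) ≤ height s ((π.northList s).get i) := by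
      apply height_le_of_readLE
      rcases ha.eq_or_lt with h | h
      · rw [h]; exact le_refl (readKey s _)
      · exact List.pairwise_iff_get.1 (Finset.pairwise_sort π.northSteps (readLE s)) a i h
    refine lt_of_le_of_lt h ?_
    simp only [height, up, Nat.cast_add, Nat.cast_one]
    linarith

/-- The marking `S_π`: the pairs of consecutive North steps. -/
def marking (s : ℝ) : Finset (Fin (π.northList s).length × Fin (π.northList s).length) :=
  Finset.univ.filter fun c => (π.northList s).get c.2 = up ((π.northList s).get c.1)

/-- `D_π = t ^ area(π) q ^ (dinv(π) - maxtdinv(π)) χ(π', S_π)`. -/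
def D (s : ℝ) : MvPowerSeries ℕ+ K :=
  (t ^ π.area * q ^ ((π.dinv : ℤ) - (π.maxtdinv s : ℤ))) •
    chi (π.attackPath s) (π.marking s)

end DyckPath

/-! ## The sweep process -/

/-- The events of the sweep process; `pass` stands for a lattice point that causes no event. -/
inductive Event
  | pass | A | B | C | D | E
  deriving DecidableEq

instance : Fintype Event :=
  ⟨{.pass, .A, .B, .C, .D, .E}, by intro x; cases x <;> decide⟩

/-- The operation performed at an event; `a` is the number of vertical steps which the line crosses to
the right of the event. -/
def Event.op : Event → ℕ → VStar →ₗ[K] VStar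
  | .pass, _ => LinearMap.id
  | .A, _ => dPlus
  | .B, _ => dMinus
  | .C, a => (q ^ a)⁻¹ • corner
  | .D, a => q ^ a • LinearMap.id
  | .E, _ => t • LinearMap.id

namespace DyckPath

variable {m n : ℕ} (π : DyckPath m n)

/-- The event at a lattice point weakly below the path. Strictly below the path it is `E`. On the path it
depends on the two steps at the point: North then East is `A`, East then North is `B`, North then North
is `C`, East then East is `D`. The starting point `(0, 0)`, left by a North step, counts as `B`, and the
endpoint `(m, n)`, reached by an East step, as `D` (with `a = 0`, so nothing happens there). -/
def event (P : ℕ × ℕ) : Event :=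
  if P.2 < π.lo P.1 then .E
  else if P.2 = π.lo P.1 then (if P.2 = π.hi P.1 then .D else .B)
  else (if P.2 = π.hi P.1 then .A else .C)

/-- The number of North steps which the line through `P` crosses to the right of `P`. -/
def crossingsRight (s : ℝ) (P : ℕ × ℕ) : ℕ :=
  open Classical in
  (π.northSteps.filter fun Q =>
    P.1 < Q.1 ∧ height s Q < height s P ∧ height s P < height s (up Q)).card

/-- The lattice points weakly below the path that the descending line has passed when it has become
`y = s x + h`, in the order in which it meets them. -/
def sweepPoints (s h : ℝ) : List (ℕ × ℕ) :=
  open Classical in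
  ((rect m n).filter fun P => P.2 ≤ π.hi P.1 ∧ h < height s P).sort (sweepLE s)

/-- The state of the sweep process when the line has become `y = s x + h`. -/
def sweep (s h : ℝ) : VStar :=
  (π.sweepPoints s h).foldl (fun φ P => (π.event P).op (π.crossingsRight s P) φ) (ofSym 1)

end DyckPath

/-! ## Colorings -/

/-- A finite family of intervals on a line `y = s x + h`. The pair `(α, β)` stands for the interval
`[a, b]` of the line with `x(a) = α` and `y(b) = β`. -/
abbrev Coloring : Type := Finset (ℕ × ℕ)

/-- The line `y = s x + h` contains no lattice point of `[0, m] × [0, n]`. -/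
def IsGeneric (m n : ℕ) (s h : ℝ) : Prop := ∀ P ∈ rect m n, height s P ≠ h

/-- Admissible colorings of the line `y = s x + h`, for `s > 0` and `h > 0`: the ends `a`, `b` of the
intervals are in the rectangle `[0, m] × [0, n]`, `a` is to the left of `b`, and the intervals do not
overlap. -/
def IsAdmissible (m n : ℕ) (s h : ℝ) (c : Coloring) : Prop :=
  (∀ I ∈ c, I.1 ≤ m ∧ s * I.1 + h ≤ n ∧ I.2 ≤ n ∧ (I.2 : ℝ) ≤ s * m + h ∧
    s * I.1 + h < I.2) ∧
  ∀ I ∈ c, ∀ J ∈ c, I ≠ J → (I.2 : ℝ) ≤ s * J.1 + h ∨ (J.2 : ℝ) ≤ s * I.1 + h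

/-- `P` is inside `c` or on its boundary, when the line goes through `P`. -/
def Meets (c : Coloring) (P : ℕ × ℕ) : Prop := ∃ I ∈ c, I.1 ≤ P.1 ∧ P.2 ≤ I.2

/-- The possible changes of a coloring `c` into `c'` when the descending line crosses the lattice point
`P`, according to the kind of event. Just above `P`, the interval `(α, β)` of `c` starts at `P` if
`α = P.1`, it ends at `P` if `β = P.2`, and `P` is inside it if `α < P.1` and `P.2 < β`. At `A` the interval
`P` appears, at `B` an interval ending at `P` is joined with one starting at `P`, at `C`, `D` and `E` the point
`P` is only the start, only the end, or an inner point of an interval. -/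
def IsMove (P : ℕ × ℕ) : Event → Coloring → Coloring → Prop
  | .pass, c, c' => ¬ Meets c P ∧ c' = c
  | .A, c, c' => ¬ Meets c P ∧ c' = insert P c
  | .B, c, c' => ∃ α β, (α, P.2) ∈ c ∧ (P.1, β) ∈ c ∧
      c' = insert (α, β) ((c.erase (α, P.2)).erase (P.1, β))
  | .C, c, c' => (∃ β, (P.1, β) ∈ c) ∧ (¬ ∃ α, (α, P.2) ∈ c) ∧ c' = c
  | .D, c, c' => (∃ α, (α, P.2) ∈ c) ∧ (¬ ∃ β, (P.1, β) ∈ c) ∧ c' = c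
  | .E, c, c' => (∃ I ∈ c, I.1 < P.1 ∧ P.2 < I.2) ∧ c' = c

/-- The number of vertical steps which the line through `P` crosses to the right of `P`: those at the
left ends of the intervals of `c` to the right of `P`. -/
def startsRight (c : Coloring) (P : ℕ × ℕ) : ℕ := (c.filter fun I => P.1 < I.1).card

/-- The lattice points of the rectangle that the descending line has passed when it has become
`y = s x + h`, in the order in which it meets them. -/
def rectPoints (m n : ℕ) (s h : ℝ) : List (ℕ × ℕ) :=
  open Classical in ((rect m n).filter fun P => h < height s P).sort (sweepLE s)

/-- A family of colorings along a list of lattice points met by the line: `f i` is the coloring after the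
first `i` points, `e i` the event at the next point (it is determined by `f`). The family begins with
the empty coloring and ends at `c`. -/
def IsFamily (L : List (ℕ × ℕ)) (c : Coloring) (f : Fin (L.length + 1) → Coloring)
    (e : Fin L.length → Event) : Prop :=
  f 0 = ∅ ∧ f (Fin.last _) = c ∧ ∀ i, IsMove (L.get i) (e i) (f i.castSucc) (f i.succ)

/-- The result of the algorithm along a family of colorings. -/
def familyResult (L : List (ℕ × ℕ)) (f : Fin (L.length + 1) → Coloring)
    (e : Fin L.length → Event) : VStar :=
  (List.finRange L.length).foldl
    (fun φ i => (e i).op (startsRight (f i.castSucc) (L.get i)) φ) (ofSym 1)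

/-- `D_{s,c}` for a coloring `c` of the line `y = s x + h`: the sum of the results of the algorithm over
all families of colorings that begin with the empty coloring and end at `c`. -/
def coloringD (m n : ℕ) (s h : ℝ) (c : Coloring) : VStar :=
  open Classical in
  ∑ F ∈ ((Fintype.piFinset fun _ : Fin ((rectPoints m n s h).length + 1) =>
      (rect m n).powerset) ×ˢ
      (Finset.univ : Finset (Fin (rectPoints m n s h).length → Event))).filter
      (fun F => IsFamily (rectPoints m n s h) c F.1 F.2),
    familyResult (rectPoints m n s h) F.1 F.2

/-- The line `y = s x + h` with the admissible coloring `c`, moving upwards, hits `c` for the first time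
at the lattice point `P`, and `y = s x + h'` is a line just above `P`. -/
structure FirstHit (m n : ℕ) (s h h' : ℝ) (c : Coloring) (P : ℕ × ℕ) : Prop where
  start : height s (m, n) < h
  generic : IsGeneric m n s h
  generic' : IsGeneric m n s h'
  admissible : IsAdmissible m n s h c
  mem : P ∈ rect m n
  meets : Meets c P
  below : h < height s P
  above : height s P < h'
  first : ∀ Q ∈ rect m n, h < height s Q → height s Q < height s P → ¬ Meets c Q
  next : ∀ Q ∈ rect m n, ¬ (height s P < height s Q ∧ height s Q < h')

/-- The recursion rules for elements `E h c` of `V_*` attached to the lines `y = s x + h` above the point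
`(m, n)` and their admissible colorings `c`. -/
structure Recursion (m n : ℕ) (s : ℝ) (E : ℝ → Coloring → VStar) : Prop where
  empty : ∀ h, height s (m, n) < h → IsGeneric m n s h → E h ∅ = ofSym 1
  ruleA : ∀ h h' c P, FirstHit m n s h h' c P → P ∈ c →
    IsAdmissible m n s h' (c.erase P) ∧ E h c = dPlus (E h' (c.erase P))
  ruleC : ∀ h h' c P β, FirstHit m n s h h' c P → (P.1, β) ∈ c → P.2 < β →
    IsAdmissible m n s h' c ∧ E h c = (q ^ startsRight c P)⁻¹ • corner (E h' c)
  ruleD : ∀ h h' c P α, FirstHit m n s h h' c P → (α, P.2) ∈ c → α < P.1 →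
    IsAdmissible m n s h' c ∧ E h c = q ^ startsRight c P • E h' c
  ruleBE : ∀ h h' c P α β, FirstHit m n s h h' c P → (α, β) ∈ c → α < P.1 → P.2 < β →
    IsAdmissible m n s h' (insert (α, P.2) (insert (P.1, β) (c.erase (α, β)))) ∧
    IsAdmissible m n s h' c ∧
    E h c = dMinus (E h' (insert (α, P.2) (insert (P.1, β) (c.erase (α, β))))) + t • E h' c

end SweepProcess

end

/-! ### The series pExp[-uX] under a change of alphabet -/

noncomputable section
namespace SweepProcess
-- Sweep process. Every state is of the form (-1)^k y_1 ⋯ y_k G. The product y_1 ⋯ y_k is symmetric,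
-- hence commutes with the T_i, and dividing it out turns d_+ and d_- into simpler operators `W.dp`
-- and `W.dm` on one ring `W` that contains all the V_k (`Bridge`). The sweep becomes a word in
-- these operators, to be read as a queue: a North step enters when the line passes its top and
-- leaves when the line passes its bottom. As all North steps have length 1, the first to enter is
-- the first to leave (`queue_cons`, `queue_tail`).
--
-- The value of a word at a finite alphabet is found by adding the letters one at a time, in
-- increasing order. The substitution X → X + u commutes with `W.dp`, but turns `W.dm` into `W.dm` +
-- u `W.del` (`W.shift_dm`), so the word becomes a sum over the sets U of elements that leave by
-- `W.del`, with weight u^|U|. Leaving by `W.del` can be moved back through the word by the Hecke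
-- relations: it commutes with the entries of later elements (`W.remove_succ_dp`), costs a factor q
-- for each older element that leaves by `W.dm` in between (`W.remove_dm`), and cancels the entry of
-- the element itself (`W.remove_zero_dp`). So the elements of U disappear from the word. If they
-- are given the new, greatest label, the powers of q count their inversions with the remaining
-- elements, and induction yields the sum of q^inversions over all labellings (`Step.ev_run`). In Δ
-- = (d_-d_+ - d_+d_-)/(q-1) the two orders differ only in whether the leaving element j is compared
-- with the entering element i; the quotient of q^[w_j < w_i] - 1 by q - 1 is the indicator of w_j <
-- w_i, which is the condition encoded in S_π (`MStep.wt_expand`). In the queue of the sweep, the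
-- waiting steps are those that attack the leaving one, so the sum is χ(π', S_π) (`word_spec`,
-- `sum_parking`).
--
-- The scalars remain. The events E give t^area. A labelling that decreases in the reading order
-- realizes all attacks, so maxtdinv is the number of attacking pairs. Then dinv - maxtdinv is
-- compared with the exponent of q coming from C and D separately for every North step Q: each
-- column to the left of Q contributes a difference of two consecutive terms (`column`), and the sum
-- telescopes to 0.
--
-- Colorings. Sorting the families by their last move expresses `coloringD` below a lattice point P
-- by its values above P (`Crosses.coloringD_eq`). Moves preserve admissibility, so only admissible
-- predecessors contribute; below P at most one interval meets P, and its position relative to P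
-- leaves a single predecessor, or two (B and E) when P is an inner point. The rules determine
-- everything by induction on the number of lattice points above the line.
open PowerSeries in
theorem hasSubst_pExpNeg_arg : PowerSeries.HasSubst (PowerSeries.mk fun n : ℕ =>
      if h : 0 < n then -((n : K)⁻¹ • (MvPolynomial.X (n.toPNat h) : SymFun)) else 0) := by
  apply PowerSeries.HasSubst.of_constantCoeff_zero'
  rw [← PowerSeries.coeff_zero_eq_constantCoeff_apply, PowerSeries.coeff_mk]
  simp

/-- `(-1) ^ n e_n[X]`, the coefficients of `pExp[-u X]`. -/
def signedElem (n : ℕ) : SymFun := PowerSeries.coeff n pExpNeg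

theorem signedElem_zero : signedElem 0 = 1 := by
  have h0 : PowerSeries.constantCoeff (PowerSeries.mk fun n : ℕ =>
      if h : 0 < n then -((n : K)⁻¹ • (MvPolynomial.X (n.toPNat h) : SymFun)) else 0) = 0 := by
    rw [← PowerSeries.coeff_zero_eq_constantCoeff_apply, PowerSeries.coeff_mk]
    simp
  rw [signedElem, PowerSeries.coeff_zero_eq_constantCoeff_apply, pExpNeg]
  refine (PowerSeries.constantCoeff_subst hasSubst_pExpNeg_arg _).trans ?_
  rw [finsum_eq_single _ 0]
  · simp
  · intro n hn
    have : MvPowerSeries.constantCoeff ((PowerSeries.mk fun n : ℕ =>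
      if h : 0 < n then -((n : K)⁻¹ • (MvPolynomial.X (n.toPNat h) : SymFun)) else 0) ^ n) = 0 := by
      rw [map_pow]
      exact (congrArg (· ^ n) h0).trans (zero_pow hn)
    rw [this, smul_zero]

theorem cast_succ_ne_zero (n : ℕ) : ((n + 1 : ℕ) : K) ≠ 0 := Nat.cast_ne_zero.2 n.succ_ne_zero

theorem derivative_pExpNeg : PowerSeries.derivative SymFun pExpNeg =
    -(PowerSeries.mk fun n : ℕ => (MvPolynomial.X n.succPNat : SymFun)) * pExpNeg := by
  rw [pExpNeg, PowerSeries.derivative_subst hasSubst_pExpNeg_arg, PowerSeries.derivative_exp,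
    mul_comm]
  congr 1
  ext1 n
  rw [PowerSeries.coeff_derivative, PowerSeries.coeff_mk, map_neg, PowerSeries.coeff_mk,
    dif_pos n.succ_pos]
  have h : ((n : SymFun) + 1) = algebraMap K SymFun ((n + 1 : ℕ) : K) := by simp
  rw [h, mul_comm, ← Algebra.smul_def, smul_neg, smul_smul, mul_inv_cancel₀ (cast_succ_ne_zero n), one_smul]
  rfl

/-- Uniqueness for a first order linear differential equation: in characteristic 0 each coefficient
is a multiple of a combination of the earlier ones. -/
theorem powerSeries_eq_zero_of_derivative {R : Type*} [CommRing R] [Algebra K R]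
    (M E : PowerSeries R) (h0 : PowerSeries.constantCoeff E = 0)
    (hE : PowerSeries.derivative R E = M * E) : E = 0 := by
  ext1 n
  induction n using Nat.strong_induction_on with
  | _ n ih =>
    cases n with
    | zero => simpa using h0
    | succ n =>
      have h := congrArg (PowerSeries.coeff n) hE
      rw [PowerSeries.coeff_derivative, PowerSeries.coeff_mul, Finset.sum_eq_zero] at h
      · have h2 : ((n : R) + 1) = algebraMap K R ((n + 1 : ℕ) : K) := by simp
        rw [h2, mul_comm, ← Algebra.smul_def] at h
        have h3 := congrArg (fun z => (((n + 1 : ℕ) : K))⁻¹ • z) h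
        simp only [smul_smul] at h3
        rw [inv_mul_cancel₀ (cast_succ_ne_zero n), one_smul, smul_zero] at h3
        rw [h3, map_zero]
      · intro x hx
        rw [ih x.2 (by
          have := Finset.HasAntidiagonal.mem_antidiagonal.1 hx
          omega), map_zero, mul_zero]

/-- Adding the letter x and removing the letter y multiplies exp(-∑ p_n u^n / n) by (1 - xu)/(1 -
yu). The claim is the coefficient of u^(n+1) in the identity (1 - yu) A = (1 - xu) B. -/
theorem signedElem_shift {R : Type*} [CommRing R] [Algebra K R] (φ ψ : SymFun →ₐ[K] R) (x y : R)
    (h : ∀ n : ℕ+, φ (MvPolynomial.X n) = ψ (MvPolynomial.X n) + x ^ (n : ℕ) - y ^ (n : ℕ))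
    (n : ℕ) : φ (signedElem (n + 1)) - y * φ (signedElem n) =
      ψ (signedElem (n + 1)) - x * ψ (signedElem n) := by
  set A := PowerSeries.map φ.toRingHom pExpNeg with hA
  set B := PowerSeries.map ψ.toRingHom pExpNeg with hB
  set P := PowerSeries.mk fun n : ℕ => φ (MvPolynomial.X n.succPNat) with hP
  set Q := PowerSeries.mk fun n : ℕ => ψ (MvPolynomial.X n.succPNat) with hQ
  set gx := PowerSeries.mk fun n : ℕ => x ^ (n + 1) with hgx
  set gy := PowerSeries.mk fun n : ℕ => y ^ (n + 1) with hgy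
  have geom : ∀ z : R, (1 - PowerSeries.C z * PowerSeries.X) *
      (PowerSeries.mk fun n : ℕ => z ^ (n + 1)) = PowerSeries.C z := by
    intro z
    ext1 n
    rw [sub_mul, one_mul, map_sub, mul_assoc, PowerSeries.coeff_C_mul, PowerSeries.coeff_mk]
    cases n with
    | zero => simp
    | succ n => rw [PowerSeries.coeff_succ_X_mul, PowerSeries.coeff_mk, PowerSeries.coeff_C,
        if_neg n.succ_ne_zero]; ring
  have hder : ∀ χ : SymFun →ₐ[K] R, PowerSeries.derivative R (PowerSeries.map χ.toRingHom pExpNeg) =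
      -(PowerSeries.mk fun n : ℕ => χ (MvPolynomial.X n.succPNat)) *
        PowerSeries.map χ.toRingHom pExpNeg := by
    intro χ
    have h1 := congrArg (PowerSeries.map χ.toRingHom) derivative_pExpNeg
    rw [map_mul, map_neg] at h1
    convert h1 using 1
    · ext1 n
      simp [PowerSeries.coeff_derivative]
    · congr 2
  have hPQ : P = Q + gx - gy := by
    ext1 n
    simp only [hP, hQ, hgx, hgy, map_sub, map_add, PowerSeries.coeff_mk, h]
    rfl
  have hdx : ∀ z : R, PowerSeries.derivative R (1 - PowerSeries.C z * PowerSeries.X) =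
      -PowerSeries.C z := by
    intro z
    rw [map_sub, PowerSeries.derivative_one, Derivation.leibniz, PowerSeries.derivative_C,
      PowerSeries.derivative_X]
    simp
  have key : (1 - PowerSeries.C y * PowerSeries.X) * A = (1 - PowerSeries.C x * PowerSeries.X) * B := by
    rw [← sub_eq_zero]
    -- Both (1 - yu) A and (1 - xu) B have logarithmic derivative -(Q + gx): the derivative of 1 -
    -- yu cancels the geometric series `gy`, that of 1 - xu produces `gx`.
    apply powerSeries_eq_zero_of_derivative (-(Q + gx))
    · have c0 : ∀ χ : SymFun →ₐ[K] R,
          PowerSeries.constantCoeff (PowerSeries.map χ.toRingHom pExpNeg) = 1 := by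
        intro χ
        rw [← PowerSeries.coeff_zero_eq_constantCoeff_apply, PowerSeries.coeff_map,
          show PowerSeries.coeff 0 pExpNeg = 1 from signedElem_zero, map_one]
      rw [map_sub, map_mul, map_mul, hA, hB, c0, c0]
      simp
    · rw [map_sub, Derivation.leibniz, Derivation.leibniz, hdx, hdx, hA, hB, hder, hder]
      simp only [smul_eq_mul]
      rw [← hA, ← hB, ← hP, ← hQ, hPQ]
      linear_combination A * geom y - B * geom x
  have := congrArg (PowerSeries.coeff (n + 1)) key
  simp only [sub_mul, one_mul, map_sub, mul_assoc, PowerSeries.coeff_C_mul,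
    PowerSeries.coeff_succ_X_mul] at this
  exact this
end SweepProcess
end

/-! ### The ring containing all V_k, and its Hecke operators -/

noncomputable section
namespace SweepProcess

/-- `Sym[X][y_0, y_1, …]`, in which all the spaces `V_k` are embedded. -/
abbrev W : Type := MvPolynomial ℕ SymFun

namespace W

/-- The variable `y_i`. -/
def y (i : ℕ) : W := MvPolynomial.X i

/-- The power sum `p_n[X]`. -/
def p (n : ℕ+) : W := MvPolynomial.C (MvPolynomial.X n)

/-- The scalar `q`. -/
def qc : W := algebraMap K W q

theorem y_injective : Function.Injective y := MvPolynomial.X_injective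

section Hom

variable {R : Type*} [CommRing R] [Algebra K R]

/-- The homomorphism with prescribed values on the power sums and on the variables. -/
def lift (a : ℕ+ → R) (b : ℕ → R) : W →ₐ[K] R := MvPolynomial.aevalTower (MvPolynomial.aeval a) b

@[simp] theorem lift_p (a : ℕ+ → R) (b : ℕ → R) (n : ℕ+) : lift a b (p n) = a n := by
  rw [lift, p, MvPolynomial.aevalTower_C, MvPolynomial.aeval_X]

@[simp] theorem lift_y (a : ℕ+ → R) (b : ℕ → R) (i : ℕ) : lift a b (y i) = b i :=
  MvPolynomial.aevalTower_X _ _ _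

@[simp] theorem endHom_qc (f : W →ₐ[K] W) : f qc = qc := f.commutes q

@[simp] theorem polyHom_qc (f : W →ₐ[K] Polynomial W) : f qc = Polynomial.C qc := f.commutes q

theorem hom_ext {f g : W →ₐ[K] R} (hp : ∀ n, f (p n) = g (p n)) (hy : ∀ i, f (y i) = g (y i)) :
    f = g := by
  refine MvPolynomial.algHom_ext' ?_ hy
  exact MvPolynomial.algHom_ext hp

theorem hom_signedElem_shift (f g : W →ₐ[K] R) (x z : R)
    (h : ∀ n : ℕ+, f (p n) = g (p n) + x ^ (n : ℕ) - z ^ (n : ℕ)) (n : ℕ) :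
    f (MvPolynomial.C (signedElem (n + 1))) - z * f (MvPolynomial.C (signedElem n)) =
      g (MvPolynomial.C (signedElem (n + 1))) - x * g (MvPolynomial.C (signedElem n)) :=
  signedElem_shift (f.comp (IsScalarTower.toAlgHom K SymFun W))
    (g.comp (IsScalarTower.toAlgHom K SymFun W)) x z h n

theorem hom_signedElem_congr (f g : W →ₐ[K] R) (h : ∀ n : ℕ+, f (p n) = g (p n)) (n : ℕ) :
    f (MvPolynomial.C (signedElem n)) = g (MvPolynomial.C (signedElem n)) := by
  have : f.comp (IsScalarTower.toAlgHom K SymFun W) = g.comp (IsScalarTower.toAlgHom K SymFun W) :=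
    MvPolynomial.algHom_ext h
  exact DFunLike.congr_fun this (signedElem n)

end Hom

/-- The exchange of `y_i` and `y_{i+1}`. -/
def s (i : ℕ) : W →ₐ[K] W := lift p fun j => y (Equiv.swap i (i + 1) j)

@[simp] theorem s_p (i : ℕ) (n : ℕ+) : s i (p n) = p n := lift_p _ _ _
theorem s_y (i j : ℕ) : s i (y j) = y (Equiv.swap i (i + 1) j) := lift_y _ _ _
@[simp] theorem s_y_left (i : ℕ) : s i (y i) = y (i + 1) := by rw [s_y, Equiv.swap_apply_left]
@[simp] theorem s_y_right (i : ℕ) : s i (y (i + 1)) = y i := by rw [s_y, Equiv.swap_apply_right]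
theorem s_y_of_ne {i j : ℕ} (h : j ≠ i) (h' : j ≠ i + 1) : s i (y j) = y j := by
  rw [s_y, Equiv.swap_apply_of_ne_of_ne h h']

@[simp] theorem s_s (i : ℕ) (F : W) : s i (s i F) = F := by
  have : (s i).comp (s i) = AlgHom.id K W := by
    apply hom_ext
    · simp
    · intro j; simp [s_y]
  exact DFunLike.congr_fun this F

theorem s_braid (i : ℕ) (F : W) : s i (s (i + 1) (s i F)) = s (i + 1) (s i (s (i + 1) F)) := by
  have : (s i).comp ((s (i + 1)).comp (s i)) = (s (i + 1)).comp ((s i).comp (s (i + 1))) := by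
    apply hom_ext
    · simp
    · intro j
      simp only [AlgHom.comp_apply, s_y]
      congr 1
      simp only [Equiv.swap_apply_def]
      split_ifs <;> omega
  exact DFunLike.congr_fun this F

theorem s_comm {i j : ℕ} (h : i + 1 < j) (F : W) : s i (s j F) = s j (s i F) := by
  have : (s i).comp (s j) = (s j).comp (s i) := by
    apply hom_ext
    · simp
    · intro j
      simp only [AlgHom.comp_apply, s_y]
      congr 1
      simp only [Equiv.swap_apply_def]
      split_ifs <;> omega
  exact DFunLike.congr_fun this F

theorem y_sub_ne_zero {i j : ℕ} (h : i ≠ j) : y i - y j ≠ 0 :=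
  sub_ne_zero.2 fun h' => h (y_injective h')

theorem y_succ_sub_ne_zero (i : ℕ) : y (i + 1) - y i ≠ 0 := y_sub_ne_zero i.succ_ne_self

theorem dvd_sub_s (i : ℕ) (F : W) : y (i + 1) - y i ∣ F - s i F := by
  rw [← Ideal.mem_span_singleton]
  refine Ideal.Quotient.eq.1 ?_
  set I : Ideal W := Ideal.span {y (i + 1) - y i}
  have hij : Ideal.Quotient.mk I (y (i + 1)) = Ideal.Quotient.mk I (y i) :=
    Ideal.Quotient.eq.2 (Ideal.mem_span_singleton_self _)
  have h : Ideal.Quotient.mkₐ K I = (Ideal.Quotient.mkₐ K I).comp (s i) := by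
    refine hom_ext (R := W ⧸ I) (fun n => ?_) fun a => ?_
    · rw [AlgHom.comp_apply, s_p]
    simp only [AlgHom.comp_apply, s_y, Ideal.Quotient.mkₐ_eq_mk]
    by_cases h1 : a = i
    · rw [h1, Equiv.swap_apply_left, hij]
    · by_cases h2 : a = i + 1
      · rw [h2, Equiv.swap_apply_right, hij]
      · rw [Equiv.swap_apply_of_ne_of_ne h1 h2]
  exact DFunLike.congr_fun h F

theorem exists_T (i : ℕ) (F : W) : ∃ G : W, (y (i + 1) - y i) * G =
    (qc - 1) * y i * F + (y (i + 1) - qc * y i) * s i F := by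
  obtain ⟨H, hH⟩ := dvd_sub_s i F
  exact ⟨s i F + (qc - 1) * y i * H, by linear_combination -(qc - 1) * y i * hH⟩

theorem qc_mul (F : W) : qc * F = q • F := (Algebra.smul_def q F).symm

theorem exists_T_linear (i : ℕ) : ∃ f : W →ₗ[K] W, ∀ F, (y (i + 1) - y i) * f F =
    (qc - 1) * y i * F + (y (i + 1) - qc * y i) * s i F := by
  choose f hf using exists_T i
  refine ⟨{ toFun := f, map_add' := fun F G => ?_, map_smul' := fun c F => ?_ }, hf⟩
  · apply mul_left_cancel₀ (y_succ_sub_ne_zero i)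
    rw [mul_add, hf, hf, hf, map_add]
    ring
  · apply mul_left_cancel₀ (y_succ_sub_ne_zero i)
    rw [mul_smul_comm, hf, RingHom.id_apply, hf, map_smul, smul_add, mul_smul_comm, mul_smul_comm]

/-- The Demazure–Lusztig operator `T_i` in the variables `y_i`, `y_{i+1}`. -/
def T (i : ℕ) : W →ₗ[K] W := (exists_T_linear i).choose

theorem T_spec (i : ℕ) (F : W) : (y (i + 1) - y i) * T i F =
    (qc - 1) * y i * F + (y (i + 1) - qc * y i) * s i F :=
  (exists_T_linear i).choose_spec F

theorem T_unique {i : ℕ} {F G : W} (h : (y (i + 1) - y i) * G =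
    (qc - 1) * y i * F + (y (i + 1) - qc * y i) * s i F) : T i F = G := by
  apply mul_left_cancel₀ (y_succ_sub_ne_zero i)
  rw [T_spec, h]

/-- `T_i` commutes with the linear maps that commute with `y_i`, `y_{i+1}` and their exchange. -/
theorem T_comm (i : ℕ) (φ : W →ₗ[K] W) (h0 : ∀ F, φ (y i * F) = y i * φ F)
    (h1 : ∀ F, φ (y (i + 1) * F) = y (i + 1) * φ F) (hs : ∀ F, φ (s i F) = s i (φ F)) (F : W) :
    φ (T i F) = T i (φ F) := by
  symm
  apply T_unique
  have h := congrArg φ (T_spec i F)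
  have hq : ∀ F, φ (qc * F) = qc * φ F := fun F => by rw [qc_mul, qc_mul, map_smul]
  simp only [sub_mul, one_mul, map_add, map_sub, mul_assoc, h0, h1, hq, hs] at h ⊢
  exact h

/-- The quadratic relation (T_i - 1)(T_i + q) = 0; it makes T_i invertible. -/
theorem T_T (i : ℕ) (F : W) : T i (T i F) = (1 - qc) * T i F + qc * F := by
  apply T_unique
  have h := congrArg (s i) (T_spec i F)
  simp only [map_mul, map_sub, map_add, s_y_left, s_y_right, s_s, endHom_qc, map_one] at h
  apply mul_left_cancel₀ (y_succ_sub_ne_zero i)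
  linear_combination (1 - qc) * y (i + 1) * T_spec i F + (y (i + 1) - qc * y i) * h

theorem T_braid (i : ℕ) (F : W) : T i (T (i + 1) (T i F)) = T (i + 1) (T i (T (i + 1) F)) := by
  have n1 := y_succ_sub_ne_zero i
  have n2 := y_succ_sub_ne_zero (i + 1)
  have n3 : y (i + 2) - y i ≠ 0 := y_sub_ne_zero (by omega)
  have e0 : s i (y (i + 2)) = y (i + 2) := s_y_of_ne (by omega) (by omega)
  have e1 : s (i + 1) (y i) = y i := s_y_of_ne (by omega) (by omega)
  have e2 : s (i + 1) (y (i + 2)) = y (i + 1) := s_y_right (i + 1)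
  have e3 : s (i + 1) (y (i + 1)) = y (i + 2) := s_y_left (i + 1)
  have eL := T_spec i (T (i + 1) (T i F))
  have eP2 := T_spec (i + 1) (T i F)
  have eP1 := T_spec i F
  have e2P1 := congrArg (s (i + 1)) eP1
  have e1P2 := congrArg (s i) eP2
  have e1P1 := congrArg (s i) eP1
  have e12P1 := congrArg (s i) e2P1
  have eR := T_spec (i + 1) (T i (T (i + 1) F))
  have eQ2 := T_spec i (T (i + 1) F)
  have eQ1 := T_spec (i + 1) F
  have e1Q1 := congrArg (s i) eQ1
  have e2Q2 := congrArg (s (i + 1)) eQ2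
  have e2Q1 := congrArg (s (i + 1)) eQ1
  have e21Q1 := congrArg (s (i + 1)) e1Q1
  simp only [map_mul, map_sub, map_add, s_y_left, s_y_right, s_s, endHom_qc, map_one, e0, e1, e2,
    e3, add_assoc, Nat.reduceAdd, s_braid] at eL eP2 eP1 e2P1 e1P2 e1P1 e12P1 eR eQ2 eQ1 e1Q1 e2Q2 e2Q1 e21Q1
  generalize y i = x at *
  generalize y (i + 1) = u at *
  generalize y (i + 2) = z at *
  -- The factor clears all denominators. Each hypothesis is the defining relation of one application
  -- of T, or its image under a permutation of the three variables; the coefficients below eliminate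
  -- the inner values of T one after another, until only the six permuted copies of F are left.
  apply mul_left_cancel₀ (mul_ne_zero (pow_ne_zero 2 n1) (mul_ne_zero (pow_ne_zero 2 n2) n3))
  linear_combination (u - x) * (z - u) ^ 2 * (z - x) * eL +
    (u - x) * (z - u) * (z - x) * (qc - 1) * x * eP2 +
    (z - u) * (z - x) * (qc - 1) ^ 2 * x * u * eP1 +
    (u - x) * (z - u) * (qc - 1) * x * (z - qc * u) * e2P1 +
    (u - x) * (z - u) ^ 2 * (u - qc * x) * e1P2 -
    (z - u) ^ 2 * (u - qc * x) * (qc - 1) * x * e1P1 +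
    (u - x) * (z - u) * (u - qc * x) * (z - qc * x) * e12P1 -
    (u - x) ^ 2 * (z - u) * (z - x) * eR -
    (u - x) * (z - u) * (z - x) * (qc - 1) * u * eQ2 -
    (u - x) * (z - x) * (qc - 1) ^ 2 * x * u * eQ1 -
    (u - x) * (z - u) * (qc - 1) * u * (u - qc * x) * e1Q1 -
    (u - x) ^ 2 * (z - u) * (z - qc * u) * e2Q2 +
    (u - x) ^ 2 * (z - qc * u) * (qc - 1) * x * e2Q1 -
    (u - x) * (z - u) * (z - qc * u) * (z - qc * x) * e21Q1
end W
end SweepProcess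
end

/-! ### Plethystic substitutions and their relations with the Hecke operators -/

noncomputable section
namespace SweepProcess
namespace W

open Polynomial (C X)

instance : CommRing (Polynomial W) := Polynomial.commRing
instance : CommRing (Polynomial (Polynomial W)) := Polynomial.commRing

theorem T_y_left (i : ℕ) (F : W) : T i (y i * F) = y (i + 1) * T i F - (qc - 1) * y i * F := by
  apply T_unique
  rw [map_mul, s_y_left]
  linear_combination y (i + 1) * T_spec i F

theorem T_y_of_ne {i j : ℕ} (h : j ≠ i) (h' : j ≠ i + 1) (F : W) : T i (y j * F) = y j * T i F :=
  (T_comm i (LinearMap.mulLeft K (y j)) (fun F => mul_left_comm _ _ _) (fun F => mul_left_comm _ _ _)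
    (fun F => by rw [LinearMap.mulLeft_apply, LinearMap.mulLeft_apply, map_mul, s_y_of_ne h h']) F).symm

theorem T_s_comm {i j : ℕ} (h : i + 1 < j) (F : W) : s j (T i F) = T i (s j F) :=
  T_comm i (s j).toLinearMap
    (fun F => by
      rw [AlgHom.toLinearMap_apply, AlgHom.toLinearMap_apply, map_mul,
        s_y_of_ne (by omega) (by omega)])
    (fun F => by
      rw [AlgHom.toLinearMap_apply, AlgHom.toLinearMap_apply, map_mul,
        s_y_of_ne (by omega) (by omega)])
    (fun F => (s_comm h F).symm) F

theorem T_T_comm {i j : ℕ} (h : i + 1 < j) (F : W) : T i (T j F) = T j (T i F) :=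
  T_comm j (T i) (fun F => T_y_of_ne (by omega) (by omega) F)
    (fun F => T_y_of_ne (by omega) (by omega) F) (fun F => (T_s_comm h F).symm) F

/-- The inverse of `T_i`. -/
def Tinv (i : ℕ) : W →ₗ[K] W := q⁻¹ • (T i + (q - 1) • LinearMap.id)

theorem q_ne_zero : q ≠ 0 := by
  have h : Function.Injective (algebraMap (MvPolynomial (Fin 2) ℚ) K) :=
    IsFractionRing.injective (MvPolynomial (Fin 2) ℚ) K
  rw [q, map_ne_zero_iff _ h]
  exact MvPolynomial.X_ne_zero 0

theorem T_T_smul (i : ℕ) (F : W) : T i (T i F) = (1 - q) • T i F + q • F := by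
  rw [T_T, sub_mul, one_mul, qc_mul, qc_mul, sub_smul, one_smul]

theorem Tinv_T (i : ℕ) (F : W) : Tinv i (T i F) = F := by
  simp only [Tinv, LinearMap.smul_apply, LinearMap.add_apply, LinearMap.id_apply, T_T_smul]
  rw [show (1 - q) • T i F + q • F + (q - 1) • T i F = q • F by module, smul_smul,
    inv_mul_cancel₀ q_ne_zero, one_smul]

theorem T_Tinv (i : ℕ) (F : W) : T i (Tinv i F) = F := by
  simp only [Tinv, LinearMap.smul_apply, LinearMap.add_apply, LinearMap.id_apply, map_add, map_smul,
    T_T_smul]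
  rw [show (1 - q) • T i F + q • F + (q - 1) • T i F = q • F by module, smul_smul,
    inv_mul_cancel₀ q_ne_zero, one_smul]

theorem Tinv_comm {i j : ℕ} (φ : W →ₗ[K] W) (h : ∀ F, φ (T i F) = T j (φ F)) (F : W) :
    φ (Tinv i F) = Tinv j (φ F) := by
  rw [← Tinv_T j (φ (Tinv i F)), ← h, T_Tinv]

/-- `F ↦ F[X + (q - 1) y_k]`. -/
def add (k : ℕ) : W →ₐ[K] W := lift (fun n => p n + (qc ^ (n : ℕ) - 1) * y k ^ (n : ℕ)) y

@[simp] theorem add_p (k : ℕ) (n : ℕ+) :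
    add k (p n) = p n + (qc ^ (n : ℕ) - 1) * y k ^ (n : ℕ) := lift_p _ _ _
@[simp] theorem add_y (k i : ℕ) : add k (y i) = y i := lift_y _ _ _

/-- `F ↦ F[X - (q - 1) y_k]`, as a polynomial in `y_k`. -/
def sub (k : ℕ) : W →ₐ[K] Polynomial W :=
  lift (fun n => C (p n) - C (qc ^ (n : ℕ) - 1) * X ^ (n : ℕ)) fun i => if i = k then X else C (y i)

@[simp] theorem sub_p (k : ℕ) (n : ℕ+) :
    sub k (p n) = C (p n) - C (qc ^ (n : ℕ) - 1) * X ^ (n : ℕ) := lift_p _ _ _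
theorem sub_y (k i : ℕ) : sub k (y i) = if i = k then X else C (y i) := lift_y _ _ _
@[simp] theorem sub_y_self (k : ℕ) : sub k (y k) = X := by rw [sub_y, if_pos rfl]
theorem sub_y_of_ne {k i : ℕ} (h : i ≠ k) : sub k (y i) = C (y i) := by rw [sub_y, if_neg h]

/-- The linear functional `z ^ n ↦ a n` on polynomials in `z`. -/
def pair {R : Type*} [CommRing R] (a : ℕ → R) : Polynomial R →ₗ[R] R :=
  Polynomial.lsum fun n => LinearMap.mulRight R (a n)

section Pair

variable {R S : Type*} [CommRing R] [CommRing S]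

theorem pair_monomial (a : ℕ → R) (n : ℕ) (c : R) : pair a (Polynomial.monomial n c) = c * a n := by
  rw [pair, Polynomial.lsum_apply, Polynomial.sum_monomial_index _ _ (by simp)]
  simp

theorem pair_C (a : ℕ → R) (c : R) : pair a (C c) = c * a 0 := by
  rw [← Polynomial.monomial_zero_left, pair_monomial]

theorem pair_C_mul (a : ℕ → R) (c : R) (f : Polynomial R) : pair a (C c * f) = c * pair a f := by
  rw [← Polynomial.smul_eq_C_mul, map_smul, smul_eq_mul]

theorem map_pair (a : ℕ → R) (φ : R →+* S) (f : Polynomial R) :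
    φ (pair a f) = pair (fun n => φ (a n)) (f.map φ) := by
  induction f using Polynomial.induction_on' with
  | add f g hf hg => simp only [map_add, Polynomial.map_add, hf, hg]
  | monomial n c => rw [pair_monomial, Polynomial.map_monomial, pair_monomial, map_mul]

theorem hom_pair [Algebra K R] [Algebra K S] (a : ℕ → R) (φ : R →ₐ[K] S) (f : Polynomial R) :
    φ (pair a f) = pair (fun n => φ (a n)) (Polynomial.mapAlgHom φ f) :=
  map_pair a φ.toRingHom f

/-- Multiplication by X shifts the sequence. This carries an identity (1 - uz) A(z) = (1 - vz) B(z)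
between generating functions, up to the constant terms, over to the functionals defined by their
coefficients. -/
theorem pair_X_sub_C {a b : ℕ → R} {u v : R} (h : ∀ n, a (n + 1) - u * a n = b (n + 1) - v * b n)
    (f : Polynomial R) : pair a ((X - C u) * f) = pair b ((X - C v) * f) := by
  induction f using Polynomial.induction_on' with
  | add f g hf hg => simp only [mul_add, map_add, hf, hg]
  | monomial n c =>
    simp only [sub_mul, map_sub, pair_C_mul, Polynomial.X_mul_monomial, pair_monomial]
    linear_combination c * h n

end Pair

/-- `(-1) ^ n e_n[X]`. -/
def a (n : ℕ) : W := MvPolynomial.C (signedElem n)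

theorem a_zero : a 0 = 1 := by rw [a, signedElem_zero, map_one]

/-- The operator `d_-` from level `k + 1` to level `k`. -/
def del (k : ℕ) : W →ₗ[K] W := (pair a).restrictScalars K ∘ₗ (sub k).toLinearMap

theorem del_apply (k : ℕ) (F : W) : del k F = pair a (sub k F) := rfl

theorem hom_a {R : Type*} [CommRing R] [Algebra K R] {f g : W →ₐ[K] R} (h : ∀ n, f (p n) = g (p n))
    (n : ℕ) : f (a n) = g (a n) := hom_signedElem_congr f g h n

theorem del_y_of_ne {k j : ℕ} (h : j ≠ k) (F : W) : del k (y j * F) = y j * del k F := by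
  rw [del_apply, map_mul, sub_y_of_ne h, pair_C_mul, del_apply]

/-- A homomorphism that fixes the power sums fixes the coefficients `a n` too, so only its effect on
the variables needs to be checked. -/
theorem del_hom_comm {k k' : ℕ} (f f' : W →ₐ[K] W) (hp : ∀ n, f (p n) = p n)
    (hp' : ∀ n, f' (p n) = p n)
    (h : ∀ i, sub k' (f (y i)) = Polynomial.mapAlgHom f' (sub k (y i))) (F : W) :
    del k' (f F) = f' (del k F) := by
  have e : (sub k').comp f = (Polynomial.mapAlgHom f').comp (sub k) := by
    refine hom_ext (R := Polynomial W) (fun n => ?_) h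
    simp [hp, hp']
  have e' : sub k' (f F) = (sub k F).map f'.toRingHom := DFunLike.congr_fun e F
  rw [del_apply, del_apply, e']
  refine Eq.trans ?_ (map_pair a f'.toRingHom _).symm
  congr 2
  ext1 n
  exact (hom_a (f := f') (g := AlgHom.id K W) hp' n).symm

theorem del_s {k i : ℕ} (h : i + 1 < k) (F : W) : del k (s i F) = s i (del k F) := by
  apply del_hom_comm
  · simp
  · simp
  · intro j
    simp only [s_y, sub_y]
    by_cases hj : j = k
    · rw [if_pos hj, if_pos (by rw [Equiv.swap_apply_def]; split_ifs <;> omega)]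
      simp
    · rw [if_neg hj, if_neg (by rw [Equiv.swap_apply_def]; split_ifs <;> omega)]
      simp [s_y]

theorem del_T {k i : ℕ} (h : i + 1 < k) (F : W) : del k (T i F) = T i (del k F) :=
  T_comm i (del k) (fun F => del_y_of_ne (by omega) F) (fun F => del_y_of_ne (by omega) F) (del_s h) F

theorem add_s {k i : ℕ} (h : i + 1 < k) (F : W) : add k (s i F) = s i (add k F) := by
  have : (add k).comp (s i) = (s i).comp (add k) := by
    apply hom_ext
    · intro n
      simp [s_y_of_ne (show k ≠ i by omega) (show k ≠ i + 1 by omega)]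
    · intro j; simp [s_y]
  exact DFunLike.congr_fun this F

theorem add_T {k i : ℕ} (h : i + 1 < k) (F : W) : add k (T i F) = T i (add k F) :=
  T_comm i (add k).toLinearMap (fun F => by simp) (fun F => by simp) (add_s h) F

/-- The elimination of the variables `y_i`, `i ≥ k`. -/
def kill (k : ℕ) : W →ₐ[K] W := lift p fun i => if i < k then y i else 0

@[simp] theorem kill_p (k : ℕ) (n : ℕ+) : kill k (p n) = p n := lift_p _ _ _
theorem kill_y (k i : ℕ) : kill k (y i) = if i < k then y i else 0 := lift_y _ _ _

/-- `F` involves only the variables `y_i`, `i < k`. -/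
def Level (k : ℕ) (F : W) : Prop := kill k F = F

theorem Level.add_left {k : ℕ} {F : W} (h : Level k F) : Level (k + 1) (add k F) := by
  have : (kill (k + 1)).comp ((add k).comp (kill k)) = (add k).comp (kill k) := by
    apply hom_ext
    · intro n; simp [kill_y]
    · intro i
      simp only [AlgHom.comp_apply, kill_y]
      split_ifs with h1
      · simp [kill_y, show i < k + 1 by omega]
      · simp
  have h2 := DFunLike.congr_fun this F
  simp only [AlgHom.comp_apply] at h2
  rwa [h] at h2

theorem Level.T {k i : ℕ} (hi : i + 1 < k) {F : W} (h : Level k F) : Level k (T i F) := by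
  have hs : ∀ F, kill k (s i F) = s i (kill k F) := by
    intro F
    have : (kill k).comp (s i) = (s i).comp (kill k) := by
      apply hom_ext
      · simp
      · intro j
        simp only [AlgHom.comp_apply, s_y, kill_y]
        by_cases hj : j < k
        · rw [if_pos hj, if_pos (by rw [Equiv.swap_apply_def]; split_ifs <;> omega), s_y]
        · rw [if_neg hj, if_neg (by rw [Equiv.swap_apply_def]; split_ifs <;> omega), map_zero]
    exact DFunLike.congr_fun this F
  have := T_comm i (kill k).toLinearMap (fun F => by simp [kill_y, show i < k by omega])
    (fun F => by simp [kill_y, show i + 1 < k by omega]) hs F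
  simp only [AlgHom.toLinearMap_apply] at this
  rw [Level, this, h]

theorem Level.Tinv {k i : ℕ} (hi : i + 1 < k) {F : W} (h : Level k F) : Level k (Tinv i F) := by
  simp only [Level, W.Tinv, LinearMap.smul_apply, LinearMap.add_apply, LinearMap.id_apply, map_smul,
    map_add]
  rw [show kill k F = F from h, show kill k (W.T i F) = W.T i F from h.T hi]

theorem Level.y_mul {k i : ℕ} (hi : i < k) {F : W} (h : Level k F) : Level k (y i * F) := by
  rw [Level, map_mul, kill_y, if_pos hi, h]

theorem Level.del {k : ℕ} {F : W} (h : Level (k + 1) F) : Level k (del k F) := by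
  have e : ∀ F, W.del k (kill (k + 1) F) = kill k (W.del k F) := by
    intro F
    apply del_hom_comm
    · simp
    · simp
    · intro j
      simp only [kill_y, sub_y]
      by_cases h1 : j = k
      · simp [h1]
      · by_cases h2 : j < k
        · simp [h1, h2, show j < k + 1 by omega, sub_y_of_ne h1, kill_y]
        · simp [h1, h2, show ¬ j < k + 1 by omega, kill_y]
  rw [Level, ← e, h]

theorem CAlgHom_apply (F : W) : Polynomial.CAlgHom (R := K) (A := W) F = C F := rfl

/-- If F does not involve y_k, then adding (q - 1) y_k to the alphabet and subtracting it again
cancel. Consequently `del` is a left inverse of `add`. -/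
theorem sub_add {k : ℕ} {F : W} (h : Level k F) : sub k (add k F) = C F := by
  have e : (sub k).comp ((add k).comp (kill k)) =
      (Polynomial.CAlgHom (R := K) (A := W)).comp (kill k) := by
    refine hom_ext (R := Polynomial W) (fun n => ?_) fun i => ?_
    · simp only [AlgHom.comp_apply, kill_p, add_p, map_add, map_mul, map_sub, map_pow, map_one, sub_p,
        polyHom_qc, sub_y_self, CAlgHom_apply]
      ring
    · simp only [AlgHom.comp_apply, kill_y]
      split_ifs with h1
      · simp only [add_y, sub_y_of_ne (show i ≠ k by omega), CAlgHom_apply]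
      · simp
  have h2 := DFunLike.congr_fun e F
  simp only [AlgHom.comp_apply] at h2
  rw [h] at h2
  exact h2

theorem del_add {k : ℕ} {F : W} (h : Level k F) : del k (add k F) = F := by
  rw [del_apply, sub_add h, pair_C, a_zero, mul_one]

theorem hom_a_shift {R : Type*} [CommRing R] [Algebra K R] (f g : W →ₐ[K] R) (x z : R)
    (h : ∀ n : ℕ+, f (p n) = g (p n) + x ^ (n : ℕ) - z ^ (n : ℕ)) (n : ℕ) :
    f (a (n + 1)) - z * f (a n) = g (a (n + 1)) - x * g (a n) :=
  hom_signedElem_shift f g x z h n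

theorem add_a (k n : ℕ) : add k (a (n + 1)) - y k * add k (a n) = a (n + 1) - qc * y k * a n :=
  hom_a_shift (add k) (AlgHom.id K W) (qc * y k) (y k)
    (fun n => by simp only [add_p, AlgHom.id_apply]; ring) n

theorem sub_a (k n : ℕ) :
    sub k (a (n + 1)) - C qc * X * sub k (a n) = C (a (n + 1)) - X * C (a n) := by
  have h := hom_a_shift (R := Polynomial W) (sub k) (Polynomial.CAlgHom (R := K) (A := W)) X
    (C qc * X)
    (fun n => by
      rw [sub_p, CAlgHom_apply, Polynomial.C_sub, Polynomial.C_pow, Polynomial.C_1]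
      ring) n
  simpa only [CAlgHom_apply] using h

/-- `F[X + (q - 1) y_k - (q - 1) z; …, y_k = z]` as a polynomial in `z`. -/
theorem sub_s_add {k : ℕ} {G : W} (h : Level (k + 1) G) :
    sub (k + 1) (s k (add (k + 1) G)) = (sub k G).map (add k).toRingHom := by
  have e : (sub (k + 1)).comp ((s k).comp ((add (k + 1)).comp (kill (k + 1)))) =
      (Polynomial.mapAlgHom (add k)).comp ((sub k).comp (kill (k + 1))) := by
    refine hom_ext (R := Polynomial W) (fun n => ?_) fun i => ?_
    · have h1 : sub (k + 1) (y k) = C (y k) := sub_y_of_ne (by omega)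
      simp only [AlgHom.comp_apply, kill_p, add_p, map_add, map_mul, map_sub, map_pow, map_one, sub_p,
        endHom_qc, polyHom_qc, s_p, s_y_right, h1, Polynomial.coe_mapAlgHom, Polynomial.map_X,
        Polynomial.map_C,
        AlgHom.coe_toRingHom]
      ring
    · simp only [AlgHom.comp_apply, kill_y]
      split_ifs with h1
      · by_cases h2 : i = k
        · subst h2
          simp
        · simp [s_y_of_ne h2 h1.ne, sub_y_of_ne h1.ne, sub_y_of_ne h2]
      · simp
  have h2 := DFunLike.congr_fun e G
  simp only [AlgHom.comp_apply] at h2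
  rw [h] at h2
  exact h2

/-- The alphabet is X + (q - 1) y_k - (q - 1) z, where z also stands in the place of y_k; at z = y_k
the two corrections cancel and G reappears. -/
theorem eval_sub_s_add {k : ℕ} {G : W} (h : Level (k + 1) G) :
    (sub (k + 1) (s k (add (k + 1) G))).eval (y k) = G := by
  have e : ((Polynomial.aeval (R := W) (y k)).restrictScalars K).comp ((sub (k + 1)).comp
      ((s k).comp ((add (k + 1)).comp (kill (k + 1))))) = kill (k + 1) := by
    refine hom_ext (fun n => ?_) fun i => ?_
    · have h1 : sub (k + 1) (y k) = C (y k) := sub_y_of_ne (by omega)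
      simp [h1]
    · simp only [AlgHom.comp_apply, kill_y]
      split_ifs with h1
      · by_cases h2 : i = k
        · subst h2
          simp
        · simp [s_y_of_ne h2 h1.ne, sub_y_of_ne h1.ne]
      · simp
  have h2 := DFunLike.congr_fun e G
  simp only [AlgHom.comp_apply] at h2
  rw [h] at h2
  exact h2

/-- Let f(z) be the polynomial of `sub_s_add`, so f(y_k) = G. The formula for T_k gives G + (z - q
y_k)(f - G)/(z - y_k). By `add_a`, pairing a multiple of z - q y_k with `a` is the same as pairing
the corresponding multiple of z - y_k with the coefficients at the enlarged alphabet. So the two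
copies of G cancel and f remains, paired with these coefficients. -/
theorem del_T_add {k : ℕ} {G : W} (h : Level (k + 1) G) :
    del (k + 1) (T k (add (k + 1) G)) = add k (del k G) := by
  set f := sub (k + 1) (s k (add (k + 1) G)) with hf
  have hG : sub (k + 1) (add (k + 1) G) = C G := sub_add h
  have hev := eval_sub_s_add h
  rw [← hf] at hev
  obtain ⟨g, hg⟩ : X - C (y k) ∣ f - C G := by
    rw [← hev]
    exact Polynomial.X_sub_C_dvd_sub_C_eval
  have hT : sub (k + 1) (T k (add (k + 1) G)) = C G + (X - C (qc * y k)) * g := by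
    have h1 := congrArg (sub (k + 1)) (T_spec k (add (k + 1) G))
    simp only [map_mul, map_sub, map_add, map_one, polyHom_qc, sub_y_self,
      sub_y_of_ne (show k ≠ k + 1 by omega), hG, ← hf] at h1
    have h2 : (X - C (y k) : Polynomial W) ≠ 0 := Polynomial.X_sub_C_ne_zero _
    apply mul_left_cancel₀ h2
    rw [h1, Polynomial.C_mul]
    linear_combination (X - C qc * C (y k)) * hg
  have h3 : pair (fun n => add k (a n)) f = add k (del k G) := by
    rw [hf, sub_s_add h]
    exact (map_pair a (add k).toRingHom (sub k G)).symm
  rw [← h3, del_apply, hT, map_add, pair_C, a_zero, ← pair_X_sub_C (add_a k), ← hg, map_sub, pair_C,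
    a_zero, map_one]
  ring

/-- `F ↦ F[X - (q - 1) y_k - (q - 1) y_{k+1}]`, as a polynomial in `y_k` and `y_{k+1}`. -/
def subSub (k : ℕ) : W →ₐ[K] Polynomial (Polynomial W) :=
  (Polynomial.mapAlgHom (sub k)).comp (sub (k + 1))

theorem subSub_p (k : ℕ) (n : ℕ+) : subSub k (p n) = C (C (p n)) -
    (C (C qc) ^ (n : ℕ) - 1) * C X ^ (n : ℕ) - (C (C qc) ^ (n : ℕ) - 1) * X ^ (n : ℕ) := by
  simp [subSub]

theorem subSub_y_left (k : ℕ) : subSub k (y k) = C X := by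
  simp [subSub, sub_y_of_ne (show k ≠ k + 1 by omega)]

theorem subSub_y_right (k : ℕ) : subSub k (y (k + 1)) = X := by
  simp [subSub]

theorem subSub_y_of_ne {k i : ℕ} (h : i ≠ k) (h' : i ≠ k + 1) : subSub k (y i) = C (C (y i)) := by
  simp [subSub, sub_y_of_ne h, sub_y_of_ne h']

theorem subSub_qc (k : ℕ) : subSub k qc = C (C qc) := by
  simp [subSub]

/-- The exchange of the two variables of `R[X][Y]`. -/
def swapHom {R : Type*} [CommRing R] [Algebra K R] :
    Polynomial (Polynomial R) →ₐ[K] Polynomial (Polynomial R) :=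
  ((Polynomial.Bivariate.swap (R := R)).restrictScalars K).toAlgHom

theorem swapHom_apply {R : Type*} [CommRing R] [Algebra K R] (f : Polynomial (Polynomial R)) :
    swapHom f = Polynomial.Bivariate.swap f := rfl

theorem subSub_swap (k : ℕ) (F : W) :
    Polynomial.Bivariate.swap (subSub k (s k F)) = subSub k F := by
  rw [← swapHom_apply]
  have e : swapHom.comp ((subSub k).comp (s k)) = subSub k := by
    refine hom_ext (R := Polynomial (Polynomial W)) (fun n => ?_) fun i => ?_ <;>
    rw [AlgHom.comp_apply, AlgHom.comp_apply, swapHom_apply]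
    · rw [s_p, subSub_p]
      simp only [map_sub, map_mul, map_pow, map_one, Polynomial.Bivariate.swap_X,
        Polynomial.Bivariate.swap_Y, Polynomial.Bivariate.swap_C_C]
      ring
    · by_cases h1 : i = k
      · rw [h1, s_y_left, subSub_y_left, subSub_y_right, Polynomial.Bivariate.swap_Y]
      · by_cases h2 : i = k + 1
        · rw [h2, s_y_right, subSub_y_left, subSub_y_right, Polynomial.Bivariate.swap_X]
        · rw [s_y_of_ne h1 h2, subSub_y_of_ne h1 h2, Polynomial.Bivariate.swap_C_C]
  exact DFunLike.congr_fun e F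

/-- The same sequence is used for both variables, so the double functional is symmetric. -/
theorem pair_pair_swap (b : ℕ → W) (f : Polynomial (Polynomial W)) :
    pair b (pair (fun n => C (b n)) (Polynomial.Bivariate.swap f)) =
      pair b (pair (fun n => C (b n)) f) := by
  induction f using Polynomial.induction_on' with
  | add f g hf hg => simp only [map_add, hf, hg]
  | monomial n g =>
    induction g using Polynomial.induction_on' with
    | add f g hf hg => simp only [map_add, hf, hg]
    | monomial m c =>
      have : Polynomial.Bivariate.swap (Polynomial.monomial n (Polynomial.monomial m c)) =
          Polynomial.monomial m (Polynomial.monomial n c) := by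
        simp only [← Polynomial.C_mul_X_pow_eq_monomial, map_mul, map_pow, Polynomial.Bivariate.swap_X,
          Polynomial.Bivariate.swap_Y, Polynomial.Bivariate.swap_C_C]
        ring
      rw [this]
      simp only [pair_monomial, Polynomial.monomial_mul_C]
      ring

/-- The second substitution also acts on the coefficients `a n` introduced by the first, so the
double functional is not symmetric as it stands. -/
theorem del_del (k : ℕ) (F : W) :
    del k (del (k + 1) F) = pair a (pair (fun n => sub k (a n)) (subSub k F)) := by
  rw [del_apply, del_apply, hom_pair]
  rfl

/-- The antisymmetry in `y_k`, `y_{k+1}` of the kernel of `d_- d_-`. -/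
theorem del_del_eq_zero {k : ℕ} {H : W} (hH : s k H = H) :
    del k (del (k + 1) ((y (k + 1) - qc * y k) * H)) = 0 := by
  have hg := subSub_swap k H
  rw [hH] at hg
  rw [del_del, map_mul (subSub k), map_sub (subSub k), map_mul (subSub k), subSub_y_left, subSub_y_right, subSub_qc]
  generalize subSub k H = g at hg
  have h := pair_X_sub_C (a := fun n => sub k (a n)) (b := fun n => C (a n)) (u := C qc * X) (v := X)
    (sub_a k) g
  -- By `sub_a`, replacing q y_k by y_k in the factor makes up for the twist of the outer
  -- coefficients. What is left is a symmetric functional applied to y_{k+1} - y_k times a symmetric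
  -- polynomial, hence 0.
  rw [← Polynomial.C_mul, h, sub_mul, map_sub, map_sub, sub_eq_zero,
    ← pair_pair_swap, map_mul, hg, Polynomial.Bivariate.swap_Y]

/-- T_k F differs from F by y_{k+1} - q y_k times the divided difference H of F. As H is symmetric
in y_k and y_{k+1}, the difference is killed by `del_del_eq_zero`. -/
theorem del_del_T (k : ℕ) (F : W) : del k (del (k + 1) (T k F)) = del k (del (k + 1) F) := by
  obtain ⟨H, hH⟩ := dvd_sub_s k F
  have hs : s k H = H := by
    have h := congrArg (s k) hH
    rw [map_sub, map_mul, map_sub, s_y_left, s_y_right, s_s] at h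
    apply mul_left_cancel₀ (y_succ_sub_ne_zero k)
    linear_combination h + hH
  have hT : T k F = F - (y (k + 1) - qc * y k) * H := by
    apply T_unique
    linear_combination (y (k + 1) - qc * y k) * hH
  rw [hT, map_sub, map_sub, del_del_eq_zero hs, sub_zero]

end W
end SweepProcess
end

/-! ### Entering, leaving and removing variables -/

noncomputable section
namespace SweepProcess
namespace W

/-- `T_0 T_1 ⋯ T_{k-1}`. -/
def chain : ℕ → W →ₗ[K] W
  | 0 => LinearMap.id
  | k + 1 => chain k ∘ₗ T k

theorem chain_succ (k : ℕ) (F : W) : chain (k + 1) F = chain k (T k F) := rfl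

theorem chain_T_of_gt {k j : ℕ} (h : k < j) (F : W) : chain k (T j F) = T j (chain k F) := by
  induction k generalizing F with
  | zero => rfl
  | succ k ih => rw [chain_succ, T_T_comm (by omega), ih (by omega), chain_succ]

/-- The braid relation moves T_i through T_i T_{i+1}; all the other factors commute with it or with
T_{i+1}. Thus an entering variable shifts the indices of the older ones by 1. -/
theorem chain_T {k i : ℕ} (h : i + 1 < k) (F : W) : chain k (T i F) = T (i + 1) (chain k F) := by
  induction k generalizing F with
  | zero => omega
  | succ k ih =>
    rcases (show i + 1 = k ∨ i + 1 < k by omega) with rfl | h1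
    · rw [chain_succ, chain_succ, T_braid, chain_T_of_gt (by omega), chain_succ, chain_succ]
    · rw [chain_succ, ← T_T_comm h1, ih h1, chain_succ]

theorem del_chain {k : ℕ} {j : ℕ} (h : k < j) (F : W) : del j (chain k F) = chain k (del j F) := by
  induction k generalizing F with
  | zero => rfl
  | succ k ih => rw [chain_succ, ih (by omega), del_T h, chain_succ]

theorem Level.chain {k j : ℕ} (h : k < j) {F : W} (hF : Level j F) : Level j (chain k F) := by
  induction k generalizing F with
  | zero => exact hF
  | succ k ih => exact ih (by omega) (hF.T h)

/-- The operator `d_+` from level `k` to level `k + 1`, divided by `-y_{k+1}`. -/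
def dp (k : ℕ) : W →ₗ[K] W := chain k ∘ₗ (add k).toLinearMap

theorem dp_apply (k : ℕ) (F : W) : dp k F = chain k (add k F) := rfl

/-- The operator `d_-` from level `k + 1` to level `k`, acting on multiples of `y_0 ⋯ y_k`. -/
def dm (k : ℕ) : W →ₗ[K] W := -(del k ∘ₗ LinearMap.mulLeft K (y k))

theorem dm_apply (k : ℕ) (F : W) : dm k F = -del k (y k * F) := rfl

theorem Level.eq {k : ℕ} {F : W} (h : Level k F) : kill k F = F := h

theorem Level.dp {k : ℕ} {F : W} (h : Level k F) : Level (k + 1) (dp k F) :=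
  h.add_left.chain k.lt_succ_self

theorem Level.dm {k : ℕ} {F : W} (h : Level (k + 1) F) : Level k (dm k F) := by
  have h1 : Level k (W.del k (y k * F)) := (h.y_mul k.lt_succ_self).del
  rw [Level, dm_apply, map_neg, h1.eq]

theorem dp_T {k i : ℕ} (h : i + 1 < k) (F : W) : dp k (T i F) = T (i + 1) (dp k F) := by
  rw [dp_apply, add_T h, chain_T h, dp_apply]

theorem del_dp {k : ℕ} {F : W} (h : Level (k + 1) F) :
    del (k + 1) (dp (k + 1) F) = dp k (del k F) := by
  rw [dp_apply, chain_succ, del_chain k.lt_succ_self, del_T_add h, dp_apply]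

/-- `T_{r+m-1}⁻¹ ⋯ T_r⁻¹`. -/
def invChain (r : ℕ) : ℕ → W →ₗ[K] W
  | 0 => LinearMap.id
  | m + 1 => Tinv (r + m) ∘ₗ invChain r m

theorem invChain_succ (r m : ℕ) (F : W) : invChain r (m + 1) F = Tinv (r + m) (invChain r m F) := rfl

theorem invChain_chain (k : ℕ) (F : W) : invChain 0 k (chain k F) = F := by
  induction k generalizing F with
  | zero => rfl
  | succ k ih => rw [invChain_succ, chain_succ, ih, zero_add, Tinv_T]

theorem Level.invChain {r m k : ℕ} (h : r + m < k) {F : W} (hF : Level k F) :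
    Level k (invChain r m F) := by
  induction m with
  | zero => exact hF
  | succ m ih => exact (ih (by omega)).Tinv h

/-- The removal of the variable `y_r` at level `r + m + 1`. -/
def remove (r m : ℕ) : W →ₗ[K] W := del (r + m) ∘ₗ invChain r m

theorem remove_apply (r m : ℕ) (F : W) : remove r m F = del (r + m) (invChain r m F) := rfl

theorem Level.remove {r m : ℕ} {F : W} (h : Level (r + m + 1) F) : Level (r + m) (remove r m F) := by
  have h1 : Level (r + m + 1) (W.invChain r m F) := h.invChain (by omega)
  rw [remove_apply]
  exact h1.del

theorem remove_zero (r : ℕ) (F : W) : remove r 0 F = del r F := rfl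

/-- The newest variable is y_0. The inverse Hecke operators undo the chain that brought it to the
front, and then `del` cancels `add`. -/
theorem remove_zero_dp {m : ℕ} {F : W} (h : Level m F) : remove 0 m (dp m F) = F := by
  rw [remove_apply, dp_apply, invChain_chain, zero_add, del_add h]

theorem invChain_dp {r m k : ℕ} (h : r + m < k) (F : W) :
    invChain (r + 1) m (dp k F) = dp k (invChain r m F) := by
  induction m with
  | zero => rfl
  | succ m ih =>
    rw [invChain_succ, ih (by omega), invChain_succ, add_right_comm]
    exact (Tinv_comm (dp k) (fun F => dp_T (by omega) F) _).symm

/-- The removal of an older variable does not interfere with a new one, which only shifts its index.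
-/
theorem remove_succ_dp {r m : ℕ} {F : W} (h : Level (r + m + 1) F) :
    remove (r + 1) m (dp (r + m + 1) F) = dp (r + m) (remove r m F) := by
  rw [remove_apply, invChain_dp (by omega), add_right_comm, del_dp (h.invChain (by omega)),
    remove_apply]

theorem invChain_dm {r m k : ℕ} (h : r + m < k) (F : W) :
    invChain r m (dm k F) = dm k (invChain r m F) := by
  induction m with
  | zero => rfl
  | succ m ih =>
    rw [invChain_succ, ih (by omega), invChain_succ]
    refine (Tinv_comm (dm k) (fun F => ?_) _).symm
    rw [dm_apply, dm_apply, map_neg, ← T_y_of_ne (by omega) (by omega), del_T (by omega)]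

/-- Since y_{k+1} T_k F = T_k (y_k F) + (q - 1) y_k F and T_k is invisible to the double `del`, the
factor is 1 + (q - 1). -/
theorem del_del_y_T (k : ℕ) (F : W) : del k (del (k + 1) (y (k + 1) * T k F)) =
    q • del k (del (k + 1) (y k * F)) := by
  have h : y (k + 1) * T k F = T k (y k * F) + (q - 1) • (y k * F) := by
    rw [T_y_left, sub_smul, one_smul, ← qc_mul]
    ring
  rw [h, map_add, map_add, del_del_T, map_smul, map_smul]
  module

/-- This is the source of all inversions: removing a waiting variable after an older one has left,
instead of before, costs a factor q. -/
theorem remove_dm (r m : ℕ) (F : W) :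
    remove r m (dm (r + m + 1) F) = q • dm (r + m) (remove r (m + 1) F) := by
  rw [remove_apply, invChain_dm (by omega), remove_apply, invChain_succ]
  -- Inserting T T⁻¹ moves the waiting variable past the oldest one, and brings the expression into
  -- the form of `del_del_y_T`.
  conv_lhs => rw [← T_Tinv (r + m) (invChain r m F)]
  rw [dm_apply, dm_apply, map_neg, smul_neg, del_del_y_T, ← del_y_of_ne (by omega)]
  rfl

/-- `F ↦ F[X + u]`. -/
def shift (u : K) : W →ₐ[K] W := lift (fun n => p n + algebraMap K W (u ^ (n : ℕ))) y

@[simp] theorem shift_p (u : K) (n : ℕ+) : shift u (p n) = p n + algebraMap K W (u ^ (n : ℕ)) :=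
  lift_p _ _ _
@[simp] theorem shift_y (u : K) (i : ℕ) : shift u (y i) = y i := lift_y _ _ _

theorem shift_s (u : K) (i : ℕ) (F : W) : shift u (s i F) = s i (shift u F) := by
  have : (shift u).comp (s i) = (s i).comp (shift u) := by
    refine hom_ext (fun n => ?_) fun j => ?_
    · rw [AlgHom.comp_apply, AlgHom.comp_apply, s_p, shift_p, map_add, s_p, AlgHom.commutes]
    · simp [s_y]
  exact DFunLike.congr_fun this F

theorem shift_T (u : K) (i : ℕ) (F : W) : shift u (T i F) = T i (shift u F) :=
  T_comm i (shift u).toLinearMap (fun F => by simp) (fun F => by simp) (shift_s u i) F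

theorem shift_add (u : K) (k : ℕ) (F : W) : shift u (add k F) = add k (shift u F) := by
  have : (shift u).comp (add k) = (add k).comp (shift u) := by
    refine hom_ext (fun n => ?_) fun j => ?_
    · simp only [AlgHom.comp_apply, add_p, shift_p, map_add, map_mul, map_sub, map_pow, map_one,
        endHom_qc, shift_y, AlgHom.commutes]
      ring
    · simp
  exact DFunLike.congr_fun this F

theorem shift_chain (u : K) (k : ℕ) (F : W) : shift u (chain k F) = chain k (shift u F) := by
  induction k generalizing F with
  | zero => rfl
  | succ k ih => rw [chain_succ, ih, shift_T, chain_succ]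

theorem shift_dp (u : K) (k : ℕ) (F : W) : shift u (dp k F) = dp k (shift u F) := by
  rw [dp_apply, shift_chain, shift_add, dp_apply]

theorem shift_sub (u : K) (k : ℕ) (F : W) :
    Polynomial.mapAlgHom (shift u) (sub k F) = sub k (shift u F) := by
  have : (Polynomial.mapAlgHom (shift u)).comp (sub k) = (sub k).comp (shift u) := by
    refine hom_ext (R := Polynomial W) (fun n => ?_) fun j => ?_
    · rw [AlgHom.comp_apply, AlgHom.comp_apply, shift_p, map_add (sub k), AlgHom.commutes (sub k), sub_p,
        Polynomial.coe_mapAlgHom, Polynomial.map_sub, Polynomial.map_mul, Polynomial.map_pow,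
        Polynomial.map_X, Polynomial.map_C, Polynomial.map_C, AlgHom.coe_toRingHom, shift_p,
        Polynomial.C_add, map_sub (shift u), map_pow (shift u), endHom_qc, map_one,
        show algebraMap K (Polynomial W) (u ^ (n : ℕ)) =
          Polynomial.C (algebraMap K W (u ^ (n : ℕ))) from rfl]
      ring
    · simp only [AlgHom.comp_apply, shift_y, sub_y]
      split_ifs <;> simp
  exact DFunLike.congr_fun this F

theorem shift_a (u : K) (n : ℕ) : shift u (a (n + 1)) = a (n + 1) - algebraMap K W u * a n := by
  have h := hom_a_shift (shift u) (AlgHom.id K W) (algebraMap K W u) 0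
    (fun n => by simp [zero_pow n.ne_zero]) n
  simpa using h

/-- A new letter u multiplies the generating function of the `a n` by 1 - uz, so pairing y_k f with
the new coefficients amounts to pairing (y_k - u) f with the old ones. -/
theorem shift_dm (u : K) (k : ℕ) (F : W) :
    shift u (dm k F) = dm k (shift u F) + u • del k (shift u F) := by
  have h : shift u (del k (y k * F)) = del k (y k * shift u F) - u • del k (shift u F) := by
    have h1 := pair_X_sub_C (a := fun n => shift u (a n)) (b := a) (u := 0) (v := algebraMap K W u)
      (fun n => by rw [shift_a]; ring) (sub k (shift u F))
    rw [del_apply, hom_pair, map_mul (sub k), map_mul, sub_y_self, shift_sub, del_apply, del_apply,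
      map_mul (sub k), sub_y_self, show Polynomial.mapAlgHom (shift u) Polynomial.X = Polynomial.X by simp]
    rw [Polynomial.C_0, sub_zero] at h1
    rw [h1, sub_mul, map_sub, pair_C_mul, Algebra.smul_def]
  rw [dm_apply, map_neg, h, dm_apply]
  abel

end W
end SweepProcess
end

/-! ### Words as queues, and the removal of the elements with the greatest label -/

noncomputable section
namespace SweepProcess

/-- A step of a word: an element enters the queue, or the first element leaves it. -/
inductive Step (ι : Type*)
  | opn (i : ι) : Step ι
  | cls (j : ι) : Step ι

namespace Step

variable {ι : Type*}

/-- The element that a step concerns. -/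
def elt : Step ι → ι
  | opn i => i
  | cls j => j

/-- The word turns the queue into the empty queue. -/
def Valid : List ι → List (Step ι) → Prop
  | Q, [] => Q = []
  | Q, opn i :: L => Valid (Q ++ [i]) L
  | [], cls _ :: _ => False
  | i :: Q, cls j :: L => i = j ∧ Valid Q L

/-- The elements leaving the queue. -/
def closed : List (Step ι) → List ι
  | [] => []
  | opn _ :: L => closed L
  | cls j :: L => j :: closed L

/-- The operators `d_+` and `d_-` applied along a word. -/
def run : ℕ → List (Step ι) → W →ₗ[K] W
  | _, [] => LinearMap.id
  | k, opn _ :: L => run (k + 1) L ∘ₗ W.dp k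
  | 0, cls _ :: _ => 0
  | k + 1, cls _ :: L => run k L ∘ₗ W.dm k

/-- The number of inversions of a labelling. -/
def wt (w : ι → ℕ+) : List ι → List (Step ι) → ℕ
  | _, [] => 0
  | Q, opn i :: L => wt w (Q ++ [i]) L
  | Q, cls j :: L => Q.tail.countP (fun i => w j < w i) + wt w Q.tail L

variable [DecidableEq ι]

/-- The variant of `run` in which the elements of `U` leave the queue by the operator `del`. -/
def runOn (U : Finset ι) : ℕ → List (Step ι) → W →ₗ[K] W
  | _, [] => LinearMap.id
  | k, opn _ :: L => runOn U (k + 1) L ∘ₗ W.dp k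
  | 0, cls _ :: _ => 0
  | k + 1, cls j :: L => runOn U k L ∘ₗ (if j ∈ U then W.del k else W.dm k)

/-- The number of inversions between the elements of `U` and the others, when the former have the
greatest label. -/
def wtOn (U : Finset ι) : List ι → List (Step ι) → ℕ
  | _, [] => 0
  | Q, opn i :: L => wtOn U (Q ++ [i]) L
  | Q, cls j :: L => (if j ∈ U then 0 else Q.tail.countP (fun i => i ∈ U)) + wtOn U Q.tail L

/-- The word without the elements of `U`. -/
def erase (U : Finset ι) (L : List (Step ι)) : List (Step ι) := L.filter fun e => e.elt ∉ U

theorem runOn_congr {U U' : Finset ι} (L : List (Step ι)) (h : ∀ j ∈ closed L, j ∈ U ↔ j ∈ U') (k : ℕ) :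
    runOn U k L = runOn U' k L := by
  induction L generalizing k with
  | nil => rfl
  | cons e L ih =>
    cases e with
    | opn i => rw [runOn, runOn, ih h]
    | cls j =>
      cases k with
      | zero => rfl
      | succ k =>
        have hj := h j (List.mem_cons_self ..)
        rw [runOn, runOn, ih fun i hi => h i (List.mem_cons_of_mem _ hi)]
        simp only [hj]

/-- The new letter passes freely through the entries; at each departure it leaves the choice between
`W.dm` and u `W.del`. U collects the departures of the second kind. -/
theorem shift_run (u : K) (L : List (Step ι)) (hL : (closed L).Nodup) (k : ℕ) (v : W) :
    W.shift u (run k L v) =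
      ∑ U ∈ (closed L).toFinset.powerset, u ^ U.card • runOn U k L (W.shift u v) := by
  induction L generalizing k v with
  | nil => simp [closed, run, runOn]
  | cons e L ih =>
    cases e with
    | opn i => simp only [run, runOn, closed, LinearMap.comp_apply, ih hL, W.shift_dp]
    | cls j =>
      cases k with
      | zero => simp [run, runOn]
      | succ k =>
        obtain ⟨h1, h2⟩ := List.nodup_cons.1 hL
        have h1' : j ∉ (closed L).toFinset := by simpa using h1
        simp only [run, closed, LinearMap.comp_apply, ih h2, W.shift_dm, List.toFinset_cons]
        rw [Finset.sum_powerset_insert h1', ← Finset.sum_add_distrib]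
        refine Finset.sum_congr rfl fun U hU => ?_
        have hjU : j ∉ U := fun h => h1' (Finset.mem_powerset.1 hU h)
        rw [runOn, runOn, LinearMap.comp_apply, LinearMap.comp_apply, if_neg hjU,
          if_pos (Finset.mem_insert_self j U), Finset.card_insert_of_notMem hjU,
          runOn_congr (U := insert j U) (U' := U) L (fun i hi => ?_), map_add, map_smul, smul_add,
          smul_smul, pow_succ]
        have : i ≠ j := fun h => h1 (h ▸ hi)
        simp [this]

/-- The removal of the marked elements of a queue, with `m` older elements kept. -/
def clear : ℕ → List Bool → W →ₗ[K] W
  | _, [] => LinearMap.id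
  | m, true :: Q => clear m Q ∘ₗ W.remove Q.length m
  | m, false :: Q => clear (m + 1) Q

/-- The head of the queue is the oldest element and belongs to the last variable; elements enter as
y_0. An unmarked newcomer therefore enters independently of the removals. -/
theorem clear_dp_false (Q : List Bool) (m : ℕ) (v : W) (hv : W.Level (Q.length + m) v) :
    clear m (Q ++ [false]) (W.dp (Q.length + m) v) = W.dp (Q.count false + m) (clear m Q v) := by
  induction Q generalizing m v with
  | nil => rfl
  | cons b Q ih =>
    rw [List.length_cons, add_right_comm] at hv
    cases b with
    | true =>
      simp only [List.cons_append, clear, LinearMap.comp_apply, List.length_append, List.length_cons,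
        List.length_nil]
      rw [zero_add, add_right_comm, W.remove_succ_dp hv, ih m _ hv.remove]
      simp
    | false =>
      simp only [List.cons_append, clear, List.length_cons]
      rw [add_right_comm, add_assoc, ih (m + 1) v (by rwa [← add_assoc])]
      simp only [List.count_cons_self]
      congr 2
      omega

/-- The removal of a marked newcomer cancels its entry. -/
theorem clear_dp_true (Q : List Bool) (m : ℕ) (v : W) (hv : W.Level (Q.length + m) v) :
    clear m (Q ++ [true]) (W.dp (Q.length + m) v) = clear m Q v := by
  induction Q generalizing m v with
  | nil =>
    simp only [List.nil_append, clear, LinearMap.comp_apply, List.length_nil, LinearMap.id_apply,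
      zero_add] at hv ⊢
    exact W.remove_zero_dp hv
  | cons b Q ih =>
    rw [List.length_cons, add_right_comm] at hv
    cases b with
    | true =>
      simp only [List.cons_append, clear, LinearMap.comp_apply, List.length_append, List.length_cons,
        List.length_nil]
      rw [zero_add, add_right_comm, W.remove_succ_dp hv, ih m _ hv.remove]
    | false =>
      simp only [List.cons_append, clear, List.length_cons]
      rw [add_right_comm, add_assoc, ih (m + 1) v (by rwa [← add_assoc])]

/-- Each marked element in the queue contributes a factor q from `remove_dm` when it is removed
before, instead of after, the departure of an older unmarked one. -/
theorem clear_dm (Q : List Bool) (m : ℕ) (v : W) :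
    clear m Q (W.dm (Q.length + m) v) =
      q ^ Q.count true • W.dm (Q.count false + m) (clear (m + 1) Q v) := by
  induction Q generalizing m v with
  | nil => simp [clear]
  | cons b Q ih =>
    cases b with
    | true =>
      simp only [clear, LinearMap.comp_apply, List.length_cons]
      rw [add_right_comm, W.remove_dm, map_smul, ih, smul_smul]
      simp [pow_succ']
    | false =>
      simp only [clear, List.length_cons]
      rw [add_right_comm, add_assoc, ih]
      simp only [List.count_cons_self, List.count_cons_of_ne (show (false : Bool) ≠ true by decide)]
      congr 3
      omega

/-- The operator `clear` is carried through the word as an invariant: entries of U are cancelled,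
departures of U are already part of `clear`, and every other departure yields q to the number of
elements of U that are waiting. -/
theorem runOn_eq (U : Finset ι) (L : List (Step ι)) (Q : List ι) (h : Valid Q L) (v : W)
    (hv : W.Level Q.length v) :
    runOn U Q.length L v = q ^ wtOn U Q L • run (Q.filter (· ∉ U)).length (erase U L)
      (clear 0 (Q.map (fun i => decide (i ∈ U))) v) := by
  have hcount : ∀ Q : List ι, (Q.map (fun i => decide (i ∈ U))).count false = (Q.filter (· ∉ U)).length := by
    intro Q
    rw [List.count, List.countP_map, List.countP_eq_length_filter]
    congr 2
    ext i
    simp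
  induction L generalizing Q v with
  | nil =>
    obtain rfl : Q = [] := h
    simp [runOn, wtOn, erase, run, clear]
  | cons e L ih =>
    cases e with
    | opn i =>
      have h1 := ih (Q ++ [i]) h (W.dp Q.length v) (by rw [List.length_append]; exact hv.dp)
      rw [List.length_append] at h1
      rw [runOn, LinearMap.comp_apply, wtOn]
      refine h1.trans ?_
      congr 1
      by_cases hi : i ∈ U
      · have h2 := clear_dp_true (Q.map (fun i => decide (i ∈ U))) 0 v (by simpa using hv)
        rw [List.length_map, add_zero] at h2
        simp only [List.map_append, List.map_cons, List.map_nil, hi, decide_true, h2]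
        simp [erase, elt, hi]
      · have h2 := clear_dp_false (Q.map (fun i => decide (i ∈ U))) 0 v (by simpa using hv)
        rw [List.length_map, add_zero, hcount] at h2
        simp only [List.map_append, List.map_cons, List.map_nil, hi, decide_false, h2]
        simp [erase, elt, hi, run]
    | cls j =>
      cases Q with
      | nil => exact h.elim
      | cons i Q =>
        obtain ⟨rfl, h⟩ := h
        rw [List.length_cons, runOn, LinearMap.comp_apply, wtOn, List.tail_cons]
        by_cases hi : i ∈ U
        · rw [if_pos hi, if_pos hi, zero_add, ih Q h _ hv.del]
          simp [erase, elt, hi, clear, W.remove_zero]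
        · rw [if_neg hi, if_neg hi, ih Q h _ hv.dm]
          have h2 := clear_dm (Q.map (fun i => decide (i ∈ U))) 0 v
          rw [List.length_map, add_zero, hcount] at h2
          rw [h2, map_smul, smul_smul, ← pow_add, add_comm]
          have h3 : (Q.map (fun i => decide (i ∈ U))).count true = Q.countP (fun i => i ∈ U) := by
            rw [List.count, List.countP_map]
            congr 1
            ext i
            simp
          rw [h3]
          simp [erase, elt, hi, clear, run]

theorem valid_erase (U : Finset ι) (L : List (Step ι)) (Q : List ι) (h : Valid Q L) :
    Valid (Q.filter (· ∉ U)) (erase U L) := by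
  induction L generalizing Q with
  | nil =>
    obtain rfl : Q = [] := h
    rfl
  | cons e L ih =>
    cases e with
    | opn i =>
      have h1 := ih _ h
      by_cases hi : i ∈ U
      · simpa [erase, elt, hi] using h1
      · simpa [erase, elt, hi, Valid] using h1
    | cls j =>
      cases Q with
      | nil => exact h.elim
      | cons i Q =>
        obtain ⟨rfl, h⟩ := h
        have h1 := ih _ h
        by_cases hi : i ∈ U
        · simpa [erase, elt, hi] using h1
        · simpa [erase, elt, hi, Valid] using h1

theorem closed_erase (U : Finset ι) (L : List (Step ι)) :
    closed (erase U L) = (closed L).filter (· ∉ U) := by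
  induction L with
  | nil => rfl
  | cons e L ih =>
    rw [erase] at ih
    cases e with
    | opn i => by_cases hi : i ∈ U <;> simpa [erase, elt, hi, closed] using ih
    | cls j => by_cases hj : j ∈ U <;> simpa [erase, elt, hj, closed] using ih

/-- With r the greatest label, a leaving element of U has no inversions, while any other leaving
element has one with every waiting element of U; the remaining pairs are those of the erased word.
-/
theorem wt_eq {U : Finset ι} {w w' : ι → ℕ+} {r : ℕ+} (hU : ∀ i ∈ U, w i = r) (hw : ∀ i, w i ≤ r)
    (hw' : ∀ i ∉ U, w' i = w i) (L : List (Step ι)) (h : ∀ j ∈ closed L, j ∉ U → w j < r)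
    (Q : List ι) (hL : Valid Q L) :
    wt w Q L = wtOn U Q L + wt w' (Q.filter (· ∉ U)) (erase U L) := by
  induction L generalizing Q with
  | nil => rfl
  | cons e L ih =>
    cases e with
    | opn i =>
      have h1 := ih h _ hL
      by_cases hi : i ∈ U
      · simpa [erase, elt, hi, wt, wtOn] using h1
      · simpa [erase, elt, hi, wt, wtOn] using h1
    | cls j =>
      cases Q with
      | nil => exact hL.elim
      | cons i Q =>
        obtain ⟨rfl, hL⟩ := hL
        have h1 := ih (fun j hj => h j (List.mem_cons_of_mem _ hj)) Q hL
        by_cases hi : i ∈ U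
        · have h2 : Q.countP (fun j => w i < w j) = 0 := by
            rw [List.countP_eq_zero]
            intro j _
            simpa [hU i hi] using hw j
          simp only [wt, wtOn, List.tail_cons, h2, hi, if_true, h1]
          simp [erase, elt, hi]
        · have hir := h i (List.mem_cons_self ..) hi
          have h2 : Q.countP (fun j => w i < w j) = Q.countP (fun j => j ∈ U) +
              (Q.filter (· ∉ U)).countP (fun j => w' i < w' j) := by
            clear h1 ih hL
            induction Q with
            | nil => rfl
            | cons a Q ih =>
              by_cases ha : a ∈ U
              · simp [ha, ih, hU a ha, hir]
                omega
              · simp [List.countP_cons, ha, ih, hw' a ha, hw' i hi]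
                omega
          simp only [wt, wtOn, List.tail_cons, h2, hi, if_false, h1]
          simp [erase, elt, hi, wt]
          omega

end Step
end SweepProcess
end

/-! ### Values of words at finite alphabets, and corners -/

noncomputable section
namespace SweepProcess
namespace W

/-- The evaluation at the alphabet `u l`, `l ∈ L`. -/
def ev (L : Finset ℕ+) (u : ℕ+ → K) : W →ₐ[K] K :=
  lift (fun n => ∑ l ∈ L, u l ^ (n : ℕ)) fun _ => 0

theorem ev_insert {L : Finset ℕ+} {r : ℕ+} (hr : r ∉ L) (u : ℕ+ → K) (F : W) :
    ev (insert r L) u F = ev L u (shift (u r) F) := by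
  have : ev (insert r L) u = (ev L u).comp (shift (u r)) := by
    refine hom_ext (fun n => ?_) fun i => ?_
    · rw [AlgHom.comp_apply, shift_p, map_add, AlgHom.commutes, ev, ev, lift_p, lift_p,
        Finset.sum_insert hr, add_comm]
      rfl
    · rw [AlgHom.comp_apply, shift_y, ev, ev, lift_y, lift_y]
  exact DFunLike.congr_fun this F

/-- At the empty alphabet all power sums vanish, so the generating series has derivative 0. -/
theorem ev_empty_a (u : ℕ+ → K) (n : ℕ) : ev ∅ u (a (n + 1)) = 0 := by
  have h := congrArg (fun f => ev ∅ u (MvPolynomial.C (PowerSeries.coeff n f))) derivative_pExpNeg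
  simp only [PowerSeries.coeff_derivative] at h
  rw [map_mul, map_mul, neg_mul, map_neg, map_neg, map_neg, PowerSeries.coeff_mul, map_sum, map_sum,
    Finset.sum_eq_zero] at h
  · rw [map_add, map_natCast, map_one, map_add, map_natCast, map_one, neg_zero, ← Nat.cast_succ] at h
    exact (mul_eq_zero.1 h).resolve_right (cast_succ_ne_zero n)
  · intro x _
    rw [PowerSeries.coeff_mk, map_mul, map_mul]
    have : ev ∅ u (MvPolynomial.C (MvPolynomial.X x.1.succPNat)) = 0 := by
      refine (lift_p _ _ _).trans ?_
      simp
    rw [this, zero_mul]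

theorem pair_X_mul_eq_zero {R : Type*} [CommRing R] (b : ℕ → R) (hb : ∀ n, b (n + 1) = 0)
    (f : Polynomial R) : pair b (Polynomial.X * f) = 0 := by
  induction f using Polynomial.induction_on' with
  | add f g hf hg => rw [mul_add, map_add, hf, hg, add_zero]
  | monomial n c => rw [Polynomial.X_mul_monomial, pair_monomial, hb, mul_zero]

/-- The factor y_k in `dm` ensures that only the coefficients `a (n + 1)` occur. -/
theorem ev_empty_dm (u : ℕ+ → K) (k : ℕ) (F : W) : ev ∅ u (dm k F) = 0 := by
  rw [dm_apply, map_neg, del_apply, hom_pair, map_mul (sub k), map_mul, sub_y_self,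
    show Polynomial.mapAlgHom (ev ∅ u) Polynomial.X = Polynomial.X by simp,
    pair_X_mul_eq_zero _ (ev_empty_a u), neg_zero]

end W

section Labels

variable {ι : Type*} [DecidableEq ι]

open Classical in
/-- The labellings of the elements of `I` by elements of `L`, extended by `1`. -/
def labels (I : Finset ι) (L : Finset ℕ+) : Finset (ι → ℕ+) :=
  (I.pi fun _ => L).image fun f i => if h : i ∈ I then f i h else 1

theorem mem_labels {I : Finset ι} {L : Finset ℕ+} {w : ι → ℕ+} :
    w ∈ labels I L ↔ (∀ i ∈ I, w i ∈ L) ∧ ∀ i ∉ I, w i = 1 := by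
  simp only [labels, Finset.mem_image, Finset.mem_pi]
  constructor
  · rintro ⟨f, hf, rfl⟩
    refine ⟨fun i hi => ?_, fun i hi => ?_⟩
    · simpa [hi] using hf i hi
    · simp [hi]
  · rintro ⟨h1, h2⟩
    refine ⟨fun i _ => w i, h1, ?_⟩
    funext i
    by_cases hi : i ∈ I
    · rw [dif_pos hi]
    · rw [dif_neg hi, h2 i hi]

/-- A labelling by `L ∪ {r}` amounts to the set of elements with the label `r` and a labelling of the
other elements by `L`. -/
theorem sum_labels_insert {M : Type*} [AddCommMonoid M] {I : Finset ι} {L : Finset ℕ+} {r : ℕ+}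
    (hr : r ∉ L) (f : (ι → ℕ+) → M) : ∑ w ∈ labels I (insert r L), f w =
      ∑ U ∈ I.powerset, ∑ w ∈ labels (I \ U) L, f fun i => if i ∈ U then r else w i := by
  rw [Finset.sum_sigma']
  refine Finset.sum_bij' (fun w _ => ⟨I.filter fun i => w i = r,
    fun i => if i ∈ I.filter (fun i => w i = r) then 1 else w i⟩)
    (fun x _ => fun i => if i ∈ x.1 then r else x.2 i) ?_ ?_ ?_ ?_ ?_
  · intro w hw
    obtain ⟨h1, h2⟩ := mem_labels.1 hw
    refine Finset.mem_sigma.2 ⟨Finset.mem_powerset.2 (Finset.filter_subset _ _), mem_labels.2 ⟨?_, ?_⟩⟩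
    · intro i hi
      obtain ⟨hi1, hi2⟩ := Finset.mem_sdiff.1 hi
      have h3 := h1 i hi1
      simp only [hi2, if_false]
      simp only [Finset.mem_filter, hi1, true_and] at hi2
      exact (Finset.mem_insert.1 h3).resolve_left hi2
    · intro i hi
      simp only [Finset.mem_sdiff, not_and, not_not] at hi
      by_cases h3 : i ∈ I
      · exact if_pos (hi h3)
      · simp [h3, h2 i h3]
  · rintro ⟨U, w⟩ hx
    obtain ⟨hU, hw⟩ := Finset.mem_sigma.1 hx
    obtain ⟨h1, h2⟩ := mem_labels.1 hw
    have hU' := Finset.mem_powerset.1 hU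
    refine mem_labels.2 ⟨fun i hi => ?_, fun i hi => ?_⟩
    · by_cases h3 : i ∈ U
      · simp [h3]
      · simp only [h3, if_false]
        exact Finset.mem_insert_of_mem (h1 i (Finset.mem_sdiff.2 ⟨hi, h3⟩))
    · have h3 : i ∉ U := fun h => hi (hU' h)
      simp only [h3, if_false]
      exact h2 i fun h => hi (Finset.mem_sdiff.1 h).1
  · intro w hw
    funext i
    by_cases h : i ∈ I.filter (fun i => w i = r)
    · simp only [h, if_true]
      exact ((Finset.mem_filter.1 h).2).symm
    · simp only [h, if_false]
  · rintro ⟨U, w⟩ hx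
    obtain ⟨hU, hw⟩ := Finset.mem_sigma.1 hx
    obtain ⟨h1, h2⟩ := mem_labels.1 hw
    have hU' := Finset.mem_powerset.1 hU
    have hUeq : (I.filter fun i => (if i ∈ U then r else w i) = r) = U := by
      ext i
      simp only [Finset.mem_filter]
      constructor
      · rintro ⟨hi, h⟩
        by_contra h3
        rw [if_neg h3] at h
        exact hr (h ▸ h1 i (Finset.mem_sdiff.2 ⟨hi, h3⟩))
      · intro h
        exact ⟨hU' h, if_pos h⟩
    simp only [hUeq, Sigma.mk.injEq, heq_eq_eq, true_and]
    funext i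
    by_cases h : i ∈ U
    · simp only [h, if_true]
      exact (h2 i fun h' => (Finset.mem_sdiff.1 h').2 h).symm
    · simp only [h, if_false]
  · intro w hw
    congr 1
    funext i
    by_cases h : i ∈ I.filter (fun i => w i = r)
    · simp only [h, if_true]
      exact (Finset.mem_filter.1 h).2
    · simp only [h, if_false]

end Labels

namespace Step

variable {ι : Type*}

/-- A word that empties the queue and is not trivial ends with a departure. -/
theorem ev_empty_run (u : ℕ+ → K) (L : List (Step ι)) (hL : L ≠ []) (Q : List ι) (h : Valid Q L) (v : W) :
    W.ev ∅ u (run Q.length L v) = 0 := by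
  induction L generalizing Q v with
  | nil => exact absurd rfl hL
  | cons e L ih =>
    cases e with
    | opn i =>
      have hne : L ≠ [] := by
        rintro rfl
        exact absurd h (by simp [Valid])
      have h1 := ih hne _ h (W.dp Q.length v)
      rwa [List.length_append] at h1
    | cls j =>
      cases Q with
      | nil => exact h.elim
      | cons i Q =>
        by_cases hne : L = []
        · subst hne
          exact W.ev_empty_dm u _ _
        · exact ih hne Q h.2 _

variable [DecidableEq ι]

/-- A word evaluates to the sum over the labellings, weighted by the inversions. -/
theorem ev_run (u : ℕ+ → K) (A : Finset ℕ+) (L : List (Step ι)) (hL : (closed L).Nodup)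
    (hv : Valid [] L) : W.ev A u (run 0 L 1) =
      ∑ w ∈ labels (closed L).toFinset A, q ^ wt w [] L * ∏ i ∈ (closed L).toFinset, u (w i) := by
  -- The letters are added in increasing order: the factors of `runOn_eq` count inversions only if
  -- the new label is the greatest one.
  induction A using Finset.induction_on_max generalizing L with
  | empty =>
    by_cases hne : L = []
    · subst hne
      have h1 : labels (closed ([] : List (Step ι))).toFinset ∅ = {fun _ => 1} := by
        ext w
        rw [mem_labels, Finset.mem_singleton]
        simp [closed, funext_iff]
      rw [h1]
      simp [run, closed, wt]
    · refine (ev_empty_run u L hne [] hv 1).trans ?_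
      -- If nothing ever leaves, nothing can have entered, so a nontrivial word has an element in
      -- need of a label.
      have h1 : labels (closed L).toFinset ∅ = ∅ := by
        obtain ⟨i, hi⟩ : ∃ i, i ∈ closed L := by
          by_contra hcon
          push Not at hcon
          have key : ∀ (L : List (Step ι)) (Q : List ι), Valid Q L → (∀ i, i ∉ closed L) →
              Q = [] ∧ L = [] := by
            intro L
            induction L with
            | nil => exact fun Q h _ => ⟨h, rfl⟩
            | cons e L ih =>
              intro Q h hc
              cases e with
              | opn i => exact absurd (ih _ h hc).1 (by simp)
              | cls j => exact absurd (List.mem_cons_self ..) (hc j)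
          exact hne (key L [] hv hcon).2
        rw [Finset.eq_empty_iff_forall_notMem]
        intro w hw
        exact absurd ((mem_labels.1 hw).1 i (List.mem_toFinset.2 hi)) (Finset.notMem_empty _)
      rw [h1, Finset.sum_empty]
  | insert r A hr ih =>
    have hrA : r ∉ A := fun h => lt_irrefl _ (hr r h)
    rw [W.ev_insert hrA, shift_run _ _ hL, map_sum, sum_labels_insert hrA]
    refine Finset.sum_congr rfl fun U hU => ?_
    have hU' := Finset.mem_powerset.1 hU
    have h1 := runOn_eq U L [] hv 1 (map_one _)
    have hclosed : (closed (erase U L)).toFinset = (closed L).toFinset \ U := by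
      rw [closed_erase]
      ext i
      simp
    simp only [List.length_nil, List.filter_nil, List.map_nil, clear, LinearMap.id_apply] at h1
    rw [map_one, h1, map_smul, map_smul, ih (erase U L) (by rw [closed_erase]; exact hL.filter _)
      (by simpa using valid_erase U L [] hv), hclosed, smul_eq_mul, smul_eq_mul, Finset.mul_sum,
      Finset.mul_sum]
    refine Finset.sum_congr rfl fun w hw => ?_
    obtain ⟨hw1, hw2⟩ := mem_labels.1 hw
    have h2 := wt_eq (U := U) (w := fun i => if i ∈ U then r else w i) (w' := w) (r := r)
      (fun i hi => if_pos hi)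
      (fun i => by
        by_cases hi : i ∈ U
        · simp [hi]
        · by_cases hi2 : i ∈ (closed L).toFinset
          · simpa [hi] using (hr _ (hw1 i (Finset.mem_sdiff.2 ⟨hi2, hi⟩))).le
          -- Elements outside the word carry the default label 1, which is at most r.
          · simp [hi, hw2 i (fun h => hi2 (Finset.mem_sdiff.1 h).1)])
      (fun i hi => (if_neg hi).symm) L
      (fun j hj hjU => by
        simpa [hjU] using hr _ (hw1 j (Finset.mem_sdiff.2 ⟨List.mem_toFinset.2 hj, hjU⟩)))
      [] hv
    rw [h2, List.filter_nil, ← Finset.prod_sdiff hU', pow_add]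
    have h3 : ∏ i ∈ U, u (if i ∈ U then r else w i) = u r ^ U.card := by
      rw [← Finset.prod_const]
      exact Finset.prod_congr rfl fun i hi => by rw [if_pos hi]
    have h4 : ∏ i ∈ (closed L).toFinset \ U, u (if i ∈ U then r else w i) =
        ∏ i ∈ (closed L).toFinset \ U, u (w i) :=
      Finset.prod_congr rfl fun i hi => by rw [if_neg (Finset.mem_sdiff.1 hi).2]
    rw [h3, h4]
    ring

end Step

/-- A step of a marked word: besides the steps of words, there are corners, where `j` leaves the queue and
`i` enters it under the condition that the label of `i` is the greater one, and scalars. -/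
inductive MStep (ι : Type*)
  | opn (i : ι) : MStep ι
  | cls (j : ι) : MStep ι
  | cor (i j : ι) : MStep ι
  | scal (c : K) : MStep ι

namespace MStep

variable {ι : Type*}

def Valid : List ι → List (MStep ι) → Prop
  | Q, [] => Q = []
  | Q, opn i :: L => Valid (Q ++ [i]) L
  | [], cls _ :: _ => False
  | i :: Q, cls j :: L => i = j ∧ Valid Q L
  | [], cor _ _ :: _ => False
  | i' :: Q, cor i j :: L => i' = j ∧ Valid (Q ++ [i]) L
  | Q, scal _ :: L => Valid Q L

/-- The elements leaving the queue. -/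
def closed : List (MStep ι) → List ι
  | [] => []
  | opn _ :: L => closed L
  | cls j :: L => j :: closed L
  | cor _ j :: L => j :: closed L
  | scal _ :: L => closed L

def run : ℕ → List (MStep ι) → W →ₗ[K] W
  | _, [] => LinearMap.id
  | k, opn _ :: L => run (k + 1) L ∘ₗ W.dp k
  | 0, cls _ :: _ => 0
  | k + 1, cls _ :: L => run k L ∘ₗ W.dm k
  | 0, cor _ _ :: _ => 0
  | k + 1, cor _ _ :: L =>
    run (k + 1) L ∘ₗ ((q - 1)⁻¹ • (W.dm (k + 1) ∘ₗ W.dp (k + 1) - W.dp k ∘ₗ W.dm k))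
  | k, scal c :: L => c • run k L

/-- At a corner the leaving j is not compared with the entering i: that comparison is the condition
recorded in `Ok`. -/
def wt (w : ι → ℕ+) : List ι → List (MStep ι) → ℕ
  | _, [] => 0
  | Q, opn i :: L => wt w (Q ++ [i]) L
  | Q, cls j :: L => Q.tail.countP (fun i => w j < w i) + wt w Q.tail L
  | Q, cor i j :: L => Q.tail.countP (fun i => w j < w i) + wt w (Q.tail ++ [i]) L
  | Q, scal _ :: L => wt w Q L

/-- The conditions at the corners. -/
def Ok (w : ι → ℕ+) : List (MStep ι) → Prop
  | [] => True
  | opn _ :: L => Ok w L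
  | cls _ :: L => Ok w L
  | cor i j :: L => w j < w i ∧ Ok w L
  | scal _ :: L => Ok w L

/-- The product of the scalars. -/
def coef : List (MStep ι) → K
  | [] => 1
  | opn _ :: L => coef L
  | cls _ :: L => coef L
  | cor _ _ :: L => coef L
  | scal c :: L => c * coef L

/-- A marked word as a linear combination of words. -/
def expand : List (MStep ι) → List (K × List (Step ι))
  | [] => [(1, [])]
  | opn i :: L => (expand L).map fun x => (x.1, .opn i :: x.2)
  | cls j :: L => (expand L).map fun x => (x.1, .cls j :: x.2)
  | cor i j :: L => ((expand L).map fun x => ((q - 1)⁻¹ * x.1, .opn i :: .cls j :: x.2)) ++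
      (expand L).map fun x => (-((q - 1)⁻¹ * x.1), .cls j :: .opn i :: x.2)
  | scal c :: L => (expand L).map fun x => (c * x.1, x.2)

theorem q_sub_one_ne_zero : q - 1 ≠ 0 := by
  have h : Function.Injective (algebraMap (MvPolynomial (Fin 2) ℚ) K) :=
    IsFractionRing.injective (MvPolynomial (Fin 2) ℚ) K
  rw [q, ← map_one (algebraMap (MvPolynomial (Fin 2) ℚ) K), ← map_sub, map_ne_zero_iff _ h, sub_ne_zero]
  intro h1
  have h2 := congrArg (MvPolynomial.eval fun _ => (0 : ℚ)) h1
  simp at h2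

theorem valid_expand (L : List (MStep ι)) (Q : List ι) (h : Valid Q L) :
    ∀ x ∈ expand L, Step.Valid Q x.2 ∧ Step.closed x.2 = closed L := by
  induction L generalizing Q with
  | nil =>
    intro x hx
    obtain rfl := List.mem_singleton.1 hx
    exact ⟨h, rfl⟩
  | cons e L ih =>
    cases e with
    | opn i =>
      simp only [expand, List.mem_map, forall_exists_index, and_imp]
      rintro _ x hx rfl
      exact ih _ h x hx
    | cls j =>
      cases Q with
      | nil => exact h.elim
      | cons i Q =>
        simp only [expand, List.mem_map, forall_exists_index, and_imp]
        rintro _ x hx rfl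
        have h1 := ih _ h.2 x hx
        exact ⟨⟨h.1, h1.1⟩, by rw [Step.closed, h1.2, closed]⟩
    | cor i j =>
      cases Q with
      | nil => exact h.elim
      | cons i' Q =>
        simp only [expand, List.mem_append, List.mem_map]
        rintro _ (⟨x, hx, rfl⟩ | ⟨x, hx, rfl⟩)
        all_goals
          have h1 := ih _ h.2 x hx
          exact ⟨⟨h.1, h1.1⟩, by simp only [Step.closed, h1.2, closed]⟩
    | scal c =>
      simp only [expand, List.mem_map, forall_exists_index, and_imp]
      rintro _ x hx rfl
      exact ih _ h x hx

theorem run_expand (L : List (MStep ι)) (Q : List ι) (h : Valid Q L) (v : W) :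
    run Q.length L v = ((expand L).map fun x => x.1 • Step.run Q.length x.2 v).sum := by
  induction L generalizing Q v with
  | nil => simp [run, expand, Step.run]
  | cons e L ih =>
    cases e with
    | opn i =>
      have h1 := ih _ h (W.dp Q.length v)
      rw [List.length_append] at h1
      rw [run, expand, List.map_map]
      exact h1
    | cls j =>
      cases Q with
      | nil => exact h.elim
      | cons i Q =>
        rw [List.length_cons, run, expand, List.map_map]
        exact ih _ h.2 _
    | cor i j =>
      cases Q with
      | nil => exact h.elim
      | cons i' Q =>
        have h1 := fun v => ih _ h.2 v
        simp only [List.length_append, List.length_cons, List.length_nil, zero_add] at h1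
        rw [List.length_cons, run, expand, List.map_append, List.sum_append, List.map_map, List.map_map,
          LinearMap.comp_apply, LinearMap.smul_apply, LinearMap.sub_apply, map_smul, map_sub, h1, h1,
          smul_sub, sub_eq_add_neg, ← neg_smul, List.smul_sum, List.smul_sum]
        simp only [List.map_map]
        congr 1
        · refine congrArg List.sum (List.map_congr_left fun x _ => ?_)
          simp only [Function.comp_apply, Step.run, LinearMap.comp_apply, smul_smul]
        · refine congrArg List.sum (List.map_congr_left fun x _ => ?_)
          simp only [Function.comp_apply, Step.run, LinearMap.comp_apply, smul_smul, neg_mul]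
    | scal c =>
      rw [run, expand, List.map_map, LinearMap.smul_apply, ih _ h, List.smul_sum, List.map_map]
      refine congrArg List.sum (List.map_congr_left fun x _ => ?_)
      simp only [Function.comp_apply, smul_smul]

open Classical in
-- At a corner the two words of `expand` differ in weight by the factor q^[w_j < w_i] only, and
-- (q^[w_j < w_i] - 1)/(q - 1) is 1 or 0 according to the condition of the corner.
theorem wt_expand (w : ι → ℕ+) (L : List (MStep ι)) (Q : List ι) (h : Valid Q L) :
    ((expand L).map fun x => x.1 * q ^ Step.wt w Q x.2).sum =
      if Ok w L then coef L * q ^ wt w Q L else 0 := by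
  induction L generalizing Q with
  | nil => simp [expand, Ok, coef, wt, Step.wt]
  | cons e L ih =>
    cases e with
    | opn i =>
      rw [expand, List.map_map]
      exact ih _ h
    | cls j =>
      cases Q with
      | nil => exact h.elim
      | cons i Q =>
        rw [expand, List.map_map]
        have h1 : ((fun x : K × List (Step ι) => x.1 * q ^ Step.wt w (i :: Q) x.2) ∘
            fun x : K × List (Step ι) => (x.1, .cls j :: x.2)) = fun x => q ^ (Q.countP fun i => w j < w i) *
              (x.1 * q ^ Step.wt w Q x.2) := by
          funext x
          simp only [Function.comp_apply, Step.wt, List.tail_cons, pow_add]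
          ring
        rw [h1, List.sum_map_mul_left, ih _ h.2]
        by_cases hok : Ok w L
        · rw [if_pos hok, if_pos (show Ok w (.cls j :: L) from hok), coef, wt, List.tail_cons, pow_add]
          ring
        · rw [if_neg hok, if_neg (show ¬ Ok w (.cls j :: L) from hok), mul_zero]
    | cor i j =>
      cases Q with
      | nil => exact h.elim
      | cons i' Q =>
        rw [expand, List.map_append, List.sum_append, List.map_map, List.map_map]
        have h1 : ((fun x : K × List (Step ι) => x.1 * q ^ Step.wt w (i' :: Q) x.2) ∘
            fun x : K × List (Step ι) => ((q - 1)⁻¹ * x.1, .opn i :: .cls j :: x.2)) =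
            fun x => ((q - 1)⁻¹ * q ^ ((Q ++ [i]).countP fun i => w j < w i)) *
              (x.1 * q ^ Step.wt w (Q ++ [i]) x.2) := by
          funext x
          simp only [Function.comp_apply, Step.wt, List.cons_append, List.tail_cons, pow_add]
          ring
        have h2 : ((fun x : K × List (Step ι) => x.1 * q ^ Step.wt w (i' :: Q) x.2) ∘
            fun x : K × List (Step ι) => (-((q - 1)⁻¹ * x.1), .cls j :: .opn i :: x.2)) =
            fun x => (-((q - 1)⁻¹ * q ^ (Q.countP fun i => w j < w i))) *
              (x.1 * q ^ Step.wt w (Q ++ [i]) x.2) := by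
          funext x
          simp only [Function.comp_apply, Step.wt, List.tail_cons, pow_add]
          ring
        rw [h1, h2, List.sum_map_mul_left, List.sum_map_mul_left, ih _ h.2, ← add_mul,
          List.countP_append]
        simp only [Ok, coef, wt, List.tail_cons, List.countP_singleton]
        by_cases hij : w j < w i
        · simp only [hij, decide_true, if_true, true_and]
          split_ifs
          · have := q_sub_one_ne_zero
            rw [pow_add, pow_add]
            field_simp
            ring
          · rw [mul_zero]
        · simp [hij]
    | scal c =>
      rw [expand, List.map_map]
      have h1 : ((fun x : K × List (Step ι) => x.1 * q ^ Step.wt w Q x.2) ∘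
          fun x : K × List (Step ι) => (c * x.1, x.2)) = fun x => c * (x.1 * q ^ Step.wt w Q x.2) := by
        funext x
        simp only [Function.comp_apply]
        ring
      rw [h1, List.sum_map_mul_left, ih _ h]
      by_cases hok : Ok w L
      · rw [if_pos hok, if_pos (show Ok w (.scal c :: L) from hok), coef, wt]
        ring
      · rw [if_neg hok, if_neg (show ¬ Ok w (.scal c :: L) from hok), mul_zero]

open Classical in
theorem ev_run (u : ℕ+ → K) (A : Finset ℕ+) (L : List (MStep ι)) (hL : (closed L).Nodup)
    (hv : Valid [] L) : W.ev A u (run 0 L 1) = coef L *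
      ∑ w ∈ (labels (closed L).toFinset A).filter (Ok · L),
        q ^ wt w [] L * ∏ i ∈ (closed L).toFinset, u (w i) := by
  have h1 := run_expand L [] hv 1
  rw [List.length_nil] at h1
  rw [h1, map_list_sum, List.map_map]
  have h2 : (expand L).map (W.ev A u ∘ fun x => x.1 • Step.run 0 x.2 1) =
      (expand L).map fun x => ∑ w ∈ labels (closed L).toFinset A,
        (x.1 * q ^ Step.wt w [] x.2) * ∏ i ∈ (closed L).toFinset, u (w i) := by
    refine List.map_congr_left fun x hx => ?_
    obtain ⟨h3, h4⟩ := valid_expand L [] hv x hx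
    rw [Function.comp_apply, map_smul, Step.ev_run u A x.2 (by rwa [h4]) h3, h4, smul_eq_mul,
      Finset.mul_sum]
    exact Finset.sum_congr rfl fun w _ => (mul_assoc _ _ _).symm
  rw [h2, Finset.mul_sum, Finset.sum_filter]
  have h3 : ∀ (l : List (K × List (Step ι))) (s : Finset (ι → ℕ+)) (f : K × List (Step ι) → (ι → ℕ+) → K),
      (l.map fun x => ∑ w ∈ s, f x w).sum = ∑ w ∈ s, (l.map fun x => f x w).sum := by
    intro l s f
    induction l with
    | nil => simp
    | cons x l ih => simp only [List.map_cons, List.sum_cons, ih, Finset.sum_add_distrib]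
  rw [h3]
  refine Finset.sum_congr rfl fun w _ => ?_
  rw [List.sum_map_mul_right, wt_expand w L [] hv]
  split_ifs
  · ring
  · ring

end MStep
end SweepProcess
end

/-! ### From the operators on V_* to words -/

noncomputable section
namespace SweepProcess

section VHom

variable {R : Type*} [CommRing R] [Algebra K R] {k : ℕ}

theorem V_hom_ext {f g : V k →ₐ[K] R}
    (hp : ∀ n : ℕ+, f (MvPolynomial.C (MvPolynomial.X n)) = g (MvPolynomial.C (MvPolynomial.X n)))
    (hy : ∀ i, f (MvPolynomial.X i) = g (MvPolynomial.X i)) : f = g := by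
  refine MvPolynomial.algHom_ext' ?_ hy
  exact MvPolynomial.algHom_ext hp

end VHom

/-- The inclusion of `V_k` into `W`. -/
def embed (k : ℕ) : V k →ₐ[K] W := (MvPolynomial.rename (R := SymFun) Fin.val).restrictScalars K

@[simp] theorem embed_X {k : ℕ} (i : Fin k) : embed k (MvPolynomial.X i) = W.y i :=
  MvPolynomial.rename_X _ _

@[simp] theorem embed_C {k : ℕ} (f : SymFun) : embed k (MvPolynomial.C f) = MvPolynomial.C f :=
  MvPolynomial.rename_C _ _

theorem embed_p {k : ℕ} (n : ℕ+) : embed k (MvPolynomial.C (MvPolynomial.X n)) = W.p n :=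
  embed_C _

theorem embed_swapVars {k : ℕ} (i : Fin k) (F : V (k + 1)) :
    embed (k + 1) (swapVars i.castSucc i.succ F) = W.s i (embed (k + 1) F) := by
  have : (embed (k + 1)).comp ((swapVars i.castSucc i.succ).restrictScalars K) =
      (W.s i).comp (embed (k + 1)) := by
    refine V_hom_ext (fun n => ?_) fun j => ?_
    · rw [AlgHom.comp_apply, AlgHom.comp_apply, embed_p, W.s_p, AlgHom.restrictScalars_apply, swapVars,
        MvPolynomial.rename_C, embed_p]
    · rw [AlgHom.comp_apply, AlgHom.comp_apply, embed_X, W.s_y, AlgHom.restrictScalars_apply, swapVars,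
        MvPolynomial.rename_X, embed_X]
      congr 1
      simp only [Equiv.swap_apply_def, Fin.ext_iff, Fin.val_castSucc, Fin.val_succ]
      split_ifs <;> simp_all
  exact DFunLike.congr_fun this F

theorem embed_hecke {k : ℕ} (i : Fin k) (F : V (k + 1)) :
    embed (k + 1) (hecke i F) = W.T i (embed (k + 1) F) := by
  symm
  apply W.T_unique
  have h := congrArg (embed (k + 1)) (hecke_spec i F)
  rw [map_mul, map_add, map_smul, map_mul, map_mul, map_sub, map_sub, map_smul, embed_X, embed_X,
    embed_swapVars, Fin.val_castSucc, Fin.val_succ] at h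
  rw [h, ← W.qc_mul, sub_smul, one_smul, ← W.qc_mul]
  ring

theorem embed_addLast (k : ℕ) (F : V k) : embed (k + 1) (addLast k F) = W.add k (embed k F) := by
  have : (embed (k + 1)).comp (addLast k) = (W.add k).comp (embed k) := by
    refine V_hom_ext (fun n => ?_) fun j => ?_
    · rw [AlgHom.comp_apply, AlgHom.comp_apply, embed_p, W.add_p, addLast, MvPolynomial.aevalTower_C,
        MvPolynomial.aeval_X, map_add, embed_p, map_smul, map_pow, embed_X, Fin.val_last, sub_smul, one_smul,
        Algebra.smul_def, map_pow, show algebraMap K W q = W.qc from rfl]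
      ring
    · rw [AlgHom.comp_apply, AlgHom.comp_apply, embed_X, W.add_y, addLast, MvPolynomial.aevalTower_X,
        embed_X, Fin.val_castSucc]
  exact DFunLike.congr_fun this F

theorem embed_subLast (k : ℕ) (F : V (k + 1)) :
    Polynomial.mapAlgHom (embed k) (subLast k F) = W.sub k (embed (k + 1) F) := by
  have : (Polynomial.mapAlgHom (embed k)).comp (subLast k) = (W.sub k).comp (embed (k + 1)) := by
    refine V_hom_ext (R := Polynomial W) (fun n => ?_) fun j => ?_
    · rw [AlgHom.comp_apply, AlgHom.comp_apply, embed_p, W.sub_p, subLast, MvPolynomial.aevalTower_C,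
        MvPolynomial.aeval_X, map_sub (Polynomial.mapAlgHom (embed k)),
        map_smul (Polynomial.mapAlgHom (embed k)), map_pow (Polynomial.mapAlgHom (embed k))]
      rw [Polynomial.coe_mapAlgHom, Polynomial.map_C, Polynomial.map_X, AlgHom.coe_toRingHom, embed_p,
        sub_smul, one_smul, Algebra.smul_def, Polynomial.C_sub, Polynomial.C_pow, Polynomial.C_1, map_pow]
      rw [show algebraMap K (Polynomial W) q = Polynomial.C W.qc from rfl]
      ring
    · rw [AlgHom.comp_apply, AlgHom.comp_apply, embed_X, subLast, MvPolynomial.aevalTower_X]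
      induction j using Fin.lastCases with
      | last => simp
      | cast i =>
        rw [Fin.lastCases_castSucc, W.sub_y_of_ne (by simpa using i.2.ne)]
        simp
  exact DFunLike.congr_fun this F

theorem dMinusAt_eq (k : ℕ) (F : V (k + 1)) :
    dMinusAt k F = W.pair (fun n => MvPolynomial.C (signedElem n)) (subLast k F) := by
  rw [dMinusAt, LinearMap.comp_apply, AlgHom.toLinearMap_apply, W.pair, Polynomial.lsum_apply,
    Polynomial.lsum_apply]
  rfl

theorem embed_dMinusAt (k : ℕ) (F : V (k + 1)) :
    embed k (dMinusAt k F) = W.del k (embed (k + 1) F) := by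
  rw [dMinusAt_eq, W.hom_pair, embed_subLast, W.del_apply]
  congr 2
  funext n
  exact embed_C _

theorem embed_chain (k : ℕ) (F : V (k + 1)) :
    embed (k + 1) ((List.ofFn fun i : Fin k => hecke i).prod F) = W.chain k (embed (k + 1) F) := by
  have key : ∀ (j : ℕ) (h : j ≤ k) (F : V (k + 1)),
      embed (k + 1) ((List.ofFn fun i : Fin j => hecke (i.castLE h)).prod F) =
        W.chain j (embed (k + 1) F) := by
    intro j
    induction j with
    | zero => intro h F; simp [W.chain]
    | succ j ih =>
      intro h F
      rw [List.ofFn_succ', List.concat_eq_append, List.prod_append, List.prod_singleton,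
        Module.End.mul_apply, W.chain_succ]
      refine (ih (by omega) _).trans ?_
      rw [embed_hecke]
      rfl
  exact key k le_rfl F

theorem embed_dPlusAt (k : ℕ) (F : V k) :
    embed (k + 1) (dPlusAt k F) = -W.chain k (W.y k * W.add k (embed k F)) := by
  rw [dPlusAt, LinearMap.neg_apply, map_neg, LinearMap.comp_apply, LinearMap.comp_apply, embed_chain,
    LinearMap.mulLeft_apply, map_mul, embed_X, Fin.val_last, AlgHom.toLinearMap_apply, embed_addLast]

namespace W

/-- `y_0 y_1 ⋯ y_{k-1}`. -/
def yProd (k : ℕ) : W := ∏ i ∈ Finset.range k, y i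

theorem yProd_succ (k : ℕ) : yProd (k + 1) = yProd k * y k := Finset.prod_range_succ _ _

theorem s_yProd {k i : ℕ} (h : i + 1 < k) : s i (yProd k) = yProd k := by
  rw [yProd, map_prod]
  refine Finset.prod_equiv (Equiv.swap i (i + 1)) (fun j => ?_) fun j _ => s_y i j
  simp only [Finset.mem_range, Equiv.swap_apply_def]
  split_ifs <;> omega

/-- The product of all k variables is symmetric, so it behaves as a scalar for the T_i among them.
-/
theorem T_yProd {k i : ℕ} (h : i + 1 < k) (F : W) : T i (yProd k * F) = yProd k * T i F :=
  (T_comm i (LinearMap.mulLeft K (yProd k)) (fun F => mul_left_comm _ _ _)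
    (fun F => mul_left_comm _ _ _)
    (fun F => by rw [LinearMap.mulLeft_apply, LinearMap.mulLeft_apply, map_mul, s_yProd h]) F).symm

theorem chain_yProd {k j : ℕ} (h : j < k) (F : W) :
    chain j (yProd k * F) = yProd k * chain j F := by
  induction j generalizing F with
  | zero => rfl
  | succ j ih => rw [chain_succ, T_yProd h, ih (by omega), chain_succ]

theorem add_yProd (k j : ℕ) : add k (yProd j) = yProd j := by
  rw [yProd, map_prod]
  exact Finset.prod_congr rfl fun i _ => add_y k i

theorem del_yProd (k : ℕ) (F : W) : del k (yProd k * F) = yProd k * del k F := by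
  have key : ∀ j ≤ k, ∀ F, del k (yProd j * F) = yProd j * del k F := by
    intro j
    induction j with
    | zero => intro _ F; simp [yProd]
    | succ j ih =>
      intro h F
      rw [yProd_succ, mul_assoc, ih (by omega), del_y_of_ne (by omega), mul_assoc]
  exact key k le_rfl F

end W

/-- The element of `V_k` which is `(-1) ^ k y_1 ⋯ y_k G`. -/
def Bridge (k : ℕ) (φ : VStar) (G : W) : Prop :=
  ∃ F : V k, φ = DirectSum.lof K ℕ V k F ∧ embed k F = (-1) ^ k * (W.yProd k * G)

theorem dPlus_lof (k : ℕ) (F : V k) :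
    dPlus (DirectSum.lof K ℕ V k F) = DirectSum.lof K ℕ V (k + 1) (dPlusAt k F) := by
  rw [dPlus, DirectSum.toModule_lof, LinearMap.comp_apply]

theorem dMinus_lof (k : ℕ) (F : V (k + 1)) :
    dMinus (DirectSum.lof K ℕ V (k + 1) F) = DirectSum.lof K ℕ V k (dMinusAt k F) := by
  rw [dMinus, DirectSum.toModule_lof, LinearMap.comp_apply]

theorem dMinus_lof_zero (F : V 0) : dMinus (DirectSum.lof K ℕ V 0 F) = 0 := by
  rw [dMinus, DirectSum.toModule_lof, LinearMap.zero_apply]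

/-- The factor -y_{k+1} in d_+ completes (-1)^k y_1 ⋯ y_k to the product for level k + 1, which
passes through the Hecke operators. -/
theorem Bridge.dPlus {k : ℕ} {φ : VStar} {G : W} (h : Bridge k φ G) :
    Bridge (k + 1) (dPlus φ) (W.dp k G) := by
  obtain ⟨F, rfl, hF⟩ := h
  refine ⟨dPlusAt k F, dPlus_lof k F, ?_⟩
  rw [embed_dPlusAt, hF, map_mul (W.add k), map_pow (W.add k), map_neg (W.add k), map_one (W.add k),
    map_mul (W.add k), W.add_yProd, W.dp_apply,
    ← W.chain_yProd k.lt_succ_self, W.yProd_succ,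
    show W.y k * ((-1) ^ k * (W.yProd k * W.add k G)) =
      ((-1) ^ k : K) • (W.yProd k * W.y k * W.add k G) by
        rw [Algebra.smul_def, map_pow, map_neg, map_one]; ring, map_smul, Algebra.smul_def, map_pow,
    map_neg, map_one]
  ring

/-- All variables but the last pass through d_-; the last one and a sign are absorbed in the
definition of `dm`. -/
theorem Bridge.dMinus {k : ℕ} {φ : VStar} {G : W} (h : Bridge (k + 1) φ G) :
    Bridge k (dMinus φ) (W.dm k G) := by
  obtain ⟨F, rfl, hF⟩ := h
  refine ⟨dMinusAt k F, dMinus_lof k F, ?_⟩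
  rw [embed_dMinusAt, hF, W.dm_apply, W.yProd_succ,
    show (-1) ^ (k + 1) * (W.yProd k * W.y k * G) = ((-1) ^ (k + 1) : K) • (W.yProd k * (W.y k * G)) by
        rw [Algebra.smul_def, map_pow, map_neg, map_one]; ring, map_smul, W.del_yProd, Algebra.smul_def,
    map_pow, map_neg, map_one]
  ring

theorem Bridge.smul {k : ℕ} {φ : VStar} {G : W} (h : Bridge k φ G) (c : K) :
    Bridge k (c • φ) (c • G) := by
  obtain ⟨F, rfl, hF⟩ := h
  refine ⟨c • F, (map_smul _ _ _).symm, ?_⟩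
  rw [map_smul, hF, mul_smul_comm, mul_smul_comm]

theorem Bridge.sub {k : ℕ} {φ ψ : VStar} {G H : W} (h : Bridge k φ G) (h' : Bridge k ψ H) :
    Bridge k (φ - ψ) (G - H) := by
  obtain ⟨F, rfl, hF⟩ := h
  obtain ⟨F', rfl, hF'⟩ := h'
  refine ⟨F - F', (map_sub _ _ _).symm, ?_⟩
  rw [map_sub, hF, hF']
  ring

theorem Bridge.corner {k : ℕ} {φ : VStar} {G : W} (h : Bridge (k + 1) φ G) :
    Bridge (k + 1) (corner φ)
      ((q - 1)⁻¹ • (W.dm (k + 1) (W.dp (k + 1) G) - W.dp k (W.dm k G))) :=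
  (h.dPlus.dMinus.sub h.dMinus.dPlus).smul _

theorem Bridge.one : Bridge 0 (ofSym 1) 1 := by
  refine ⟨MvPolynomial.C 1, rfl, ?_⟩
  rw [embed_C, MvPolynomial.C_1]
  simp [W.yProd]

theorem Bridge.zero {φ : VStar} {G : W} (h : Bridge 0 φ G) :
    ∃ f : SymFun, φ = ofSym f ∧ G = MvPolynomial.C f := by
  obtain ⟨F, rfl, hF⟩ := h
  obtain ⟨f, rfl⟩ := MvPolynomial.C_surjective (Fin 0) F
  refine ⟨f, rfl, ?_⟩
  rw [embed_C] at hF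
  simp [hF, W.yProd]

/-- The steps of a marked word which an event stands for. -/
def Event.steps : Event → ℕ → ℕ × ℕ → List (MStep (ℕ × ℕ))
  | .pass, _, _ => []
  | .A, _, P => [.opn (P.1, P.2 - 1)]
  | .B, _, P => [.cls P]
  | .C, a, P => [.cor (P.1, P.2 - 1) P, .scal (q ^ a)⁻¹]
  | .D, a, _ => [.scal (q ^ a)]
  | .E, _, _ => [.scal t]

/-- Validity keeps the length of the queue equal to the level of the state, so the junk values of
`MStep.run` at level 0 never occur. -/
theorem bridge_foldl (e : ℕ × ℕ → Event) (a : ℕ × ℕ → ℕ) (L : List (ℕ × ℕ)) (Q : List (ℕ × ℕ))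
    (h : MStep.Valid Q (L.flatMap fun P => (e P).steps (a P) P)) (φ : VStar) (G : W)
    (hφ : Bridge Q.length φ G) :
    Bridge 0 (L.foldl (fun φ P => (e P).op (a P) φ) φ)
      (MStep.run Q.length (L.flatMap fun P => (e P).steps (a P) P) G) := by
  induction L generalizing Q φ G with
  | nil =>
    obtain rfl : Q = [] := h
    exact hφ
  | cons P L ih =>
    rw [List.flatMap_cons] at h ⊢
    rw [List.foldl_cons]
    generalize e P = x at h ⊢
    cases x with
    | pass => exact ih Q h φ G hφ
    | A =>
      have h1 := ih _ h (dPlus φ) (W.dp Q.length G) (by rw [List.length_append]; exact hφ.dPlus)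
      rw [List.length_append] at h1
      exact h1
    | B =>
      cases Q with
      | nil => exact h.elim
      | cons i Q => exact ih Q h.2 _ _ hφ.dMinus
    | C =>
      cases Q with
      | nil => exact h.elim
      | cons i Q =>
        have h1 := ih _ h.2 ((q ^ a P)⁻¹ • corner φ) ((q ^ a P)⁻¹ • ((q - 1)⁻¹ •
          (W.dm (Q.length + 1) (W.dp (Q.length + 1) G) - W.dp Q.length (W.dm Q.length G))))
          (by rw [List.length_append]; exact hφ.corner.smul _)
        rw [List.length_append] at h1
        rw [map_smul] at h1
        exact h1
    | D =>
      have h1 := ih Q h _ _ (hφ.smul (q ^ a P))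
      rw [map_smul] at h1
      exact h1
    | E =>
      have h1 := ih Q h _ _ (hφ.smul t)
      rw [map_smul] at h1
      exact h1

end SweepProcess
end

/-! ### The slope s_-, and the sweep of a Dyck path as a marked word -/

noncomputable section
namespace SweepProcess

/-- The slope `s` is slightly smaller than `n / m`, and `ε` bounds the difference: the integral vectors
`(x, y)` with `0 ≤ x ≤ m` below the diagonal are below the line of slope `s` by more than `ε`. -/
structure IsSlope (m n : ℕ) (s ε : ℝ) : Prop where
  m_pos : 0 < m
  n_pos : 0 < n
  ε_pos : 0 < ε
  of_le : ∀ (x : ℕ) (y : ℤ), x ≤ m → (n * x : ℤ) ≤ m * y → ε * x ≤ y - s * x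
  of_lt : ∀ (x : ℕ) (y : ℤ), x ≤ m → (m * y : ℤ) < n * x → y - s * x < -ε

/-- The height of (x, y) is (m₁ y - n₁ x)/m₁ + ε x, and the integer m₁ y - n₁ x is either
nonnegative or at most -1. In the second case ε (x + 1) < 1/m₁ brings the height below -ε. -/
theorem isSlope_of_small {m₁ n₁ g : ℕ} (hm : 0 < m₁) (hn : 0 < n₁) (hg : 0 < g) {ε : ℝ} (hε : 0 < ε)
    (hsmall : ε * ((m₁ : ℝ) * (((g * m₁ : ℕ) : ℝ) + 1)) < 1) :
    IsSlope (g * m₁) (g * n₁) ((n₁ : ℝ) / (m₁ : ℝ) - ε) ε := by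
  have hm' : (0 : ℝ) < m₁ := by exact_mod_cast hm
  have hg' : (0 : ℤ) < g := by exact_mod_cast hg
  have key : ∀ (x : ℕ) (y : ℤ), (y : ℝ) - ((n₁ : ℝ) / (m₁ : ℝ) - ε) * x =
      ((m₁ * y - n₁ * x : ℤ) : ℝ) / m₁ + ε * x := by
    intro x y
    push_cast
    field_simp
    ring
  refine ⟨Nat.mul_pos hg hm, Nat.mul_pos hg hn, hε, fun x y _ h => ?_, fun x y hx h => ?_⟩
  · rw [key]
    have h1 : (0 : ℤ) ≤ m₁ * y - n₁ * x := by
      push_cast at h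
      nlinarith
    have h2 : (0 : ℝ) ≤ ((m₁ * y - n₁ * x : ℤ) : ℝ) / m₁ := div_nonneg (by exact_mod_cast h1) hm'.le
    linarith
  · rw [key]
    have h1 : (m₁ * y - n₁ * x : ℤ) ≤ -1 := by
      push_cast at h
      have : (g : ℤ) * (m₁ * y) < g * (n₁ * x) := by linarith
      have := lt_of_mul_lt_mul_left this hg'.le
      omega
    have h2 : ((m₁ * y - n₁ * x : ℤ) : ℝ) / m₁ ≤ -1 / m₁ :=
      div_le_div_of_nonneg_right (by exact_mod_cast h1) hm'.le
    have h3 : (x : ℝ) ≤ ((g * m₁ : ℕ) : ℝ) := by exact_mod_cast hx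
    have h4 : ε * (x + 1) < 1 / m₁ := by
      rw [lt_div_iff₀ hm']
      nlinarith
    have h5 : (-1 : ℝ) / m₁ = -(1 / m₁) := by ring
    linarith

namespace IsSlope

variable {m n : ℕ} {s ε : ℝ}

theorem s_pos (hs : IsSlope m n s ε) : 0 < s := by
  have h := hs.of_lt 1 0 hs.m_pos (by have := hs.n_pos; push_cast; omega)
  have := hs.ε_pos
  push_cast at h
  linarith

/-- The difference of two points of equal height would be a vector of height 0. Strictly below the
diagonal heights are less than -ε, weakly above it they are at least ε x, so x = 0. -/
theorem height_injOn (hs : IsSlope m n s ε) {P Q : ℕ × ℕ} (hP : P.1 ≤ m) (hQ : Q.1 ≤ m) (h : height s P = height s Q) :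
    P = Q := by
  wlog hPQ : P.1 ≤ Q.1 generalizing P Q
  · exact (this hQ hP h.symm (by omega)).symm
  have hε := hs.ε_pos
  simp only [height] at h
  have h1 : ((Q.2 - P.2 : ℤ) : ℝ) - s * ((Q.1 - P.1 : ℕ) : ℝ) = 0 := by
    push_cast [hPQ]
    linarith
  have h2 : (n * (Q.1 - P.1 : ℕ) : ℤ) ≤ m * (Q.2 - P.2 : ℤ) := by
    by_contra hcon
    have := hs.of_lt (Q.1 - P.1) (Q.2 - P.2) (by omega) (by omega)
    linarith
  have h3 := hs.of_le (Q.1 - P.1) (Q.2 - P.2) (by omega) h2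
  rw [h1] at h3
  have h4 : ((Q.1 - P.1 : ℕ) : ℝ) = 0 := by
    have : (0 : ℝ) ≤ ((Q.1 - P.1 : ℕ) : ℝ) := Nat.cast_nonneg _
    nlinarith
  have h5 : Q.1 - P.1 = 0 := by exact_mod_cast h4
  have h6 : P.1 = Q.1 := by omega
  rw [h6] at h
  have h7 : (P.2 : ℝ) = Q.2 := by linarith
  exact Prod.ext h6 (by exact_mod_cast h7)

/-- The last position y = s x - ε of the line separates the points weakly above the diagonal from
those below. -/
theorem neg_lt_height_iff (hs : IsSlope m n s ε) {P : ℕ × ℕ} (hP : P.1 ≤ m) :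
    -ε < height s P ↔ n * P.1 ≤ m * P.2 := by
  have hε := hs.ε_pos
  constructor
  · intro h
    by_contra hcon
    have := hs.of_lt P.1 P.2 hP (by exact_mod_cast not_le.1 hcon)
    simp only [height] at h
    push_cast at this
    linarith
  · intro h
    have := hs.of_le P.1 P.2 hP (by exact_mod_cast h)
    have h1 : (0 : ℝ) ≤ ε * P.1 := by positivity
    simp only [height]
    push_cast at this
    linarith

end IsSlope

theorem mem_rect {m n : ℕ} {P : ℕ × ℕ} : P ∈ rect m n ↔ P.1 ≤ m ∧ P.2 ≤ n := by
  simp [rect]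

theorem height_up (s : ℝ) (P : ℕ × ℕ) : height s (up P) = height s P + 1 := by
  simp [height, up]
  ring

/-- The lattice point directly below (for points not on the horizontal axis). -/
def down (P : ℕ × ℕ) : ℕ × ℕ := (P.1, P.2 - 1)

theorem down_up (P : ℕ × ℕ) : down (up P) = P := rfl

theorem up_down {P : ℕ × ℕ} (h : 0 < P.2) : up (down P) = P := by
  simp only [up, down]
  exact Prod.ext rfl (by simp; omega)

/-- The points of a list come in the order of decreasing heights. -/
def Descending (s : ℝ) (L : List (ℕ × ℕ)) : Prop := L.Pairwise fun P Q => height s Q < height s P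

theorem Descending.eq_of_mem_iff {s : ℝ} {L L' : List (ℕ × ℕ)} (h : Descending s L)
    (h' : Descending s L') (hL : ∀ P, P ∈ L ↔ P ∈ L') : L = L' := by
  have : Std.Irrefl fun P Q : ℕ × ℕ => height s Q < height s P := ⟨fun _ => lt_irrefl _⟩
  have : Std.Asymm fun P Q : ℕ × ℕ => height s Q < height s P := ⟨fun _ _ => lt_asymm⟩
  exact List.Pairwise.eq_of_mem_iff h h' hL

theorem Descending.nodup {s : ℝ} {L : List (ℕ × ℕ)} (h : Descending s L) : L.Nodup :=
  h.imp fun h1 h2 => absurd h1 (by rw [h2]; exact lt_irrefl _)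

theorem descending_sort {m n : ℕ} {s ε : ℝ} (hs : IsSlope m n s ε) (S : Finset (ℕ × ℕ))
    (hS : ∀ P ∈ S, P.1 ≤ m) : Descending s (S.sort (sweepLE s)) := by
  have h1 := Finset.pairwise_sort S (sweepLE s)
  have h2 := Finset.sort_nodup S (sweepLE s)
  refine (h1.and h2).imp_of_mem fun {P Q} hP hQ h => ?_
  rw [Finset.mem_sort] at hP hQ
  refine lt_of_le_of_ne (height_le_of_readLE h.1) fun h3 => h.2 ?_
  exact (hs.height_injOn (hS Q hQ) (hS P hP) h3).symm

namespace DyckPath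

variable {m n : ℕ} (π : DyckPath m n)

theorem lo_zero : π.lo 0 = 0 := by simp [lo]

theorem lo_succ (i : Fin m) : π.lo (i + 1) = π.ht i := by simp [lo]

theorem hi_fin (i : Fin m) : π.hi i = π.ht i := by simp [hi]

theorem hi_eq_lo_succ {x : ℕ} (h : x < m) : π.hi x = π.lo (x + 1) := by simp [lo, hi, h]

theorem hi_le (x : ℕ) : π.hi x ≤ n := by
  unfold hi
  split_ifs
  · exact π.le_top _
  · exact le_rfl

theorem lo_le_hi (x : ℕ) : π.lo x ≤ π.hi x := by
  unfold lo hi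
  split_ifs with h1 h2 h2
  · exact π.mono (by simp)
  · exact π.le_top _
  · exact Nat.zero_le _
  · exact Nat.zero_le _

theorem hi_mono_lo {x x' : ℕ} (h : x < x') (h' : x' ≤ m) : π.hi x ≤ π.lo x' := by
  obtain ⟨d, rfl⟩ := Nat.exists_eq_add_of_lt h
  rw [← π.hi_eq_lo_succ (by omega), hi, hi, dif_pos (by omega), dif_pos (by omega)]
  exact π.mono (by simp)

theorem above_lo {x : ℕ} (h : x ≤ m) : n * x ≤ m * π.lo x := by
  cases x with
  | zero => simp
  | succ x =>
    rw [lo, dif_pos ⟨by omega, by omega⟩]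
    exact π.above ⟨x, _⟩

theorem mem_northSteps {P : ℕ × ℕ} :
    P ∈ π.northSteps ↔ P.1 ≤ m ∧ π.lo P.1 ≤ P.2 ∧ P.2 < π.hi P.1 := by
  rw [northSteps, Finset.mem_filter, mem_rect]
  have := π.hi_le P.1
  constructor
  · rintro ⟨⟨h1, _⟩, h2⟩; exact ⟨h1, h2⟩
  · rintro ⟨h1, h2, h3⟩; exact ⟨⟨h1, by omega⟩, h2, h3⟩

variable {s ε : ℝ}

open Classical in
/-- The points which the sweep process visits. -/
def visited (s ε : ℝ) : Finset (ℕ × ℕ) :=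
  (rect m n).filter fun P => P.2 ≤ π.hi P.1 ∧ -ε < height s P

theorem mem_visited (hs : IsSlope m n s ε) {P : ℕ × ℕ} :
    P ∈ π.visited s ε ↔ P.1 ≤ m ∧ P.2 ≤ π.hi P.1 ∧ n * P.1 ≤ m * P.2 := by
  rw [visited, Finset.mem_filter, mem_rect]
  have := π.hi_le P.1
  constructor
  · rintro ⟨⟨h1, h2⟩, h3, h4⟩
    exact ⟨h1, h3, (hs.neg_lt_height_iff h1).1 h4⟩
  · rintro ⟨h1, h3, h4⟩
    exact ⟨⟨h1, by omega⟩, h3, (hs.neg_lt_height_iff h1).2 h4⟩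

theorem mem_visited_of_lo_le (hs : IsSlope m n s ε) {P : ℕ × ℕ} (h1 : P.1 ≤ m) (h2 : π.lo P.1 ≤ P.2)
    (h3 : P.2 ≤ π.hi P.1) : P ∈ π.visited s ε :=
  (π.mem_visited hs).2 ⟨h1, h3, (π.above_lo h1).trans (Nat.mul_le_mul_left m h2)⟩

theorem northSteps_subset (hs : IsSlope m n s ε) {P : ℕ × ℕ} (h : P ∈ π.northSteps) :
    P ∈ π.visited s ε := by
  obtain ⟨h1, h2, h3⟩ := π.mem_northSteps.1 h
  exact π.mem_visited_of_lo_le hs h1 h2 h3.le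

theorem up_mem_visited (hs : IsSlope m n s ε) {P : ℕ × ℕ} (h : P ∈ π.northSteps) :
    up P ∈ π.visited s ε := by
  obtain ⟨h1, h2, h3⟩ := π.mem_northSteps.1 h
  exact π.mem_visited_of_lo_le hs h1 (by simp only [up]; omega) h3

/-- The part of the sweep which is still to come. -/
structure IsRest (s ε : ℝ) (L : List (ℕ × ℕ)) : Prop where
  subset : ∀ P ∈ L, P ∈ π.visited s ε
  desc : Descending s L
  lower : ∀ P ∈ π.visited s ε, P ∉ L → ∀ Q ∈ L, height s Q < height s P

theorem IsRest.tail {P : ℕ × ℕ} {L : List (ℕ × ℕ)} (h : π.IsRest s ε (P :: L)) : π.IsRest s ε L where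
  subset Q hQ := h.subset Q (List.mem_cons_of_mem _ hQ)
  desc := (List.pairwise_cons.1 h.desc).2
  lower Q hQ hQL R hR := by
    by_cases hQP : Q = P
    · rw [hQP]; exact (List.pairwise_cons.1 h.desc).1 R hR
    · exact h.lower Q hQ (by simp [hQP, hQL]) R (List.mem_cons_of_mem _ hR)

theorem isRest_sweepPoints (hs : IsSlope m n s ε) : π.IsRest s ε (π.sweepPoints s (-ε)) where
  subset P hP := by
    rw [sweepPoints, Finset.mem_sort] at hP
    exact hP
  desc := descending_sort hs _ fun P hP => (mem_rect.1 (Finset.mem_filter.1 hP).1).1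
  lower P hP hPL := by
    rw [sweepPoints, Finset.mem_sort] at hPL
    exact absurd hP hPL

open Classical in
/-- The North steps crossed by the line, from the highest to the lowest. -/
def queue (s : ℝ) (L : List (ℕ × ℕ)) : List (ℕ × ℕ) :=
  (π.northSteps.sort (sweepLE s)).filter fun Q => Q ∈ L ∧ up Q ∉ L

open Classical in
/-- The North steps strictly crossed by the line through the first point of `P :: L`. -/
def crossed (s : ℝ) (P : ℕ × ℕ) (L : List (ℕ × ℕ)) : List (ℕ × ℕ) :=
  (π.northSteps.sort (sweepLE s)).filter fun Q => Q ∈ L ∧ up Q ∉ P :: L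

theorem descending_northSteps (hs : IsSlope m n s ε) :
    Descending s (π.northSteps.sort (sweepLE s)) :=
  descending_sort hs _ fun _ hP => (π.mem_northSteps.1 hP).1

theorem mem_queue {L : List (ℕ × ℕ)} {Q : ℕ × ℕ} :
    Q ∈ π.queue s L ↔ Q ∈ π.northSteps ∧ Q ∈ L ∧ up Q ∉ L := by
  simp [queue]

theorem mem_crossed {P : ℕ × ℕ} {L : List (ℕ × ℕ)} {Q : ℕ × ℕ} :
    Q ∈ π.crossed s P L ↔ Q ∈ π.northSteps ∧ Q ∈ L ∧ up Q ∉ P :: L := by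
  simp [crossed]

/-- A North step starting at P has the highest starting point among those not yet left behind, so it
is the next to leave the queue. -/
theorem queue_cons (hs : IsSlope m n s ε) {P : ℕ × ℕ} {L : List (ℕ × ℕ)} (h : π.IsRest s ε (P :: L)) :
    π.queue s (P :: L) = (if P ∈ π.northSteps then [P] else []) ++ π.crossed s P L := by
  have hP := (List.pairwise_cons.1 h.desc).1
  have hd := π.descending_northSteps hs
  have hup : up P ∉ P :: L := by
    intro h1
    rcases List.mem_cons.1 h1 with h1 | h1
    · have := congrArg Prod.snd h1
      simp [up] at this
    · have := hP _ h1
      rw [height_up] at this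
      linarith
  refine Descending.eq_of_mem_iff (List.Pairwise.filter _ hd) ?_ fun Q => ?_
  · split_ifs
    · refine List.pairwise_cons.2 ⟨fun Q hQ => hP Q ((π.mem_crossed.1 hQ).2.1), List.Pairwise.filter _ hd⟩
    · exact List.Pairwise.filter _ hd
  · rw [mem_queue, List.mem_append, mem_crossed]
    constructor
    · rintro ⟨h1, h2, h3⟩
      rcases List.mem_cons.1 h2 with rfl | h2
      · left; rw [if_pos h1]; simp
      · exact Or.inr ⟨h1, h2, h3⟩
    · rintro (h1 | ⟨h1, h2, h3⟩)
      · split_ifs at h1 with h2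
        · obtain rfl := List.mem_singleton.1 h1
          exact ⟨h2, List.mem_cons_self .., hup⟩
        · exact absurd h1 List.not_mem_nil
      · exact ⟨h1, List.mem_cons_of_mem _ h2, h3⟩

/-- The step whose top is P enters at the end: all steps have length 1, and the other crossed ones
have their tops above P, so their starting points are above that of the new step. -/
theorem queue_tail (hs : IsSlope m n s ε) {P : ℕ × ℕ} {L : List (ℕ × ℕ)} (h : π.IsRest s ε (P :: L)) :
    π.queue s L = π.crossed s P L ++ (if 0 < P.2 ∧ down P ∈ π.northSteps then [down P] else []) := by
  have hP := (List.pairwise_cons.1 h.desc).1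
  have hd := π.descending_northSteps hs
  refine Descending.eq_of_mem_iff (List.Pairwise.filter _ hd) ?_ fun Q => ?_
  · refine List.pairwise_append.2 ⟨List.Pairwise.filter _ hd, by split_ifs <;> simp, fun Q hQ R hR => ?_⟩
    split_ifs at hR with h1
    · obtain rfl := List.mem_singleton.1 hR
      obtain ⟨h2, h3, h4⟩ := π.mem_crossed.1 hQ
      have h5 := h.lower _ (π.up_mem_visited hs h2) h4 P (List.mem_cons_self ..)
      rw [← up_down h1.1, height_up, height_up] at h5
      linarith
    · exact absurd hR List.not_mem_nil
  · rw [mem_queue, List.mem_append, mem_crossed]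
    constructor
    · rintro ⟨h1, h2, h3⟩
      by_cases h4 : up Q = P
      · right
        rw [← h4, down_up, if_pos ⟨by simp [up], h1⟩]
        simp
      · exact Or.inl ⟨h1, h2, by simp [h3, h4]⟩
    · rintro (⟨h1, h2, h3⟩ | h1)
      · exact ⟨h1, h2, fun h4 => h3 (List.mem_cons_of_mem _ h4)⟩
      · split_ifs at h1 with h2
        · obtain rfl := List.mem_singleton.1 h1
          have h3 : height s P = height s (down P) + 1 := by rw [← height_up, up_down h2.1]
          refine ⟨h2.2, ?_, ?_⟩
          · by_contra h4
            have h5 := h.lower _ (π.northSteps_subset hs h2.2) (by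
              intro h6
              rcases List.mem_cons.1 h6 with h6 | h6
              · rw [h6] at h3; linarith
              · exact h4 h6) P (List.mem_cons_self ..)
            linarith
          · rw [up_down h2.1]
            intro h4
            exact lt_irrefl _ (hP P h4)
        · exact absurd h1 List.not_mem_nil

/-- A step is strictly crossed by the line through P when its start is below P and its top above,
and this is the attack relation. Hence the inversions of the word are attacks. -/
theorem mem_crossed_iff (hs : IsSlope m n s ε) {P : ℕ × ℕ} {L : List (ℕ × ℕ)}
    (h : π.IsRest s ε (P :: L)) {Q : ℕ × ℕ} :
    Q ∈ π.crossed s P L ↔ Q ∈ π.northSteps ∧ Attacks s Q P := by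
  have hP := (List.pairwise_cons.1 h.desc).1
  rw [mem_crossed]
  constructor
  · rintro ⟨h1, h2, h3⟩
    exact ⟨h1, hP Q h2, h.lower _ (π.up_mem_visited hs h1) h3 P (List.mem_cons_self ..)⟩
  · rintro ⟨h1, h2, h3⟩
    refine ⟨h1, ?_, fun h4 => ?_⟩
    · by_contra h4
      have h5 := h.lower Q (π.northSteps_subset hs h1) (by
        intro h6
        rcases List.mem_cons.1 h6 with h6 | h6
        · rw [h6] at h2; exact lt_irrefl _ h2
        · exact h4 h6) P (List.mem_cons_self ..)
      exact lt_asymm h2 h5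
    · rcases List.mem_cons.1 h4 with h4 | h4
      · rw [h4] at h3; exact lt_irrefl _ h3
      · exact lt_asymm h3 (hP _ h4)

/-- The marked word of the part `L` of the sweep. -/
def word (s : ℝ) (L : List (ℕ × ℕ)) : List (MStep (ℕ × ℕ)) :=
  L.flatMap fun P => (π.event P).steps (π.crossingsRight s P) P

theorem word_cons (P : ℕ × ℕ) (L : List (ℕ × ℕ)) :
    π.word s (P :: L) = (π.event P).steps (π.crossingsRight s P) P ++ π.word s L :=
  List.flatMap_cons

/-- The events in terms of the North steps at the point. -/
theorem event_cases (P : ℕ × ℕ) (hm : P.1 ≤ m) (hP : P.2 ≤ π.hi P.1) :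
    (π.event P = .A ∧ P ∉ π.northSteps ∧ 0 < P.2 ∧ down P ∈ π.northSteps) ∨
    (π.event P = .B ∧ P ∈ π.northSteps ∧ ¬ (0 < P.2 ∧ down P ∈ π.northSteps)) ∨
    (π.event P = .C ∧ P ∈ π.northSteps ∧ 0 < P.2 ∧ down P ∈ π.northSteps) ∨
    ((π.event P = .D ∨ π.event P = .E) ∧ P ∉ π.northSteps ∧ ¬ (0 < P.2 ∧ down P ∈ π.northSteps)) := by
  have h := π.lo_le_hi P.1
  simp only [mem_northSteps, down, event]
  split_ifs with h1 h2 h3 h3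
  · right; right; right
    refine ⟨Or.inr rfl, ?_, ?_⟩ <;> omega
  · right; right; right
    refine ⟨Or.inl rfl, ?_, ?_⟩ <;> omega
  · right; left
    refine ⟨rfl, ?_, ?_⟩ <;> omega
  · left
    refine ⟨rfl, ?_, ?_⟩ <;> omega
  · right; right; left
    refine ⟨rfl, ?_, ?_⟩ <;> omega

/-- The scalar which an event contributes. -/
def scalar (s : ℝ) (P : ℕ × ℕ) : K := match π.event P with
  | .C => (q ^ π.crossingsRight s P)⁻¹
  | .D => q ^ π.crossingsRight s P
  | .E => t
  | _ => 1

open Classical in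
-- Backward induction along the sweep. At an event B or C the step starting at P leaves, and the
-- other elements of the queue are the steps attacking it. At C the step ending at P enters
-- immediately; its corner condition is that labels decrease along consecutive North steps.
theorem word_spec (hs : IsSlope m n s ε) (L : List (ℕ × ℕ)) (h : π.IsRest s ε L) :
    MStep.Valid (π.queue s L) (π.word s L) ∧
    MStep.closed (π.word s L) = L.filter (· ∈ π.northSteps) ∧
    MStep.coef (π.word s L) = (L.map (π.scalar s)).prod ∧
    ∀ w : ℕ × ℕ → ℕ+, (MStep.Ok w (π.word s L) ↔
        ∀ P ∈ L, P ∈ π.northSteps → 0 < P.2 → down P ∈ π.northSteps → w P < w (down P)) ∧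
      MStep.wt w (π.queue s L) (π.word s L) = ((L.filter (· ∈ π.northSteps)).map fun P =>
        (π.northSteps.filter fun Q => Attacks s Q P ∧ w P < w Q).card).sum := by
  induction L with
  | nil =>
    refine ⟨?_, rfl, rfl, fun w => ⟨?_, rfl⟩⟩
    · simp [queue, word, MStep.Valid]
    · simp [word, MStep.Ok]
  | cons P L ih =>
    obtain ⟨ih1, ih2, ih3, ih4⟩ := ih h.tail
    have hP := h.subset P (List.mem_cons_self ..)
    have hP' := (π.mem_visited hs).1 hP
    have hcount : ∀ w : ℕ × ℕ → ℕ+, (π.crossed s P L).countP (fun Q => w P < w Q) =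
        (π.northSteps.filter fun Q => Attacks s Q P ∧ w P < w Q).card := by
      intro w
      have hnd : (π.crossed s P L).Nodup :=
        (Finset.sort_nodup _ _).filter _
      rw [List.countP_eq_length_filter, ← List.toFinset_card_of_nodup (hnd.filter _)]
      congr 1
      ext Q
      simp only [List.mem_toFinset, List.mem_filter, π.mem_crossed_iff hs h, Finset.mem_filter,
        decide_eq_true_eq]
      tauto
    rw [word_cons, π.queue_cons hs h]
    rw [π.queue_tail hs h] at ih1 ih4
    rcases π.event_cases P hP'.1 hP'.2.1 with ⟨he, h1, h2⟩ | ⟨he, h1, h2⟩ | ⟨he, h1, h2⟩ | ⟨he, h1, h2⟩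
    · rw [if_pos h2] at ih1 ih4
      rw [if_neg h1, he]
      simp only [Event.steps, List.nil_append, List.cons_append, MStep.Valid, MStep.closed, MStep.coef,
        MStep.Ok, MStep.wt, List.map_cons, List.prod_cons, scalar, he, one_mul,
        List.filter_cons, h1, decide_false, List.mem_cons, forall_eq_or_imp]
      exact ⟨ih1, by simpa using ih2, ih3,
        fun w => ⟨by simpa using (ih4 w).1, (ih4 w).2.trans (by simp)⟩⟩
    · rw [if_neg h2, List.append_nil] at ih1 ih4
      rw [if_pos h1, he]
      simp only [Event.steps, List.nil_append, List.cons_append, MStep.Valid, MStep.closed, MStep.coef,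
        MStep.Ok, MStep.wt, List.map_cons, List.prod_cons, scalar, he, one_mul,
        List.filter_cons, h1, decide_true, List.mem_cons, forall_eq_or_imp, List.tail_cons, hcount]
      refine ⟨⟨trivial, ih1⟩, by simpa using ih2, ih3, fun w => ⟨?_, ?_⟩⟩
      · rw [(ih4 w).1]
        tauto
      · rw [(ih4 w).2]
        simp
    · rw [if_pos h2] at ih1 ih4
      rw [if_pos h1, he]
      simp only [Event.steps, List.nil_append, List.cons_append, MStep.Valid, MStep.closed, MStep.coef,
        MStep.Ok, MStep.wt, List.map_cons, List.prod_cons, scalar, he,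
        List.filter_cons, h1, decide_true, List.mem_cons, forall_eq_or_imp, List.tail_cons, hcount]
      refine ⟨⟨trivial, ih1⟩, by simpa using ih2, by rw [ih3], fun w => ⟨?_, ?_⟩⟩
      · rw [(ih4 w).1]
        change w P < w (down P) ∧ _ ↔ _
        tauto
      · rw [show ((P.1, P.2 - 1) : ℕ × ℕ) = down P from rfl, (ih4 w).2]
        simp
    · rw [if_neg h2, List.append_nil] at ih1 ih4
      rw [if_neg h1]
      rcases he with he | he
      all_goals
        rw [he]
        simp only [Event.steps, List.nil_append, List.cons_append, MStep.Valid, MStep.closed, MStep.coef,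
          MStep.Ok, MStep.wt, List.map_cons, List.prod_cons, scalar, he,
          List.filter_cons, h1, decide_false, List.mem_cons, forall_eq_or_imp]
        exact ⟨ih1, by simpa using ih2, by rw [ih3],
          fun w => ⟨by simpa using (ih4 w).1, by simpa using (ih4 w).2⟩⟩

end DyckPath
end SweepProcess
end

/-! ### From values at finite alphabets to the characteristic function of the path -/

noncomputable section
namespace SweepProcess

/-- The coefficients of a symmetric function are those of its values at finite alphabets. -/
theorem coeff_toSeries (F : SymFun) (A : Finset ℕ+) (d : ℕ+ →₀ ℕ) (hd : d.support ⊆ A) :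
    MvPowerSeries.coeff d (toSeries F) = MvPolynomial.coeff d
      (MvPolynomial.aeval (fun n : ℕ+ => ∑ l ∈ A, (MvPolynomial.X l : MvPolynomial ℕ+ K) ^ (n : ℕ)) F) := by
  induction F using MvPolynomial.induction_on generalizing d with
  | C a =>
    rw [toSeries, MvPolynomial.aeval_C, MvPolynomial.aeval_C, MvPolynomial.algebraMap_eq,
      MvPowerSeries.algebraMap_apply, MvPolynomial.coeff_C, MvPowerSeries.coeff_C]
    simp [eq_comm]
  | add F G hF hG => rw [map_add, map_add, map_add, MvPolynomial.coeff_add, hF d hd, hG d hd]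
  | mul_X F n hF =>
    classical
    rw [map_mul toSeries, map_mul (MvPolynomial.aeval _), MvPowerSeries.coeff_mul, MvPolynomial.coeff_mul]
    refine Finset.sum_congr rfl fun x hx => ?_
    rw [Finset.HasAntidiagonal.mem_antidiagonal] at hx
    have h1 : x.1.support ⊆ A := fun i hi => hd (by
      rw [← hx]; simp only [Finsupp.mem_support_iff, Finsupp.add_apply] at hi ⊢; omega)
    have h2 : x.2.support ⊆ A := fun i hi => hd (by
      rw [← hx]; simp only [Finsupp.mem_support_iff, Finsupp.add_apply] at hi ⊢; omega)
    rw [hF _ h1, toSeries, MvPolynomial.aeval_X, MvPolynomial.aeval_X]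
    congr 1
    rw [MvPolynomial.coeff_sum]
    simp only [MvPolynomial.coeff_X_pow]
    change (if ∃ i : ℕ+, x.2 = Finsupp.single i (n : ℕ) then (1 : K) else 0) = _
    split_ifs with h3
    · obtain ⟨i, hi⟩ := h3
      rw [hi] at h2 ⊢
      have hiA : i ∈ A := h2 (by simp)
      rw [Finset.sum_eq_single_of_mem i hiA]
      · simp
      · intro j _ hji
        rw [if_neg]
        intro h4
        exact hji (Finsupp.single_left_injective n.ne_zero h4)
    · symm
      refine Finset.sum_eq_zero fun i _ => if_neg fun h4 => h3 ⟨i, h4.symm⟩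

namespace DyckPath

variable {m n : ℕ} (π : DyckPath m n) {s ε : ℝ}

theorem mem_sweepPoints {P : ℕ × ℕ} : P ∈ π.sweepPoints s (-ε) ↔ P ∈ π.visited s ε := by
  rw [sweepPoints, Finset.mem_sort, visited]

open Classical in
/-- Labellings of the North steps which decrease along consecutive ones. -/
def parking (A : Finset ℕ+) : Finset (ℕ × ℕ → ℕ+) :=
  (labels π.northSteps A).filter fun w =>
    ∀ P ∈ π.northSteps, 0 < P.2 → down P ∈ π.northSteps → w P < w (down P)

open Classical in
/-- The number of attacks from a greater to a smaller label. -/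
def attackInv (s : ℝ) (w : ℕ × ℕ → ℕ+) : ℕ :=
  ∑ P ∈ π.northSteps, (π.northSteps.filter fun Q => Attacks s Q P ∧ w P < w Q).card

/-- The values of the result of the sweep process at finite alphabets. -/
theorem sweep_eval (hs : IsSlope m n s ε) : ∃ F : SymFun, π.sweep s (-ε) = ofSym F ∧
    ∀ (A : Finset ℕ+) (u : ℕ+ → K), MvPolynomial.aeval (fun n : ℕ+ => ∑ l ∈ A, u l ^ (n : ℕ)) F =
      (∏ P ∈ π.visited s ε, π.scalar s P) *
        ∑ w ∈ π.parking A, q ^ π.attackInv s w * ∏ P ∈ π.northSteps, u (w P) := by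
  classical
  have hr := π.isRest_sweepPoints hs
  have hnd := hr.desc.nodup
  obtain ⟨h1, h2, h3, h4⟩ := π.word_spec hs _ hr
  have hq : π.queue s (π.sweepPoints s (-ε)) = [] := by
    rw [List.eq_nil_iff_forall_not_mem]
    intro Q hQ
    obtain ⟨h5, _, h6⟩ := π.mem_queue.1 hQ
    exact h6 (π.mem_sweepPoints.2 (π.up_mem_visited hs h5))
  rw [hq] at h1 h4
  have hset (inst : DecidableEq (ℕ × ℕ)) :
      (MStep.closed (π.word s (π.sweepPoints s (-ε)))).toFinset = π.northSteps := by
    ext P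
    simp only [h2, List.mem_toFinset, List.mem_filter, decide_eq_true_eq, and_iff_right_iff_imp]
    exact fun hP => π.mem_sweepPoints.2 (π.northSteps_subset hs hP)
  have hset' : (π.sweepPoints s (-ε)).toFinset = π.visited s ε := by
    ext P
    rw [List.mem_toFinset, mem_sweepPoints]
  obtain ⟨F, hF, hG⟩ := (bridge_foldl π.event (π.crossingsRight s) (π.sweepPoints s (-ε)) [] h1
    (ofSym 1) 1 Bridge.one).zero
  refine ⟨F, hF, fun A u => ?_⟩
  have h5 := MStep.ev_run u A _ (by rw [h2]; exact hnd.filter _) h1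
  rw [hset, h3] at h5
  have h6 : W.ev A u (MvPolynomial.C F) =
      MvPolynomial.aeval (fun n : ℕ+ => ∑ l ∈ A, u l ^ (n : ℕ)) F := by
    simp [W.ev, W.lift]
  rw [← h6, ← hG]
  refine h5.trans ?_
  rw [← hset', List.prod_toFinset _ hnd]
  congr 1
  refine Finset.sum_congr ?_ fun w _ => ?_
  · rw [parking]
    ext w
    simp only [Finset.mem_filter, mem_labels]
    refine and_congr_right fun _ => ?_
    refine (h4 w).1.trans ?_
    exact ⟨fun h P hP => h P (π.mem_sweepPoints.2 (π.northSteps_subset hs hP)) hP, fun h P _ hP => h P hP⟩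
  · rw [(h4 w).2, attackInv, ← List.sum_toFinset _ (hnd.filter _), ← h2, hset _]

open Classical in
-- K is infinite, so values determine polynomials; the alphabet consisting of the support of d
-- suffices for the coefficient at d.
theorem coeff_of_eval {F : SymFun} {κ : K} (hF : ∀ (A : Finset ℕ+) (u : ℕ+ → K),
      MvPolynomial.aeval (fun n : ℕ+ => ∑ l ∈ A, u l ^ (n : ℕ)) F =
      κ * ∑ w ∈ π.parking A, q ^ π.attackInv s w * ∏ P ∈ π.northSteps, u (w P)) (d : ℕ+ →₀ ℕ) :
    MvPowerSeries.coeff d (toSeries F) = κ * ∑ w ∈ (π.parking d.support).filter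
      (fun w => ∑ P ∈ π.northSteps, Finsupp.single (w P) 1 = d), q ^ π.attackInv s w := by
  have : Infinite K := CharZero.infinite K
  have h1 : MvPolynomial.aeval
      (fun n : ℕ+ => ∑ l ∈ d.support, (MvPolynomial.X l : MvPolynomial ℕ+ K) ^ (n : ℕ)) F =
      MvPolynomial.C κ * ∑ w ∈ π.parking d.support, MvPolynomial.C (q ^ π.attackInv s w) *
        ∏ P ∈ π.northSteps, MvPolynomial.X (w P) := by
    refine MvPolynomial.funext fun u => ?_
    rw [map_mul, map_sum, MvPolynomial.eval_C]
    simp only [map_mul, map_prod, MvPolynomial.eval_X, MvPolynomial.eval_C]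
    rw [← hF]
    have h2 : (MvPolynomial.aeval u).comp (MvPolynomial.aeval fun n : ℕ+ =>
          ∑ l ∈ d.support, (MvPolynomial.X l : MvPolynomial ℕ+ K) ^ (n : ℕ)) =
        MvPolynomial.aeval fun n : ℕ+ => ∑ l ∈ d.support, u l ^ (n : ℕ) :=
      MvPolynomial.algHom_ext fun n => by simp
    rw [← h2]
    rfl
  rw [coeff_toSeries F d.support d subset_rfl, h1, MvPolynomial.coeff_C_mul, MvPolynomial.coeff_sum,
    Finset.sum_filter]
  congr 1
  refine Finset.sum_congr rfl fun w _ => ?_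
  rw [MvPolynomial.coeff_C_mul]
  have h2 : ∏ P ∈ π.northSteps, (MvPolynomial.X (w P) : MvPolynomial ℕ+ K) =
      MvPolynomial.monomial (∑ P ∈ π.northSteps, Finsupp.single (w P) 1) 1 :=
    (MvPolynomial.monomial_sum_one π.northSteps fun P => Finsupp.single (w P) 1).symm
  rw [h2, MvPolynomial.coeff_monomial]
  split_ifs <;> simp

/-- The `i`-th North step in the reading order. -/
def north (s : ℝ) (i : Fin (π.northList s).length) : ℕ × ℕ := (π.northList s).get i

theorem north_injective : Function.Injective (π.north s) :=
  List.nodup_iff_injective_get.1 (Finset.sort_nodup _ _)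

theorem mem_northSteps_iff_north {P : ℕ × ℕ} : P ∈ π.northSteps ↔ ∃ i, π.north s i = P := by
  rw [← Finset.mem_sort (readLE s), ← northList, List.mem_iff_get]
  rfl

theorem northSteps_eq_map : π.northSteps = Finset.univ.map ⟨π.north s, π.north_injective⟩ := by
  ext P
  rw [π.mem_northSteps_iff_north (s := s)]
  simp

theorem height_north_lt_iff (hs : IsSlope m n s ε) {i j : Fin (π.northList s).length} :
    height s (π.north s i) < height s (π.north s j) ↔ i < j := by
  have h : StrictMono fun i => height s (π.north s i) := by
    intro i j hij
    refine lt_of_le_of_ne (height_le_of_readLE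
      (List.pairwise_iff_get.1 (Finset.pairwise_sort π.northSteps (readLE s)) i j hij)) fun h => ?_
    have hN : ∀ i, (π.north s i).1 ≤ m := fun i =>
      (π.mem_northSteps.1 ((π.mem_northSteps_iff_north (s := s)).2 ⟨i, rfl⟩)).1
    exact hij.ne (π.north_injective (hs.height_injOn (hN i) (hN j) h))
  exact h.lt_iff_lt

/-- The steps preceding the top of the i-th one form an initial segment of the reading order, so
their number, which is the height of column i, tells which ones they are. -/
theorem lt_attackPath_iff (hs : IsSlope m n s ε) (i j : Fin (π.northList s).length) :
    (j : ℕ) < (π.attackPath s).ht i ↔ height s (π.north s j) < height s (up (π.north s i)) := by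
  classical
  have hht : (π.attackPath s).ht i = ((Finset.univ : Finset (Fin (π.northList s).length)).filter fun j =>
      height s (π.north s j) < height s (up (π.north s i))).card := by
    simp only [attackPath, north]
    congr
  rw [hht]
  constructor
  · intro h
    by_contra hj
    refine absurd h (not_lt.2 ?_)
    rw [← Fin.card_Iio j]
    refine Finset.card_le_card fun k hk => ?_
    rw [Finset.mem_filter] at hk
    rw [Finset.mem_Iio, ← π.height_north_lt_iff hs]
    exact lt_of_lt_of_le hk.2 (not_lt.1 hj)
  · intro h
    rw [Nat.lt_iff_add_one_le, ← Fin.card_Iic j]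
    refine Finset.card_le_card fun k hk => ?_
    rw [Finset.mem_Iic] at hk
    refine Finset.mem_filter.2 ⟨Finset.mem_univ _, lt_of_le_of_lt ?_ h⟩
    exact not_lt.1 fun h1 => absurd ((π.height_north_lt_iff hs).1 h1) (not_lt.2 hk)

theorem attackInv_eq_inv (hs : IsSlope m n s ε) (w : ℕ × ℕ → ℕ+) :
    π.attackInv s w = inv (π.attackPath s) fun i => w (π.north s i) := by
  classical
  rw [attackInv, inv, Finset.card_filter, ← Finset.univ_product_univ, Finset.sum_product_right,
    π.northSteps_eq_map (s := s), Finset.sum_map]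
  refine Finset.sum_congr rfl fun j _ => ?_
  rw [Finset.card_filter, Finset.sum_map]
  refine Finset.sum_congr rfl fun i _ => ?_
  simp only [Function.Embedding.coeFn_mk, Attacks, π.height_north_lt_iff hs, π.lt_attackPath_iff hs,
    and_assoc]

/-- Numbering the North steps in the reading order turns labellings into words, consecutive steps
into the pairs of the marking, and attacks into cells below the attack path. -/
theorem sum_parking (hs : IsSlope m n s ε) (d : ℕ+ →₀ ℕ) :
    ∑ w ∈ (π.parking d.support).filter
      (fun w => ∑ P ∈ π.northSteps, Finsupp.single (w P) 1 = d), q ^ π.attackInv s w =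
    chi (π.attackPath s) (π.marking s) d := by
  classical
  rw [chi]
  have hmem : ∀ i, π.north s i ∈ π.northSteps := fun i => π.mem_northSteps_iff_north.2 ⟨i, rfl⟩
  have hiff : ∀ w : ℕ × ℕ → ℕ+,
      ((∀ P ∈ π.northSteps, 0 < P.2 → down P ∈ π.northSteps → w P < w (down P)) ↔
        ∀ c ∈ π.marking s, w (π.north s c.2) < w (π.north s c.1)) := by
    intro w
    constructor
    · intro h c hc
      have hc' : π.north s c.2 = up (π.north s c.1) := (Finset.mem_filter.1 hc).2
      have := h _ (hmem c.2) (by rw [hc']; simp [up]) (by rw [hc', down_up]; exact hmem _)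
      rwa [hc', down_up, ← hc'] at this
    · intro h P hP h0 hd
      obtain ⟨j, rfl⟩ := (π.mem_northSteps_iff_north (s := s)).1 hP
      obtain ⟨i, hi⟩ := (π.mem_northSteps_iff_north (s := s)).1 hd
      have := h (i, j) (Finset.mem_filter.2 ⟨Finset.mem_univ _, by
        change π.north s j = up (π.north s i)
        rw [hi, up_down h0]⟩)
      rwa [hi] at this
  have hsum : ∀ w : ℕ × ℕ → ℕ+, ∑ P ∈ π.northSteps, Finsupp.single (w P) 1 =
      ∑ i, Finsupp.single (w (π.north s i)) 1 := by
    intro w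
    rw [π.northSteps_eq_map (s := s), Finset.sum_map]
    rfl
  refine Finset.sum_nbij (fun w i => w (π.north s i)) ?_ ?_ ?_ ?_
  · intro w hw
    simp only [parking, Finset.mem_filter, mem_labels, hsum, hiff, Fintype.mem_piFinset] at hw ⊢
    exact ⟨fun i => hw.1.1.1 _ (hmem i), hw.1.2, hw.2⟩
  · intro w hw w' hw' h
    simp only [parking, Finset.coe_filter, Finset.mem_filter, mem_labels, Set.mem_ofPred_eq] at hw hw'
    funext P
    by_cases hP : P ∈ π.northSteps
    · obtain ⟨i, rfl⟩ := (π.mem_northSteps_iff_north (s := s)).1 hP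
      exact congrFun h i
    · rw [hw.1.1.2 P hP, hw'.1.1.2 P hP]
  · intro v hv
    simp only [Finset.coe_filter, Fintype.mem_piFinset, Set.mem_ofPred_eq] at hv
    -- A word is extended by the default label 1 off the North steps, in accordance with `labels`.
    have hext : ∀ i, Function.extend (π.north s) v 1 (π.north s i) = v i :=
      π.north_injective.extend_apply v 1
    refine ⟨Function.extend (π.north s) v 1, ?_, funext hext⟩
    simp only [parking, Finset.coe_filter, Finset.mem_filter, mem_labels, hsum, hiff, hext,
      Set.mem_ofPred_eq]
    refine ⟨⟨⟨fun P hP => ?_, fun P hP => ?_⟩, hv.2.1⟩, hv.2.2⟩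
    · obtain ⟨i, rfl⟩ := (π.mem_northSteps_iff_north (s := s)).1 hP
      rw [hext]
      exact hv.1 i
    · rw [Function.extend_apply' _ _ _ fun h => hP (π.mem_northSteps_iff_north.2 h)]
      rfl
  · intro w _
    rw [π.attackInv_eq_inv hs]

/-- The result of the sweep process, up to the determination of the scalar factor. -/
theorem exists_sweep (hs : IsSlope m n s ε) : ∃ F : SymFun, π.sweep s (-ε) = ofSym F ∧
    toSeries F = (∏ P ∈ π.visited s ε, π.scalar s P) • chi (π.attackPath s) (π.marking s) := by
  obtain ⟨F, h1, h2⟩ := π.sweep_eval hs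
  refine ⟨F, h1, MvPowerSeries.ext fun d => ?_⟩
  rw [π.coeff_of_eval h2, π.sum_parking hs]
  rfl

end DyckPath
end SweepProcess
end

/-! ### The scalar factor: area, dinv and maxtdinv -/

noncomputable section
namespace SweepProcess
namespace DyckPath

variable {m n : ℕ} (π : DyckPath m n) {s ε : ℝ}

open Classical in
/-- The number of pairs of North steps such that the first attacks the second. -/
def attackCount (s : ℝ) : ℕ :=
  ((π.northSteps ×ˢ π.northSteps).filter fun c => Attacks s c.1 c.2).card

/-- An attacked step is later in the reading order than its attacker, and so is the step directly
above a given one. So labels that decrease in the reading order are admissible and count every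
attack. -/
theorem maxtdinv_eq (s : ℝ) : π.maxtdinv s = π.attackCount s := by
  classical
  have hcount : π.attackCount s = ((Finset.univ : Finset (π.northSteps × π.northSteps)).filter
      fun c => Attacks s c.1 c.2).card := by
    rw [attackCount]
    symm
    refine Finset.card_nbij (fun c => ((c.1 : ℕ × ℕ), (c.2 : ℕ × ℕ))) ?_ ?_ ?_
    · intro c hc
      simp only [Finset.coe_filter, Set.mem_ofPred_eq, Finset.mem_product, Finset.mem_univ,
        true_and] at hc ⊢
      exact ⟨⟨c.1.2, c.2.2⟩, hc⟩
    · intro c _ c' _ h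
      simp only [Prod.mk.injEq] at h
      exact Prod.ext (Subtype.ext h.1) (Subtype.ext h.2)
    · intro c hc
      simp only [Finset.coe_filter, Finset.mem_product, Set.mem_ofPred_eq] at hc
      exact ⟨(⟨c.1, hc.1.1⟩, ⟨c.2, hc.1.2⟩), by simpa using hc.2, rfl⟩
  refine IsGreatest.csSup_eq ⟨?_, ?_⟩
  -- The label of P is the number of North steps that do not precede P; it is positive because P
  -- itself is counted.
  · let f : ℕ × ℕ → ℕ := fun P => (π.northSteps.filter fun R => height s P ≤ height s R).card
    have hf : ∀ P ∈ π.northSteps, 0 < f P := fun P hP =>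
      Finset.card_pos.2 ⟨P, Finset.mem_filter.2 ⟨hP, le_rfl⟩⟩
    have hlt : ∀ P ∈ π.northSteps, ∀ Q, height s P < height s Q → f Q < f P := by
      intro P hP Q hPQ
      refine Finset.card_lt_card (Finset.ssubset_iff_subset_ne.2 ⟨fun R hR => ?_, fun h => ?_⟩)
      · rw [Finset.mem_filter] at hR ⊢
        exact ⟨hR.1, hPQ.le.trans hR.2⟩
      · have : P ∈ π.northSteps.filter fun R => height s Q ≤ height s R := by
          rw [h]; exact Finset.mem_filter.2 ⟨hP, le_rfl⟩
        exact absurd (Finset.mem_filter.1 this).2 (not_le.2 hPQ)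
    refine ⟨fun P => ⟨f P, hf P P.2⟩, fun P Q h => ?_, ?_⟩
    · refine hlt P P.2 Q ?_
      rw [h, height_up]
      linarith
    · unfold tdinv
      rw [hcount]
      congr 1
      ext c
      simp only [Finset.mem_filter]
      exact and_congr_right fun _ => and_iff_left_of_imp fun h => hlt c.1 c.1.2 c.2 h.1
  · rintro _ ⟨w, _, rfl⟩
    rw [tdinv, hcount]
    refine Finset.card_le_card fun c hc => ?_
    rw [Finset.mem_filter] at hc ⊢
    exact ⟨hc.1, hc.2.1⟩

open Classical in
-- A cell between the path and the diagonal is matched with its lower right corner, a point strictly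
-- below the path and weakly above the diagonal.
theorem card_visited_E (hs : IsSlope m n s ε) :
    ((π.visited s ε).filter fun P => π.event P = .E).card = π.area := by
  rw [area]
  symm
  refine Finset.card_nbij (fun c => ((c.1 : ℕ) + 1, c.2)) ?_ ?_ ?_
  · rintro ⟨i, j⟩ hc
    rw [Finset.mem_coe, Finset.mem_filter] at hc ⊢
    rw [π.mem_visited hs]
    simp only [event, lo_succ]
    have h1 := π.lo_le_hi (i + 1)
    rw [lo_succ] at h1
    have h2 : j + 1 ≤ π.ht i := hc.2.1
    exact ⟨⟨i.2, by omega, hc.2.2⟩, if_pos (by omega)⟩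
  · rintro ⟨i, j⟩ _ ⟨i', j'⟩ _ h
    simp only [Prod.mk.injEq, Nat.add_right_cancel_iff, Fin.val_inj] at h ⊢
    exact h
  · rintro ⟨x, y⟩ hP
    simp only [Finset.coe_filter, π.mem_visited hs, Set.mem_ofPred_eq] at hP
    have h1 : y < π.lo x := by
      by_contra h1
      have := hP.2
      simp only [event, if_neg h1] at this
      split_ifs at this
    cases x with
    | zero => rw [lo_zero] at h1; omega
    | succ x =>
      obtain ⟨⟨h2, h3, h4⟩, _⟩ := hP
      have h5 := (π.lo_le_hi (x + 1)).trans (π.hi_le _)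
      refine ⟨(⟨x, h2⟩, y), ?_, rfl⟩
      simp only [Finset.coe_filter, Finset.mem_product, Finset.mem_univ, Finset.mem_range,
        Set.mem_ofPred_eq, true_and]
      have h6 : π.lo (x + 1) = π.ht ⟨x, h2⟩ := π.lo_succ ⟨x, h2⟩
      exact ⟨by omega, by omega, h4⟩

/-- The sign of the exponent of `q` which a point of the path contributes. -/
def sign (P : ℕ × ℕ) : ℤ :=
  if P.2 = π.lo P.1 ∧ P.2 = π.hi P.1 then 1 else if π.lo P.1 < P.2 ∧ P.2 < π.hi P.1 then -1 else 0

theorem scalar_eq (P : ℕ × ℕ) (hP : P.2 ≤ π.hi P.1) : π.scalar s P =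
    (if π.event P = .E then t else 1) * q ^ (π.sign P * (π.crossingsRight s P : ℤ)) := by
  have h := π.lo_le_hi P.1
  have h1 : π.scalar s P = match π.event P with
    | .C => (q ^ π.crossingsRight s P)⁻¹
    | .D => q ^ π.crossingsRight s P
    | .E => t
    | _ => 1 := rfl
  rw [h1, sign]
  unfold event
  split_ifs <;> first | omega | simp_all

open Classical in
theorem prod_scalar (hs : IsSlope m n s ε) : ∏ P ∈ π.visited s ε, π.scalar s P =
    t ^ π.area * q ^ ∑ P ∈ rect m n, π.sign P * (π.crossingsRight s P : ℤ) := by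
  have h1 : ∑ P ∈ rect m n, π.sign P * (π.crossingsRight s P : ℤ) =
      ∑ P ∈ π.visited s ε, π.sign P * (π.crossingsRight s P : ℤ) := by
    symm
    refine Finset.sum_subset (Finset.filter_subset _ _) fun P hP hP' => ?_
    -- Points of nonzero sign lie on the path, and those are all visited.
    have h2 : π.sign P = 0 := by
      have h3 := (π.mem_visited_of_lo_le hs (mem_rect.1 hP).1).mt
      have h4 := π.lo_le_hi P.1
      unfold sign
      split_ifs with h5 h6
      · exact absurd (π.mem_visited_of_lo_le hs (mem_rect.1 hP).1 (by omega) (by omega)) hP'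
      · exact absurd (π.mem_visited_of_lo_le hs (mem_rect.1 hP).1 (by omega) (by omega)) hP'
      · rfl
    rw [h2, zero_mul]
  rw [h1, ← π.card_visited_E hs, ← Finset.prod_const, Finset.prod_filter]
  have hq : ∀ (S : Finset (ℕ × ℕ)) (f : ℕ × ℕ → ℤ), q ^ ∑ P ∈ S, f P = ∏ P ∈ S, q ^ f P := by
    intro S f
    induction S using Finset.induction_on with
    | empty => simp
    | insert a S ha ih => rw [Finset.sum_insert ha, Finset.prod_insert ha, zpow_add₀ W.q_ne_zero, ih]
  rw [hq, ← Finset.prod_mul_distrib]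
  exact Finset.prod_congr rfl fun P hP => π.scalar_eq P ((π.mem_visited hs).1 hP).2.1

/-- The point of a column without North steps counts +1, the inner points of a vertical run count
-1. Both cases agree with the single expression on the right, where the value at the bottom of a run
cancels. -/
theorem sum_sign (x : ℕ) (g : ℕ → ℤ) : ∑ y ∈ Finset.range (n + 1), π.sign (x, y) * g y =
    g (π.lo x) - ∑ y ∈ Finset.Ico (π.lo x) (π.hi x), g y := by
  have h1 := π.lo_le_hi x
  have h2 := π.hi_le x
  rcases h1.eq_or_lt with h | h
  · rw [h, Finset.Ico_self, Finset.sum_empty, sub_zero,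
      Finset.sum_eq_single_of_mem (π.hi x) (by simp; omega)]
    · simp [sign, h]
    · intro y _ hy
      simp only [sign, h]
      rw [if_neg (by omega), if_neg (by omega), zero_mul]
  · rw [Finset.sum_eq_sum_Ico_succ_bot h, sub_add_cancel_left, ← Finset.sum_neg_distrib]
    have hsub : Finset.Ico (π.lo x + 1) (π.hi x) ⊆ Finset.range (n + 1) := fun y hy => by
      rw [Finset.mem_Ico] at hy
      rw [Finset.mem_range]
      omega
    refine (Finset.sum_subset hsub fun y _ hy => ?_).symm.trans (Finset.sum_congr rfl fun y hy => ?_)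
    · rw [Finset.mem_Ico] at hy
      simp only [sign]
      rw [if_neg (by omega), if_neg (by omega), zero_mul]
    · rw [Finset.mem_Ico] at hy
      simp only [sign]
      rw [if_neg (by omega), if_pos (by omega)]
      ring

/-- The two inequalities say that the vector (a + 1, l) is strictly below the diagonal and (a, l +
1) weakly above it; for vectors of this width this is the sign of the height. These vectors lead
from the start of the East step to Q, and from its end to the top of Q. -/
theorem dinv_cond (hs : IsSlope m n s ε) {x y : ℕ} {Q : ℕ × ℕ} (hQ : Q.1 ≤ m) (hx : x + 1 ≤ Q.1)
    (hy : y ≤ Q.2) :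
    ((Q.1 - (x + 1)) * n ≤ m * (Q.2 - y + 1) ∧ m * (Q.2 - y) < n * (Q.1 - (x + 1) + 1)) ↔
      height s Q < height s (x, y) ∧ height s (x + 1, y) < height s Q + 1 := by
  obtain ⟨a, ha⟩ := Nat.exists_eq_add_of_le hx
  obtain ⟨l, hl⟩ := Nat.exists_eq_add_of_le hy
  have hε := hs.ε_pos
  have e1 : Q.1 - (x + 1) = a := by omega
  have e2 : Q.2 - y = l := by omega
  have h1 : (Q.1 : ℝ) = x + 1 + a := by rw [ha]; push_cast; ring
  have h2 : (Q.2 : ℝ) = y + l := by rw [hl]; push_cast; ring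
  have ham : a + 1 ≤ m := by omega
  rw [e1, e2, and_comm]
  simp only [height, h1, h2]
  push_cast
  refine and_congr ⟨fun h => ?_, fun h => ?_⟩ ⟨fun h => ?_, fun h => ?_⟩
  · have := hs.of_lt (a + 1) l ham (by exact_mod_cast h)
    push_cast at this
    linarith
  · by_contra hcon
    have := hs.of_le (a + 1) l ham (by exact_mod_cast not_lt.1 hcon)
    push_cast at this
    have : 0 ≤ ε * ((a : ℝ) + 1) := by positivity
    linarith
  · have := hs.of_le a (l + 1) (by omega) (by rw [mul_comm]; exact_mod_cast h)
    push_cast at this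
    -- For a = 0 the bound ε a is not strict, but then the vector is vertical and its height is l +
    -- 1.
    rcases Nat.eq_zero_or_pos a with h0 | h0
    · subst h0
      have : (0 : ℝ) ≤ l := Nat.cast_nonneg l
      push_cast
      linarith
    · have : 0 < ε * (a : ℝ) := by positivity
      linarith
  · by_contra hcon
    have := hs.of_lt a (l + 1) (by omega) (by rw [mul_comm (n : ℤ)]; exact_mod_cast not_le.1 hcon)
    push_cast at this
    linarith

open Classical in
/-- The balance of a column, as seen from a North step `Q` to its right. -/
theorem column (hs : IsSlope m n s ε) {Q : ℕ × ℕ} (hQ : Q ∈ π.northSteps) {x : ℕ} (hx : x < Q.1) :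
    (if height s Q < height s (x, π.hi x) ∧ height s (x + 1, π.hi x) < height s Q + 1
      then 1 else 0 : ℤ) -
    (∑ y ∈ Finset.Ico (π.lo x) (π.hi x),
      if height s Q - 1 < height s (x, y) ∧ height s (x, y) < height s Q + 1 then 1 else 0) -
    (∑ y ∈ Finset.range (n + 1), π.sign (x, y) *
      if height s Q < height s (x, y) ∧ height s (x, y) < height s Q + 1 then 1 else 0) =
    (if height s Q + 1 < height s (x, π.lo x) then 1 else 0) -
      if height s Q + 1 < height s (x + 1, π.lo (x + 1)) then 1 else 0 := by
  obtain ⟨hQm, hQlo, _⟩ := π.mem_northSteps.1 hQ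
  have hne : ∀ y, height s (x, y) ≠ height s Q := fun y h => by
    have := congrArg Prod.fst (hs.height_injOn (P := (x, y)) (by simp; omega) hQm h)
    simp at this; omega
  have hne' : ∀ y, height s (x, y) ≠ height s Q + 1 := fun y h => by
    rw [← height_up] at h
    have := congrArg Prod.fst (hs.height_injOn (P := (x, y)) (by simp; omega) (by exact hQm) h)
    simp [up] at this; omega
  have hlow : height s (x, π.hi x) = height s (x + 1, π.hi x) + s := by
    simp only [height]
    push_cast
    ring
  have hs0 := hs.s_pos
  -- Here u and v indicate the points of the column above the start and above the top of Q. Every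
  -- term becomes a difference: the crossing count is u(y) - v(y), the attack count is u(y + 1) -
  -- v(y), and the dinv count is u at the top of the column minus the v-indicator at the bottom of
  -- the next column. The values of u then cancel.
  set u : ℕ → ℤ := fun y => if height s Q < height s (x, y) then 1 else 0 with hu
  set v : ℕ → ℤ := fun y => if height s Q + 1 < height s (x, y) then 1 else 0 with hv
  have e1 : ∀ y, (if height s Q < height s (x, y) ∧ height s (x, y) < height s Q + 1
      then 1 else 0 : ℤ) = u y - v y := by
    intro y
    have := hne y
    rcases lt_or_gt_of_ne (hne' y) with h | h
    · simp only [hu, hv, h, and_true, if_neg (not_lt.2 h.le), sub_zero]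
    · simp only [hu, hv, h, not_lt.2 h.le, and_false, if_true, if_false,
        if_pos (show height s Q < height s (x, y) by linarith), sub_self]
  have hstep : ∀ y, height s (x, y + 1) = height s (x, y) + 1 := fun y => height_up s (x, y)
  have e2 : ∀ y, (if height s Q - 1 < height s (x, y) ∧ height s (x, y) < height s Q + 1
      then 1 else 0 : ℤ) = u (y + 1) - v y := by
    intro y
    have h3 : (height s Q - 1 < height s (x, y)) ↔ height s Q < height s (x, y + 1) := by
      rw [hstep, sub_lt_iff_lt_add]
    simp only [h3]
    rcases lt_or_gt_of_ne (hne' y) with h | h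
    · simp only [hu, hv, h, and_true, if_neg (not_lt.2 h.le), sub_zero]
    · simp only [hu, hv, h, not_lt.2 h.le, and_false, if_true, if_false,
        if_pos (show height s Q < height s (x, y + 1) by rw [hstep]; linarith), sub_self]
  have e3 : (if height s Q < height s (x, π.hi x) ∧ height s (x + 1, π.hi x) < height s Q + 1
      then 1 else 0 : ℤ) = u (π.hi x) -
        if height s Q + 1 < height s (x + 1, π.lo (x + 1)) then 1 else 0 := by
    rw [← π.hi_eq_lo_succ (by omega)]
    have hne2 : height s (x + 1, π.hi x) ≠ height s Q + 1 := by
      rw [← height_up]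
      intro h
      have := congrArg Prod.snd (hs.height_injOn (P := (x + 1, π.hi x)) (by simp; omega)
        (by exact hQm) h)
      simp only [up] at this
      have := π.hi_mono_lo hx hQm
      omega
    rcases lt_or_gt_of_ne hne2 with h | h
    · simp only [hu, h, and_true, if_neg (not_lt.2 h.le), sub_zero]
    · simp only [hu, h, not_lt.2 h.le, and_false, if_true, if_false,
        if_pos (show height s Q < height s (x, π.hi x) by linarith), sub_self]
  rw [e3, π.sum_sign x]
  simp only [e1, e2]
  have h4 : ∑ y ∈ Finset.Ico (π.lo x) (π.hi x), (u (y + 1) - u y) = u (π.hi x) - u (π.lo x) :=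
    Finset.sum_Ico_sub u (π.lo_le_hi x)
  simp only [Finset.sum_sub_distrib] at h4 ⊢
  change _ = v (π.lo x) - _
  linarith

open Classical in
-- Steps on one vertical do not attack each other. Of two others, with Q the one on the right, one
-- attacks the other exactly when their heights differ by less than 1.
theorem attackCount_eq (hs : IsSlope m n s ε) : (π.attackCount s : ℤ) = ∑ Q ∈ π.northSteps,
    ∑ x ∈ Finset.range Q.1, ∑ y ∈ Finset.Ico (π.lo x) (π.hi x),
      if height s Q - 1 < height s (x, y) ∧ height s (x, y) < height s Q + 1 then 1 else 0 := by
  have h1 : (π.attackCount s : ℤ) = ∑ P ∈ π.northSteps, ∑ Q ∈ π.northSteps,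
      if Attacks s P Q then 1 else 0 := by
    rw [attackCount, Finset.card_filter, Finset.sum_product]
    push_cast
    rfl
  have h2 : ∀ P Q : ℕ × ℕ, Attacks s P Q → P.1 ≠ Q.1 := by
    rintro P Q ⟨h3, h4⟩ h5
    rw [height_up] at h4
    simp only [height, h5] at h3 h4
    have h6 : (P.2 : ℝ) < Q.2 := by linarith
    have h7 : (Q.2 : ℝ) < (P.2 + 1 : ℕ) := by push_cast; linarith
    have h8 : P.2 < Q.2 := by exact_mod_cast h6
    have h9 : Q.2 < P.2 + 1 := by exact_mod_cast h7
    omega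
  have h3 : ∀ P Q : ℕ × ℕ, (if Attacks s P Q then 1 else 0 : ℤ) =
      (if P.1 < Q.1 ∧ Attacks s P Q then 1 else 0) + if Q.1 < P.1 ∧ Attacks s P Q then 1 else 0 := by
    intro P Q
    by_cases h : Attacks s P Q
    · rcases lt_or_gt_of_ne (h2 P Q h) with h4 | h4
      · simp [h, h4, not_lt.2 h4.le]
      · simp [h, h4, not_lt.2 h4.le]
    · simp [h]
  simp only [h3, Finset.sum_add_distrib] at h1
  rw [Finset.sum_comm, ← Finset.sum_add_distrib] at h1
  rw [h1]
  refine Finset.sum_congr rfl fun Q hQ => ?_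
  have hQm := (π.mem_northSteps.1 hQ).1
  rw [← Finset.sum_add_distrib, ← Finset.sum_finset_product
    (π.northSteps.filter fun P => P.1 < Q.1) _ _ (fun P => ?_)
    (f := fun P => if height s Q - 1 < height s P ∧ height s P < height s Q + 1 then (1 : ℤ) else 0),
    Finset.sum_filter]
  · refine Finset.sum_congr rfl fun P hP => ?_
    have hPm := (π.mem_northSteps.1 hP).1
    by_cases h : P.1 < Q.1
    · have hne : height s P ≠ height s Q := fun h4 => by
        rw [hs.height_injOn hPm hQm h4] at h
        exact lt_irrefl _ h
      simp only [Attacks, height_up, h, true_and, if_true]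
      rcases lt_or_gt_of_ne hne with h4 | h4
      · simp [h4, not_lt.2 h4.le, show height s P < height s Q + 1 by linarith, sub_lt_iff_lt_add]
      · simp [h4, not_lt.2 h4.le, show height s Q - 1 < height s P by linarith]
    · simp [h]
  · rw [Finset.mem_filter, mem_northSteps, Finset.mem_range, Finset.mem_Ico]
    constructor
    · rintro ⟨⟨_, h4⟩, h5⟩; exact ⟨h5, h4⟩
    · rintro ⟨h5, h4⟩; exact ⟨⟨by omega, h4⟩, h5⟩

open Classical in
theorem dinv_eq (hs : IsSlope m n s ε) : (π.dinv : ℤ) = ∑ Q ∈ π.northSteps,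
    ∑ x ∈ Finset.range Q.1, if height s Q < height s (x, π.hi x) ∧
      height s (x + 1, π.hi x) < height s Q + 1 then 1 else 0 := by
  rw [dinv, Finset.card_filter, Finset.sum_product_right]
  push_cast
  refine Finset.sum_congr rfl fun Q hQ => ?_
  obtain ⟨hQm, hQlo, _⟩ := π.mem_northSteps.1 hQ
  have h1 : ∀ i : Fin m, (if (i : ℕ) + 1 ≤ Q.1 ∧
      (Q.1 - ((i : ℕ) + 1)) * n ≤ m * (Q.2 - π.ht i + 1) ∧
      m * (Q.2 - π.ht i) < n * (Q.1 - ((i : ℕ) + 1) + 1) then (1 : ℤ) else 0) =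
      (fun x : ℕ => if x < Q.1 then if height s Q < height s (x, π.hi x) ∧
      height s (x + 1, π.hi x) < height s Q + 1 then (1 : ℤ) else 0 else 0) i := by
    intro i
    dsimp only
    by_cases h : (i : ℕ) < Q.1
    · have h2 := π.hi_mono_lo h hQm
      rw [if_pos h, ← π.hi_fin]
      refine if_congr ?_ rfl rfl
      rw [← dinv_cond hs hQm h (h2.trans hQlo)]
      exact and_iff_right h
    · rw [if_neg h, if_neg fun h2 => h h2.1]
  rw [Finset.sum_congr rfl fun i _ => h1 i, Fin.sum_univ_eq_sum_range (fun x : ℕ => if x < Q.1 then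
    if height s Q < height s (x, π.hi x) ∧ height s (x + 1, π.hi x) < height s Q + 1 then (1 : ℤ) else 0
    else 0), ← Finset.sum_filter]
  refine Finset.sum_congr ?_ fun _ _ => rfl
  ext x
  rw [Finset.mem_filter, Finset.mem_range, Finset.mem_range]
  omega

open Classical in
theorem sum_sign_crossings (s : ℝ) :
    ∑ P ∈ rect m n, π.sign P * (π.crossingsRight s P : ℤ) = ∑ Q ∈ π.northSteps,
      ∑ x ∈ Finset.range Q.1, ∑ y ∈ Finset.range (n + 1), π.sign (x, y) *
        if height s Q < height s (x, y) ∧ height s (x, y) < height s Q + 1 then 1 else 0 := by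
  have h1 : ∀ P, π.sign P * (π.crossingsRight s P : ℤ) = ∑ Q ∈ π.northSteps, if P.1 < Q.1 then
      π.sign P * (if height s Q < height s P ∧ height s P < height s Q + 1 then 1 else 0) else 0 := by
    intro P
    rw [crossingsRight, Finset.card_filter]
    push_cast
    rw [Finset.mul_sum]
    refine Finset.sum_congr rfl fun Q _ => ?_
    rw [height_up]
    by_cases h : P.1 < Q.1 <;> simp [h]
  rw [Finset.sum_congr rfl fun P _ => h1 P, Finset.sum_comm]
  refine Finset.sum_congr rfl fun Q hQ => ?_
  have hQm := (π.mem_northSteps.1 hQ).1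
  rw [← Finset.sum_filter, ← Finset.sum_finset_product
    ((rect m n).filter fun P => P.1 < Q.1) _ _ (fun P => ?_)
    (f := fun P => π.sign P *
      if height s Q < height s P ∧ height s P < height s Q + 1 then (1 : ℤ) else 0)]
  rw [Finset.mem_filter, mem_rect, Finset.mem_range, Finset.mem_range]
  omega

/-- For fixed Q the columns to its left telescope by `column`. Both boundary terms vanish: the
bottom of column 0 has height 0, the bottom of the column of Q is not above Q, and neither is above
the top of Q, since North steps have nonnegative height. -/
theorem dinv_sub_attackCount (hs : IsSlope m n s ε) : (π.dinv : ℤ) - π.attackCount s =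
    ∑ P ∈ rect m n, π.sign P * (π.crossingsRight s P : ℤ) := by
  rw [π.dinv_eq hs, π.attackCount_eq hs, π.sum_sign_crossings s, ← Finset.sum_sub_distrib, ← sub_eq_zero,
    ← Finset.sum_sub_distrib]
  refine Finset.sum_eq_zero fun Q hQ => ?_
  have hQ' := (π.mem_visited hs).1 (π.northSteps_subset hs hQ)
  rw [← Finset.sum_sub_distrib, ← Finset.sum_sub_distrib,
    Finset.sum_congr rfl fun x hx => π.column hs hQ (Finset.mem_range.1 hx),
    Finset.sum_range_sub' fun x => if height s Q + 1 < height s (x, π.lo x) then (1 : ℤ) else 0]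
  have h1 : (0 : ℝ) ≤ height s Q := by
    have := hs.of_le Q.1 Q.2 hQ'.1 (by exact_mod_cast hQ'.2.2)
    have h2 : 0 ≤ ε * (Q.1 : ℝ) := mul_nonneg hs.ε_pos.le (Nat.cast_nonneg _)
    simp only [height]
    push_cast at this
    linarith
  have h2 : height s (0, π.lo 0) = 0 := by simp [height, lo_zero]
  have h3 : height s (Q.1, π.lo Q.1) ≤ height s Q := by
    have : (π.lo Q.1 : ℝ) ≤ Q.2 := by exact_mod_cast (π.mem_northSteps.1 hQ).2.1
    simp only [height]
    linarith
  rw [if_neg (by rw [h2]; linarith), if_neg (by linarith), sub_zero]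

/-- The sweep process computes the characteristic function of the path. -/
theorem sweep_eq_D (hs : IsSlope m n s ε) :
    ∃ F : SymFun, toSeries F = π.D s ∧ π.sweep s (-ε) = ofSym F := by
  obtain ⟨F, h1, h2⟩ := π.exists_sweep hs
  refine ⟨F, ?_, h1⟩
  rw [h2, D, π.prod_scalar hs, π.maxtdinv_eq, π.dinv_sub_attackCount hs]

end DyckPath
end SweepProcess
end

/-! ### Sums over families of colorings, by first and by last move -/

noncomputable section
namespace SweepProcess

open Classical in
/-- The moves at `P` from a coloring `c` to colorings in `R`. -/
def movesFrom (R : Finset Coloring) (P : ℕ × ℕ) (c : Coloring) : Finset (Coloring × Event) :=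
  (R ×ˢ Finset.univ).filter fun x => IsMove P x.2 c x.1

open Classical in
/-- The moves at `P` to a coloring `c` from colorings in `R`. -/
def movesTo (R : Finset Coloring) (P : ℕ × ℕ) (c : Coloring) : Finset (Coloring × Event) :=
  (R ×ˢ Finset.univ).filter fun x => IsMove P x.2 x.1 c

theorem mem_movesFrom {R : Finset Coloring} {P : ℕ × ℕ} {c : Coloring} {x : Coloring × Event} :
    x ∈ movesFrom R P c ↔ x.1 ∈ R ∧ IsMove P x.2 c x.1 := by
  simp [movesFrom]

theorem mem_movesTo {R : Finset Coloring} {P : ℕ × ℕ} {c : Coloring} {x : Coloring × Event} :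
    x ∈ movesTo R P c ↔ x.1 ∈ R ∧ IsMove P x.2 x.1 c := by
  simp [movesTo]

open Classical in
/-- The sum of the results over the families of colorings from `c₀` to `c` along a list of points. -/
def total (R : Finset Coloring) (c : Coloring) : List (ℕ × ℕ) → Coloring → VStar → VStar
  | [], c₀, φ => if c₀ = c then φ else 0
  | P :: L, c₀, φ => ∑ x ∈ movesFrom R P c₀, total R c L x.1 (x.2.op (startsRight c₀ P) φ)

/-- The recursion for `total` splits off the first move; here the last move is split off, as the
rules for the descending line require. -/
theorem total_append_singleton {R : Finset Coloring} {c : Coloring} (hc : c ∈ R) (P : ℕ × ℕ)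
    (L : List (ℕ × ℕ)) (c₀ : Coloring) (hc₀ : c₀ ∈ R) (φ : VStar) : total R c (L ++ [P]) c₀ φ =
      ∑ x ∈ movesTo R P c, x.2.op (startsRight x.1 P) (total R x.1 L c₀ φ) := by
  induction L generalizing c₀ φ with
  | nil =>
    simp only [List.nil_append, total, apply_ite (Event.op _ _), map_zero]
    rw [← Finset.sum_filter, ← Finset.sum_filter]
    refine Finset.sum_nbij' (fun x => (c₀, x.2)) (fun x => (c, x.2)) ?_ ?_ ?_ ?_ ?_
    · rintro ⟨c', e⟩ hx
      simp only [Finset.mem_filter, mem_movesFrom, mem_movesTo] at hx ⊢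
      obtain ⟨⟨_, hx⟩, rfl⟩ := hx
      exact ⟨⟨hc₀, hx⟩, trivial⟩
    · rintro ⟨c', e⟩ hx
      simp only [Finset.mem_filter, mem_movesFrom, mem_movesTo] at hx ⊢
      obtain ⟨⟨_, hx⟩, rfl⟩ := hx
      exact ⟨⟨hc, hx⟩, trivial⟩
    · rintro ⟨c', e⟩ hx
      exact Prod.ext (Finset.mem_filter.1 hx).2.symm rfl
    · rintro ⟨c', e⟩ hx
      exact Prod.ext (Finset.mem_filter.1 hx).2 rfl
    · rintro ⟨c', e⟩ _
      rfl
  | cons P' L ih =>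
    simp only [List.cons_append, total, map_sum]
    rw [Finset.sum_comm]
    exact Finset.sum_congr rfl fun x hx => ih x.1 (mem_movesFrom.1 hx).1 _

/-- Families of colorings along a list of points which begin with `c₀`. -/
def IsFamilyFrom (c₀ : Coloring) (L : List (ℕ × ℕ)) (c : Coloring) (f : Fin (L.length + 1) → Coloring)
    (e : Fin L.length → Event) : Prop :=
  f 0 = c₀ ∧ f (Fin.last _) = c ∧ ∀ i, IsMove (L.get i) (e i) (f i.castSucc) (f i.succ)

/-- The result of the algorithm along a family, started with `φ`. -/
def resultFrom (φ : VStar) (L : List (ℕ × ℕ)) (f : Fin (L.length + 1) → Coloring)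
    (e : Fin L.length → Event) : VStar :=
  (List.finRange L.length).foldl
    (fun φ i => (e i).op (startsRight (f i.castSucc) (L.get i)) φ) φ

theorem resultFrom_cons (φ : VStar) (P : ℕ × ℕ) (L : List (ℕ × ℕ))
    (f : Fin (L.length + 2) → Coloring) (e : Fin (L.length + 1) → Event) :
    resultFrom φ (P :: L) f e =
      resultFrom ((e 0).op (startsRight (f 0) P) φ) L (Fin.tail f) (Fin.tail e) := by
  rw [resultFrom, resultFrom]
  change List.foldl _ _ (List.finRange (L.length + 1)) = _
  rw [List.finRange_succ, List.foldl_cons, List.foldl_map]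
  rfl

theorem isFamilyFrom_cons (c₀ : Coloring) (P : ℕ × ℕ) (L : List (ℕ × ℕ)) (c : Coloring)
    (f : Fin (L.length + 2) → Coloring) (e : Fin (L.length + 1) → Event) :
    IsFamilyFrom c₀ (P :: L) c f e ↔ f 0 = c₀ ∧ IsMove P (e 0) (f 0) (f 1) ∧
      IsFamilyFrom (f 1) L c (Fin.tail f) (Fin.tail e) := by
  rw [IsFamilyFrom, IsFamilyFrom]
  change _ ∧ _ ∧ (∀ i : Fin (L.length + 1), _) ↔ _
  rw [Fin.forall_fin_succ]
  constructor
  · rintro ⟨h1, h2, h3, h4⟩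
    exact ⟨h1, h3, rfl, h2, h4⟩
  · rintro ⟨h1, h3, _, h2, h4⟩
    exact ⟨h1, h2, h3, h4⟩

open Classical in
-- A family consists of its first move and a family starting from the coloring so obtained.
theorem sum_families (R : Finset Coloring) (c : Coloring) (L : List (ℕ × ℕ)) (c₀ : Coloring)
    (hc₀ : c₀ ∈ R) (φ : VStar) :
    ∑ F ∈ ((Fintype.piFinset fun _ : Fin (L.length + 1) => R) ×ˢ
      (Finset.univ : Finset (Fin L.length → Event))).filter (fun F => IsFamilyFrom c₀ L c F.1 F.2),
      resultFrom φ L F.1 F.2 = total R c L c₀ φ := by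
  induction L generalizing c₀ φ with
  | nil =>
    rw [total]
    split_ifs with h
    · refine (Finset.sum_eq_single ((fun _ => c₀ : Fin 1 → Coloring), (Fin.elim0 : Fin 0 → Event))
        ?_ ?_).trans rfl
      · rintro ⟨f, e⟩ hF hne
        exfalso
        refine hne (Prod.ext (funext fun i => ?_) (funext fun i => i.elim0))
        obtain rfl := Subsingleton.elim i 0
        exact (Finset.mem_filter.1 hF).2.1
      · intro hF
        refine absurd (Finset.mem_filter.2 ⟨Finset.mem_product.2 ⟨?_, Finset.mem_univ _⟩, ?_⟩) hF
        · exact Fintype.mem_piFinset.2 fun _ => hc₀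
        · exact ⟨rfl, h, fun i => i.elim0⟩
    · refine Finset.sum_eq_zero fun F hF => absurd ?_ h
      obtain ⟨h1, h2, _⟩ := (Finset.mem_filter.1 hF).2
      rw [← h1, ← h2]
      rfl
  | cons P L ih =>
    rw [total, ← Finset.sum_congr rfl fun x hx => ih x.1 (mem_movesFrom.1 hx).1 _, Finset.sum_sigma']
    refine Finset.sum_bij'
      (fun (F : (Fin (L.length + 2) → Coloring) × (Fin (L.length + 1) → Event)) _ =>
        (⟨(F.1 1, F.2 0), (Fin.tail F.1, Fin.tail F.2)⟩ : Sigma fun _ : Coloring × Event =>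
          (Fin (L.length + 1) → Coloring) × (Fin L.length → Event)))
      (fun x _ => ((Fin.cons c₀ x.2.1 : Fin (L.length + 2) → Coloring),
        (Fin.cons x.1.2 x.2.2 : Fin (L.length + 1) → Event))) ?_ ?_ ?_ ?_ ?_
    · rintro ⟨f, e⟩ hF
      obtain ⟨hF1, hF2⟩ := Finset.mem_filter.1 hF
      have hf := Fintype.mem_piFinset.1 (Finset.mem_product.1 hF1).1
      obtain ⟨h1, h2, h3⟩ := (isFamilyFrom_cons c₀ P L c f e).1 hF2
      refine Finset.mem_sigma.2 ⟨mem_movesFrom.2 ⟨hf 1, ?_⟩, Finset.mem_filter.2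
        ⟨Finset.mem_product.2 ⟨Fintype.mem_piFinset.2 fun i => hf i.succ, Finset.mem_univ _⟩, h3⟩⟩
      rw [← h1]
      exact h2
    · rintro ⟨⟨c₁, e₀⟩, f, e⟩ hx
      obtain ⟨hx1, hx2⟩ := Finset.mem_sigma.1 hx
      obtain ⟨hx3, hx4⟩ := Finset.mem_filter.1 hx2
      have hf := Fintype.mem_piFinset.1 (Finset.mem_product.1 hx3).1
      refine Finset.mem_filter.2 ⟨Finset.mem_product.2
        ⟨Fintype.mem_piFinset.2 fun i => ?_, Finset.mem_univ _⟩, ?_⟩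
      · refine Fin.cases ?_ (fun j => ?_) i
        · exact hc₀
        · exact hf j
      · refine (isFamilyFrom_cons c₀ P L c _ _).2 ⟨rfl, ?_, ?_⟩
        · have h1 : f 0 = c₁ := hx4.1
          change IsMove P e₀ c₀ (f 0)
          rw [h1]
          exact (mem_movesFrom.1 hx1).2
        · exact ⟨rfl, hx4.2⟩
    · rintro ⟨f, e⟩ hF
      have h1 : f 0 = c₀ := (Finset.mem_filter.1 hF).2.1
      subst h1
      exact Prod.ext (Fin.cons_self_tail f) (Fin.cons_self_tail e)
    · rintro ⟨⟨c₁, e₀⟩, f, e⟩ hx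
      have h1 : f 0 = c₁ := (Finset.mem_filter.1 (Finset.mem_sigma.1 hx).2).2.1
      subst h1
      rfl
    · rintro ⟨f, e⟩ hF
      have h1 : f 0 = c₀ := (Finset.mem_filter.1 hF).2.1
      subst h1
      exact resultFrom_cons φ P L f e

theorem coloringD_eq_total (m n : ℕ) (s h : ℝ) (c : Coloring) : coloringD m n s h c =
    total (rect m n).powerset c (rectPoints m n s h) ∅ (ofSym 1) :=
  sum_families (rect m n).powerset c (rectPoints m n s h) ∅ (Finset.empty_mem_powerset _) (ofSym 1)

end SweepProcess
end

/-! ### Admissible colorings and the crossing of one lattice point -/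

noncomputable section
namespace SweepProcess

/-- The intervals of the coloring `c` of a line `y = s x + h` above the point `(m, n)` are in the
rectangle, of positive length and do not overlap. -/
structure Adm (m n : ℕ) (s h : ℝ) (c : Coloring) : Prop where
  mem : ∀ I ∈ c, I ∈ rect m n
  pos : ∀ I ∈ c, h < height s I
  apart : ∀ I ∈ c, ∀ J ∈ c, I ≠ J → height s (J.1, I.2) ≤ h ∨ height s (I.1, J.2) ≤ h

/-- On a line above (m, n) an interval of positive length with x(a) ≤ m and y(b) ≤ n automatically
has both ends in the rectangle. -/
theorem isAdmissible_iff {m n : ℕ} {s h : ℝ} (hh : height s (m, n) < h) {c : Coloring} :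
    IsAdmissible m n s h c ↔ Adm m n s h c := by
  simp only [height] at hh
  constructor
  · rintro ⟨h1, h2⟩
    refine ⟨fun I hI => mem_rect.2 ⟨(h1 I hI).1, (h1 I hI).2.2.1⟩, fun I hI => ?_, fun I hI J hJ hne => ?_⟩
    · have := (h1 I hI).2.2.2.2
      simp only [height]
      linarith
    · refine (h2 I hI J hJ hne).imp (fun h => ?_) fun h => ?_ <;>
      · simp only [height]
        linarith
  · rintro ⟨h1, h2, h3⟩
    refine ⟨fun I hI => ?_, fun I hI J hJ hne => ?_⟩
    · obtain ⟨h4, h5⟩ := mem_rect.1 (h1 I hI)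
      have h6 := h2 I hI
      simp only [height] at h6
      have h7 : (I.1 : ℝ) ≤ m := by exact_mod_cast h4
      have h8 : (I.2 : ℝ) ≤ n := by exact_mod_cast h5
      exact ⟨h4, by linarith, h5, by linarith, by linarith⟩
    · refine (h3 I hI J hJ hne).imp (fun h => ?_) fun h => ?_ <;>
      · simp only [height] at h
        linarith

/-- When the line descends from height `h'` to height `h`, it crosses exactly one point of the
rectangle, namely `P`. -/
structure Crosses (m n : ℕ) (s h h' : ℝ) (P : ℕ × ℕ) : Prop where
  mem : P ∈ rect m n
  lt : h < height s P
  lt' : height s P < h'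
  next : ∀ Q ∈ rect m n, h < height s Q → Q ≠ P → h' < height s Q

theorem exists_just_above (m n : ℕ) (s : ℝ) (P : ℕ × ℕ) :
    ∃ h', height s P < h' ∧ ∀ Q ∈ rect m n, height s P < height s Q → h' < height s Q := by
  have h1 : ∀ᶠ h' in nhdsWithin (height s P) (Set.Ioi (height s P)),
      ∀ Q ∈ rect m n, height s P < height s Q → h' < height s Q := by
    refine (Filter.eventually_all_finset _).2 fun Q _ => ?_
    by_cases h : height s P < height s Q
    · filter_upwards [nhdsWithin_le_nhds (Iio_mem_nhds h)] with h' h2 _ using h2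
    · exact Filter.Eventually.of_forall fun _ h2 => absurd h2 h
  obtain ⟨h', h2, h3⟩ := (h1.and self_mem_nhdsWithin).exists
  exact ⟨h', h3, h2⟩

section Slope

variable {m n : ℕ} {s ε : ℝ}

theorem exists_crosses (hs : IsSlope m n s ε) {h : ℝ} (hh : ∃ P ∈ rect m n, h < height s P) :
    ∃ h' P, Crosses m n s h h' P := by
  classical
  obtain ⟨P₀, hP₀, hP₀h⟩ := hh
  obtain ⟨P, hP, hmin⟩ := ((rect m n).filter fun P => h < height s P).exists_min_image (height s)
    ⟨P₀, Finset.mem_filter.2 ⟨hP₀, hP₀h⟩⟩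
  rw [Finset.mem_filter] at hP
  obtain ⟨h', h1, h2⟩ := exists_just_above m n s P
  refine ⟨h', P, hP.1, hP.2, h1, fun Q hQ h3 hne => h2 Q hQ ?_⟩
  refine lt_of_le_of_ne (hmin Q (Finset.mem_filter.2 ⟨hQ, h3⟩)) fun h4 => hne ?_
  exact (hs.height_injOn (mem_rect.1 hP.1).1 (mem_rect.1 hQ).1 h4).symm

open Classical in
/-- The number of points of the rectangle above the line. -/
def numAbove (m n : ℕ) (s h : ℝ) : ℕ := ((rect m n).filter fun P => h < height s P).card

theorem numAbove_lt {h h' : ℝ} {P : ℕ × ℕ} (hP : P ∈ rect m n) (h1 : h < height s P)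
    (h2 : height s P < h') : numAbove m n s h' < numAbove m n s h := by
  classical
  refine Finset.card_lt_card (Finset.ssubset_iff_subset_ne.2 ⟨fun Q hQ => ?_, fun h3 => ?_⟩)
  · rw [Finset.mem_filter] at hQ ⊢
    exact ⟨hQ.1, h1.trans (h2.trans hQ.2)⟩
  · have : P ∈ (rect m n).filter fun P => h' < height s P := by
      rw [h3]; exact Finset.mem_filter.2 ⟨hP, h1⟩
    exact lt_asymm h2 (Finset.mem_filter.1 this).2

/-- Induction along the descending line. -/
theorem descend (hs : IsSlope m n s ε) {motive : ℝ → Prop}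
    (start : ∀ h, (∀ P ∈ rect m n, ¬ h < height s P) → motive h)
    (step : ∀ h h' P, Crosses m n s h h' P → motive h' → motive h) (h : ℝ) : motive h := by
  induction hN : numAbove m n s h using Nat.strong_induction_on generalizing h with
  | _ N ih =>
    by_cases hh : ∃ P ∈ rect m n, h < height s P
    · obtain ⟨h', P, hc⟩ := exists_crosses hs hh
      refine step h h' P hc (ih _ ?_ h' rfl)
      rw [← hN]
      exact numAbove_lt hc.mem hc.lt hc.lt'
    · exact start h fun P hP h1 => hh ⟨P, hP, h1⟩

theorem mem_rectPoints {h : ℝ} {P : ℕ × ℕ} : P ∈ rectPoints m n s h ↔ P ∈ rect m n ∧ h < height s P := by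
  simp [rectPoints]

theorem descending_rectPoints (hs : IsSlope m n s ε) (h : ℝ) : Descending s (rectPoints m n s h) :=
  descending_sort hs _ fun _ hP => (mem_rect.1 (Finset.mem_filter.1 hP).1).1

theorem Crosses.rectPoints_eq (hs : IsSlope m n s ε) {h h' : ℝ} {P : ℕ × ℕ}
    (hc : Crosses m n s h h' P) : rectPoints m n s h = rectPoints m n s h' ++ [P] := by
  refine (descending_rectPoints hs h).eq_of_mem_iff ?_ fun Q => ?_
  · refine List.pairwise_append.2 ⟨descending_rectPoints hs h', List.pairwise_singleton _ _, ?_⟩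
    intro Q hQ R hR
    obtain rfl := List.mem_singleton.1 hR
    exact hc.lt'.trans (mem_rectPoints.1 hQ).2
  · rw [List.mem_append, mem_rectPoints, mem_rectPoints, List.mem_singleton]
    constructor
    · rintro ⟨h1, h2⟩
      by_cases h3 : Q = P
      · exact Or.inr h3
      · exact Or.inl ⟨h1, hc.next Q h1 h2 h3⟩
    · rintro (⟨h1, h2⟩ | rfl)
      · exact ⟨h1, (hc.lt.trans hc.lt').trans h2⟩
      · exact ⟨hc.mem, hc.lt⟩

theorem Crosses.coloringD_eq (hs : IsSlope m n s ε) {h h' : ℝ} {P : ℕ × ℕ}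
    (hc : Crosses m n s h h' P) {c : Coloring} (hcR : c ∈ (rect m n).powerset) :
    coloringD m n s h c = ∑ x ∈ movesTo (rect m n).powerset P c,
      x.2.op (startsRight x.1 P) (coloringD m n s h' x.1) := by
  simp only [coloringD_eq_total]
  rw [hc.rectPoints_eq hs, total_append_singleton hcR _ _ _ (Finset.empty_mem_powerset _)]

theorem coloringD_top {h : ℝ} (hh : ∀ P ∈ rect m n, ¬ h < height s P) (c : Coloring) :
    coloringD m n s h c = open Classical in if ∅ = c then ofSym 1 else 0 := by
  have h1 : rectPoints m n s h = [] := by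
    rw [List.eq_nil_iff_forall_not_mem]
    intro P hP
    rw [mem_rectPoints] at hP
    exact hh P hP.1 hP.2
  rw [coloringD_eq_total, h1, total]

/-! ## Heights of points with exchanged coordinates -/

theorem height_lt_of_snd_lt (s : ℝ) {a b b' : ℕ} (h : b < b') : height s (a, b) < height s (a, b') := by
  have : (b : ℝ) < b' := by exact_mod_cast h
  simp only [height]
  linarith

theorem height_le_height (hs : 0 < s) {a a' b b' : ℕ} (h : a' ≤ a) (h' : b ≤ b') :
    height s (a, b) ≤ height s (a', b') := by
  have h1 : (a' : ℝ) ≤ a := by exact_mod_cast h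
  have h2 : (b : ℝ) ≤ b' := by exact_mod_cast h'
  simp only [height]
  nlinarith

theorem height_lt_of_lt_fst (hs : 0 < s) {a a' b : ℕ} (h : a' < a) :
    height s (a, b) < height s (a', b) := by
  have h1 : (a' : ℝ) < a := by exact_mod_cast h
  simp only [height]
  nlinarith

/-! ## Moves between admissible colorings -/

namespace Crosses

variable {h h' : ℝ} {P : ℕ × ℕ}

theorem snd_lt (hc : Crosses m n s h h' P) {b : ℕ} (hb : h' < height s (P.1, b)) : P.2 < b := by
  by_contra h1
  have h2 : (b : ℝ) ≤ P.2 := by exact_mod_cast not_lt.1 h1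
  have := hc.lt'
  simp only [height] at *
  linarith

theorem fst_lt (hs : 0 < s) (hc : Crosses m n s h h' P) {a : ℕ} (ha : h' < height s (a, P.2)) :
    a < P.1 := by
  by_contra h1
  have h2 : (P.1 : ℝ) ≤ a := by exact_mod_cast not_lt.1 h1
  have := hc.lt'
  simp only [height] at *
  nlinarith

/-- A point of the rectangle which is not below `P` is `P` or above the upper line. -/
theorem above (hs : 0 < s) (hc : Crosses m n s h h' P) {a b : ℕ} (ha : a ≤ P.1) (hb : P.2 ≤ b)
    (hn : b ≤ n) (hne : a < P.1 ∨ P.2 < b) : h' < height s (a, b) := by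
  refine hc.next (a, b) (mem_rect.2 ⟨ha.trans (mem_rect.1 hc.mem).1, hn⟩) ?_ ?_
  · exact hc.lt.trans_le (height_le_height hs ha hb)
  · intro h1
    rw [← h1] at hne
    simp at hne

/-- Admissibility compares the line with points of the rectangle only, and P is the only one between
the two lines; so every comparison with another point is unaffected by the crossing. -/
theorem le_of_le (hc : Crosses m n s h h' P) {Q : ℕ × ℕ} (hQ : Q ∈ rect m n) (hne : Q ≠ P)
    (h1 : height s Q ≤ h') : height s Q ≤ h := by
  by_contra h2
  exact absurd (hc.next Q hQ (not_le.1 h2) hne) (not_lt.2 h1)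

theorem adm_up (hc : Crosses m n s h h' P) {c : Coloring} (ha : Adm m n s h c) (hP : P ∉ c) :
    Adm m n s h' c where
  mem := ha.mem
  pos I hI := hc.next I (ha.mem I hI) (ha.pos I hI) fun h1 => hP (h1 ▸ hI)
  apart I hI J hJ hne := by
    have := hc.lt.trans hc.lt'
    exact (ha.apart I hI J hJ hne).imp (fun h1 => h1.trans this.le) fun h1 => h1.trans this.le

/-- Two intervals which start and end at `P`, or contain it, do not occur together, unless one of
them starts where the other ends. -/
theorem eq_of_meets (hs : 0 < s) (hc : Crosses m n s h h' P) {c : Coloring} (ha : Adm m n s h c)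
    {I J : ℕ × ℕ} (hI : I ∈ c) (hJ : J ∈ c) (h1 : I.1 ≤ P.1) (h2 : P.2 ≤ I.2) (h3 : J.1 ≤ P.1)
    (h4 : P.2 ≤ J.2) : I = J := by
  by_contra hne
  have h5 := hc.lt
  rcases ha.apart I hI J hJ hne with h6 | h6
  · have := height_le_height hs h3 h2
    rw [Prod.mk.eta] at this
    linarith
  · have := height_le_height hs h1 h4
    rw [Prod.mk.eta] at this
    linarith

/-- Above `P` the only intervals of an admissible coloring which meet `P` are one that ends there and
one that starts there, or a single one. -/
theorem eq_or_eq_of_meets (hs : 0 < s) (hc : Crosses m n s h h' P) {c : Coloring}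
    (ha : Adm m n s h' c) {I J : ℕ × ℕ} (hI : I ∈ c) (hJ : J ∈ c) (h1 : I.1 ≤ P.1) (h2 : P.2 ≤ I.2)
    (h3 : J.1 ≤ P.1) (h4 : P.2 ≤ J.2) (hne : I ≠ J) :
    (J.1 = P.1 ∧ I.2 = P.2) ∨ (I.1 = P.1 ∧ J.2 = P.2) := by
  have hIn := (mem_rect.1 (ha.mem I hI)).2
  have hJn := (mem_rect.1 (ha.mem J hJ)).2
  rcases ha.apart I hI J hJ hne with h6 | h6
  · left
    by_contra h7
    exact absurd (hc.above hs h3 h2 hIn (by omega)) (not_lt.2 h6)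
  · right
    by_contra h7
    exact absurd (hc.above hs h1 h4 hJn (by omega)) (not_lt.2 h6)

/-- Descending past P can spoil only the comparison of an interval ending at P with one starting
there, and exactly this pair is joined by B. In the other cases such a pair does not exist. -/
theorem adm_move (hs : 0 < s) (hc : Crosses m n s h h' P) {c c' : Coloring} {e : Event}
    (ha : Adm m n s h' c) (hm : IsMove P e c c') : Adm m n s h c' := by
  have hhh := hc.lt.trans hc.lt'
  have hpos : ∀ I ∈ c, h < height s I := fun I hI => hhh.trans (ha.pos I hI)
  have hends : ∀ a, (a, P.2) ∈ c → a < P.1 := fun a hI => hc.fst_lt hs (ha.pos _ hI)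
  have hstarts : ∀ b, (P.1, b) ∈ c → P.2 < b := fun b hI => hc.snd_lt (ha.pos _ hI)
  have hapart : ∀ I ∈ c, ∀ J ∈ c, I ≠ J → ¬ (J.1 = P.1 ∧ I.2 = P.2) → ¬ (I.1 = P.1 ∧ J.2 = P.2) →
      height s (J.1, I.2) ≤ h ∨ height s (I.1, J.2) ≤ h := by
    intro I hI J hJ hne h1 h2
    have hI' := mem_rect.1 (ha.mem I hI)
    have hJ' := mem_rect.1 (ha.mem J hJ)
    refine (ha.apart I hI J hJ hne).imp (hc.le_of_le (mem_rect.2 ⟨hJ'.1, hI'.2⟩) ?_)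
      (hc.le_of_le (mem_rect.2 ⟨hI'.1, hJ'.2⟩) ?_)
    · intro h3; exact h1 ⟨(Prod.ext_iff.1 h3).1, (Prod.ext_iff.1 h3).2⟩
    · intro h3; exact h2 ⟨(Prod.ext_iff.1 h3).1, (Prod.ext_iff.1 h3).2⟩
  have hsame : (∀ a b, (a, P.2) ∈ c → (P.1, b) ∈ c → False) → Adm m n s h c := fun h1 =>
    { mem := ha.mem
      pos := hpos
      apart := fun I hI J hJ hne => by
        obtain ⟨a, b⟩ := I
        obtain ⟨a', b'⟩ := J
        refine hapart _ hI _ hJ hne ?_ ?_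
        · rintro ⟨h2, h3⟩
          simp only at h2 h3
          subst h2 h3
          exact h1 _ _ hI hJ
        · rintro ⟨h2, h3⟩
          simp only at h2 h3
          subst h2 h3
          exact h1 _ _ hJ hI }
  have hmeet : ¬ Meets c P → ∀ a b, (a, P.2) ∈ c → (P.1, b) ∈ c → False := fun h1 a b h2 _ =>
    h1 ⟨_, h2, (hends a h2).le, le_rfl⟩
  cases e with
  | pass =>
    obtain ⟨h1, rfl⟩ := hm
    exact hsame (hmeet h1)
  | A =>
    obtain ⟨h1, rfl⟩ := hm
    have h2 := hsame (hmeet h1)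
    have h3 : ∀ I ∈ c, height s (I.1, P.2) ≤ h ∨ height s (P.1, I.2) ≤ h := by
      intro I hI
      have hI' := mem_rect.1 (ha.mem I hI)
      have hP' := mem_rect.1 hc.mem
      have h4 : P.1 < I.1 ∨ I.2 < P.2 := by
        by_contra h4
        exact h1 ⟨I, hI, by omega, by omega⟩
      refine h4.imp (fun h5 => ?_) fun h5 => ?_
      · refine hc.le_of_le (mem_rect.2 ⟨hI'.1, hP'.2⟩) (fun h6 => ?_) ?_
        · exact h5.ne' ((Prod.ext_iff.1 h6).1)
        · exact ((height_lt_of_lt_fst hs h5).trans hc.lt').le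
      · refine hc.le_of_le (mem_rect.2 ⟨hP'.1, hI'.2⟩) (fun h6 => ?_) ?_
        · exact h5.ne ((Prod.ext_iff.1 h6).2)
        · exact ((height_lt_of_snd_lt s h5).trans hc.lt').le
    refine ⟨?_, ?_, ?_⟩
    · rw [Finset.forall_mem_insert]
      exact ⟨hc.mem, h2.mem⟩
    · rw [Finset.forall_mem_insert]
      exact ⟨hc.lt, h2.pos⟩
    · intro I hI J hJ hne
      rw [Finset.mem_insert] at hI hJ
      rcases hI with rfl | hI <;> rcases hJ with rfl | hJ
      · exact absurd rfl hne
      · exact h3 J hJ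
      · exact (h3 I hI).symm
      · exact h2.apart I hI J hJ hne
  | B =>
    obtain ⟨a, b, h1, h2, rfl⟩ := hm
    have haP := hends a h1
    have hPb := hstarts b h2
    have hab : ∀ J ∈ c, J ≠ (a, P.2) → J ≠ (P.1, b) →
        height s (J.1, b) ≤ h ∨ height s (a, J.2) ≤ h := by
      intro J hJ hJ1 hJ2
      have hJ' := mem_rect.1 (ha.mem J hJ)
      have hb' := mem_rect.1 (ha.mem _ h2)
      have ha' := mem_rect.1 (ha.mem _ h1)
      have key : height s (J.1, b) ≤ h' ∨ height s (a, J.2) ≤ h' := by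
        rcases ha.apart (a, P.2) h1 J hJ (Ne.symm hJ1) with h3 | h3
        · rcases ha.apart (P.1, b) h2 J hJ (Ne.symm hJ2) with h4 | h4
          · exact Or.inl h4
          -- An interval J lying to the right of the first half and to the left of the second would
          -- be squeezed into the point P, contradicting its positive length.
          · exfalso
            have hc' := hc.lt'
            have hp := ha.pos J hJ
            simp only [height] at h3 h4 hp hc'
            have h5 : P.1 ≤ J.1 := by
              by_contra h5
              exact absurd (hc.above hs (not_le.1 h5).le le_rfl (mem_rect.1 hc.mem).2
                (Or.inl (not_le.1 h5))) (not_lt.2 (by simp only [height]; exact h3))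
            have h6 : J.2 ≤ P.2 := by
              by_contra h6
              exact absurd (hc.above hs le_rfl (not_le.1 h6).le hJ'.2
                (Or.inr (not_le.1 h6))) (not_lt.2 (by simp only [height]; exact h4))
            have h7 : (P.1 : ℝ) ≤ J.1 := by exact_mod_cast h5
            have h8 : (J.2 : ℝ) ≤ P.2 := by exact_mod_cast h6
            nlinarith
        · exact Or.inr h3
      refine key.imp (hc.le_of_le (mem_rect.2 ⟨hJ'.1, hb'.2⟩) fun h3 => ?_)
        (hc.le_of_le (mem_rect.2 ⟨ha'.1, hJ'.2⟩) fun h3 => ?_)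
      · exact hPb.ne' ((Prod.ext_iff.1 h3).2)
      · exact haP.ne ((Prod.ext_iff.1 h3).1)
    have hmem : ∀ J, J ∈ (c.erase (a, P.2)).erase (P.1, b) ↔ J ≠ (P.1, b) ∧ J ≠ (a, P.2) ∧ J ∈ c := by
      intro J
      rw [Finset.mem_erase, Finset.mem_erase]
    refine ⟨?_, ?_, ?_⟩
    · rw [Finset.forall_mem_insert]
      exact ⟨mem_rect.2 ⟨(mem_rect.1 (ha.mem _ h1)).1, (mem_rect.1 (ha.mem _ h2)).2⟩,
        fun J hJ => ha.mem J ((hmem J).1 hJ).2.2⟩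
    · rw [Finset.forall_mem_insert]
      exact ⟨hhh.trans (hc.above hs haP.le hPb.le (mem_rect.1 (ha.mem _ h2)).2 (Or.inl haP)),
        fun J hJ => hpos J ((hmem J).1 hJ).2.2⟩
    · intro I hI J hJ hne
      rw [Finset.mem_insert, hmem] at hI hJ
      rcases hI with rfl | ⟨hI1, hI2, hI⟩ <;> rcases hJ with rfl | ⟨hJ1, hJ2, hJ⟩
      · exact absurd rfl hne
      · exact hab J hJ hJ2 hJ1
      · exact (hab I hI hI2 hI1).symm
      -- Only one interval ends at P, so no pair of remaining intervals touches there.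
      · have hend : ∀ I ∈ c, I ≠ (a, P.2) → I.2 ≠ P.2 := by
          rintro ⟨a', b'⟩ hI hI2 h3
          simp only at h3
          subst h3
          have h5 := hends _ hI
          have := hc.eq_or_eq_of_meets hs ha hI h1 h5.le le_rfl haP.le le_rfl hI2
          simp only at this
          omega
        exact hapart I hI J hJ hne (fun h3 => hend I hI hI2 h3.2) fun h3 => hend J hJ hJ2 h3.2
  | C =>
    obtain ⟨_, h1, rfl⟩ := hm
    exact hsame fun a b h2 _ => h1 ⟨a, h2⟩
  | D =>
    obtain ⟨_, h1, rfl⟩ := hm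
    exact hsame fun a b _ h2 => h1 ⟨b, h2⟩
  | E =>
    obtain ⟨⟨I, hI, h1, h2⟩, rfl⟩ := hm
    refine hsame fun a b h3 _ => ?_
    have h4 := hends a h3
    have := hc.eq_or_eq_of_meets hs ha hI h3 h1.le h2.le h4.le le_rfl (by rintro rfl; simp at h2)
    simp only at this
    omega

end Crosses

end Slope
end SweepProcess
end

/-! ### Levels, recursion rules and uniqueness for colorings -/

noncomputable section
namespace SweepProcess

/-! ## The elements attached to colorings lie in the right summand -/

theorem dPlus_mem_summand {k : ℕ} {φ : VStar} (h : φ ∈ summand k) : dPlus φ ∈ summand (k + 1) := by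
  obtain ⟨F, rfl⟩ := h
  exact ⟨dPlusAt k F, (dPlus_lof k F).symm⟩

theorem dMinus_mem_summand {k : ℕ} {φ : VStar} (h : φ ∈ summand (k + 1)) : dMinus φ ∈ summand k := by
  obtain ⟨F, rfl⟩ := h
  exact ⟨dMinusAt k F, (dMinus_lof k F).symm⟩

theorem corner_mem_summand {k : ℕ} {φ : VStar} (h : φ ∈ summand k) : corner φ ∈ summand k := by
  refine Submodule.smul_mem _ _ (Submodule.sub_mem _ (dMinus_mem_summand (dPlus_mem_summand h)) ?_)
  cases k with
  | zero =>
    obtain ⟨F, rfl⟩ := h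
    rw [LinearMap.comp_apply, dMinus_lof_zero, map_zero]
    exact Submodule.zero_mem _
  | succ k => exact dPlus_mem_summand (dMinus_mem_summand h)

section Slope

variable {m n : ℕ} {s ε h h' : ℝ} {P : ℕ × ℕ} {c : Coloring}

theorem Adm.mem_powerset (ha : Adm m n s h c) : c ∈ (rect m n).powerset :=
  Finset.mem_powerset.2 ha.mem

theorem adm_empty (m n : ℕ) (s h : ℝ) : Adm m n s h ∅ := by
  refine ⟨?_, ?_, ?_⟩ <;> simp

/-- Families begin with the empty coloring and moves preserve admissibility, so no family reaches an
inadmissible coloring. This removes all inadmissible predecessors from the sums. -/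
theorem adm_of_coloringD_ne_zero (hs : IsSlope m n s ε) (h : ℝ) :
    ∀ c ∈ (rect m n).powerset, coloringD m n s h c ≠ 0 → Adm m n s h c := by
  refine descend hs (motive := fun h => ∀ c ∈ (rect m n).powerset, coloringD m n s h c ≠ 0 →
    Adm m n s h c) (fun h hh c _ h1 => ?_) (fun h h' P hc ih c hcR h1 => ?_) h
  · rw [coloringD_top hh] at h1
    split_ifs at h1 with h2
    · rw [← h2]
      exact adm_empty m n s h
    · exact absurd rfl h1
  · rw [hc.coloringD_eq hs hcR] at h1
    obtain ⟨x, hx, h2⟩ := Finset.exists_ne_zero_of_sum_ne_zero h1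
    obtain ⟨hxR, hm⟩ := mem_movesTo.1 hx
    refine hc.adm_move hs.s_pos (ih x.1 hxR fun h3 => h2 ?_) hm
    rw [h3, map_zero]

theorem Crosses.op_mem_summand (hs : 0 < s) (hc : Crosses m n s h h' P) {c' : Coloring} {e : Event}
    (ha : Adm m n s h' c) (hm : IsMove P e c c') (a : ℕ) {φ : VStar} (hφ : φ ∈ summand c.card) :
    e.op a φ ∈ summand c'.card := by
  cases e with
  | pass =>
    obtain ⟨_, rfl⟩ := hm
    exact hφ
  | A =>
    obtain ⟨h1, rfl⟩ := hm
    rw [Finset.card_insert_of_notMem fun h2 => h1 ⟨P, h2, le_rfl, le_rfl⟩]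
    exact dPlus_mem_summand hφ
  | B =>
    obtain ⟨α, β, h1, h2, rfl⟩ := hm
    have hα := hc.fst_lt hs (ha.pos _ h1)
    have hβ := hc.snd_lt (ha.pos _ h2)
    have hne : ((P.1, β) : ℕ × ℕ) ≠ (α, P.2) := fun h3 => hα.ne' (Prod.ext_iff.1 h3).1
    -- The joined interval must be new, for otherwise the number of intervals would drop by 2 while
    -- d_- lowers the level by 1.
    have h3 : (α, β) ∉ (c.erase (α, P.2)).erase (P.1, β) := by
      intro h3
      have h4 := Finset.mem_of_mem_erase (Finset.mem_of_mem_erase h3)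
      have := hc.eq_or_eq_of_meets hs ha h4 h1 hα.le hβ.le hα.le le_rfl
        fun h5 => hβ.ne' (Prod.ext_iff.1 h5).2
      simp only at this
      omega
    have h4 : (insert (α, β) ((c.erase (α, P.2)).erase (P.1, β))).card + 1 = c.card := by
      rw [Finset.card_insert_of_notMem h3, Finset.card_erase_add_one (Finset.mem_erase.2 ⟨hne, h2⟩),
        Finset.card_erase_add_one h1]
    rw [← h4] at hφ
    exact dMinus_mem_summand hφ
  | C =>
    obtain ⟨_, _, rfl⟩ := hm
    exact Submodule.smul_mem _ _ (corner_mem_summand hφ)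
  | D =>
    obtain ⟨_, _, rfl⟩ := hm
    exact Submodule.smul_mem _ _ hφ
  | E =>
    obtain ⟨_, rfl⟩ := hm
    exact Submodule.smul_mem _ _ hφ

theorem coloringD_mem_summand (hs : IsSlope m n s ε) (h : ℝ) :
    ∀ c ∈ (rect m n).powerset, coloringD m n s h c ∈ summand c.card := by
  refine descend hs (motive := fun h => ∀ c ∈ (rect m n).powerset,
    coloringD m n s h c ∈ summand c.card) (fun h hh c _ => ?_) (fun h h' P hc ih c hcR => ?_) h
  · rw [coloringD_top hh]
    split_ifs with h2
    · rw [← h2]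
      exact ⟨_, rfl⟩
    · exact Submodule.zero_mem _
  · rw [hc.coloringD_eq hs hcR]
    refine Submodule.sum_mem _ fun x hx => ?_
    obtain ⟨hxR, hm⟩ := mem_movesTo.1 hx
    by_cases h1 : coloringD m n s h' x.1 = 0
    · rw [h1, map_zero]
      exact Submodule.zero_mem _
    · exact hc.op_mem_summand hs.s_pos (adm_of_coloringD_ne_zero hs h' _ hxR h1) hm _ (ih _ hxR)

/-! ## The recursion -/

/-- Only finitely many moves from admissible colorings contribute. -/
theorem Crosses.coloringD_eq_sum (hs : IsSlope m n s ε) (hc : Crosses m n s h h' P)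
    (hcR : c ∈ (rect m n).powerset) (M : Finset (Coloring × Event))
    (hM : ∀ x ∈ M, x.1 ∈ (rect m n).powerset ∧ IsMove P x.2 x.1 c)
    (hM' : ∀ e c', Adm m n s h' c' → IsMove P e c' c → (c', e) ∈ M) :
    coloringD m n s h c = ∑ x ∈ M, x.2.op (startsRight x.1 P) (coloringD m n s h' x.1) := by
  rw [hc.coloringD_eq hs hcR]
  symm
  refine Finset.sum_subset (fun x hx => mem_movesTo.2 (hM x hx)) fun x hx hxM => ?_
  obtain ⟨hxR, hm⟩ := mem_movesTo.1 hx
  by_cases h1 : coloringD m n s h' x.1 = 0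
  · rw [h1, map_zero]
  · exact absurd (hM' x.2 x.1 (adm_of_coloringD_ne_zero hs h' _ hxR h1) hm) hxM

/-- What a move leads to, just below the point `P`. -/
theorem Crosses.move_cases (hs : 0 < s) (hc : Crosses m n s h h' P) {c' : Coloring} {e : Event}
    (ha : Adm m n s h' c') (hm : IsMove P e c' c) :
    (e = .pass ∧ c' = c ∧ ¬ Meets c P) ∨ (e = .A ∧ P ∈ c ∧ c' = c.erase P) ∨
    (e = .B ∧ ∃ α β, α < P.1 ∧ P.2 < β ∧ (α, β) ∈ c ∧
      c' = insert (α, P.2) (insert (P.1, β) (c.erase (α, β)))) ∨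
    (e = .C ∧ c' = c ∧ ∃ β, P.2 < β ∧ (P.1, β) ∈ c) ∨
    (e = .D ∧ c' = c ∧ ∃ α, α < P.1 ∧ (α, P.2) ∈ c) ∨
    (e = .E ∧ c' = c ∧ ∃ α β, α < P.1 ∧ P.2 < β ∧ (α, β) ∈ c) := by
  cases e with
  | pass => exact Or.inl ⟨rfl, hm.2.symm, by rw [hm.2]; exact hm.1⟩
  | A =>
    obtain ⟨h1, rfl⟩ := hm
    refine Or.inr (Or.inl ⟨rfl, Finset.mem_insert_self _ _, ?_⟩)
    rw [Finset.erase_insert fun h2 => h1 ⟨P, h2, le_rfl, le_rfl⟩]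
  | B =>
    obtain ⟨α, β, h1, h2, rfl⟩ := hm
    have hα := hc.fst_lt hs (ha.pos _ h1)
    have hβ := hc.snd_lt (ha.pos _ h2)
    have hne : ((P.1, β) : ℕ × ℕ) ≠ (α, P.2) := fun h3 => hα.ne' (Prod.ext_iff.1 h3).1
    have h3 : (α, β) ∉ (c'.erase (α, P.2)).erase (P.1, β) := by
      intro h3
      have h4 := Finset.mem_of_mem_erase (Finset.mem_of_mem_erase h3)
      have := hc.eq_or_eq_of_meets hs ha h4 h1 hα.le hβ.le hα.le le_rfl
        fun h5 => hβ.ne' (Prod.ext_iff.1 h5).2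
      simp only at this
      omega
    refine Or.inr (Or.inr (Or.inl ⟨rfl, α, β, hα, hβ, Finset.mem_insert_self _ _, ?_⟩))
    rw [Finset.erase_insert h3, Finset.insert_erase (Finset.mem_erase.2 ⟨hne, h2⟩),
      Finset.insert_erase h1]
  | C =>
    obtain ⟨⟨β, h1⟩, _, rfl⟩ := hm
    exact Or.inr (Or.inr (Or.inr (Or.inl ⟨rfl, rfl, β, hc.snd_lt (ha.pos _ h1), h1⟩)))
  | D =>
    obtain ⟨⟨α, h1⟩, _, rfl⟩ := hm
    exact Or.inr (Or.inr (Or.inr (Or.inr (Or.inl ⟨rfl, rfl, α, hc.fst_lt hs (ha.pos _ h1), h1⟩))))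
  | E =>
    obtain ⟨⟨I, hI, h1, h2⟩, rfl⟩ := hm
    exact Or.inr (Or.inr (Or.inr (Or.inr (Or.inr ⟨rfl, rfl, I.1, I.2, h1, h2, hI⟩))))

theorem Crosses.coloringD_eq_of_not_meets (hs : IsSlope m n s ε) (hc : Crosses m n s h h' P)
    (hcR : c ∈ (rect m n).powerset) (hP : ¬ Meets c P) :
    coloringD m n s h c = coloringD m n s h' c := by
  rw [hc.coloringD_eq_sum hs hcR {(c, .pass)}, Finset.sum_singleton]
  · rfl
  · intro x hx
    rw [Finset.mem_singleton.1 hx]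
    exact ⟨hcR, hP, rfl⟩
  · intro e c' ha hm
    rw [Finset.mem_singleton]
    rcases hc.move_cases hs.s_pos ha hm with ⟨rfl, rfl, _⟩ | ⟨_, h1, _⟩ | ⟨_, α, β, h1, h2, h3, _⟩ |
      ⟨_, _, β, h1, h2⟩ | ⟨_, _, α, h1, h2⟩ | ⟨_, _, α, β, h1, h2, h3⟩
    · rfl
    · exact absurd ⟨P, h1, le_rfl, le_rfl⟩ hP
    · exact absurd ⟨_, h3, h1.le, h2.le⟩ hP
    · exact absurd ⟨_, h2, le_rfl, h1.le⟩ hP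
    · exact absurd ⟨_, h2, h1.le, le_rfl⟩ hP
    · exact absurd ⟨_, h3, h1.le, h2.le⟩ hP

theorem coloringD_empty (hs : IsSlope m n s ε) (h : ℝ) : coloringD m n s h ∅ = ofSym 1 := by
  refine descend hs (motive := fun h => coloringD m n s h ∅ = ofSym 1) (fun h hh => ?_) (fun h h' P hc ih => ?_) h
  · rw [coloringD_top hh, if_pos rfl]
  · rw [hc.coloringD_eq_of_not_meets hs (Finset.empty_mem_powerset _) fun ⟨I, hI, _⟩ =>
      absurd hI (Finset.notMem_empty I), ih]

namespace Crosses

/-- Just below P, admissibility allows only one interval meeting P. Its position excludes all but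
one case of `move_cases`; the rules C and D are obtained in the same way. -/
theorem ruleA (hs : IsSlope m n s ε) (hc : Crosses m n s h h' P) (ha : Adm m n s h c) (hP : P ∈ c) :
    Adm m n s h' (c.erase P) ∧ coloringD m n s h c = dPlus (coloringD m n s h' (c.erase P)) := by
  have h1 : Adm m n s h (c.erase P) :=
    ⟨fun I hI => ha.mem I (Finset.mem_of_mem_erase hI), fun I hI => ha.pos I (Finset.mem_of_mem_erase hI),
      fun I hI J hJ => ha.apart I (Finset.mem_of_mem_erase hI) J (Finset.mem_of_mem_erase hJ)⟩
  refine ⟨hc.adm_up h1 (Finset.notMem_erase _ _), ?_⟩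
  have huniq : ∀ I ∈ c, I.1 ≤ P.1 → P.2 ≤ I.2 → I = P := fun I hI h2 h3 =>
    hc.eq_of_meets hs.s_pos ha hI hP h2 h3 le_rfl le_rfl
  rw [hc.coloringD_eq_sum hs ha.mem_powerset {(c.erase P, .A)}, Finset.sum_singleton]
  · rfl
  · intro x hx
    rw [Finset.mem_singleton.1 hx]
    refine ⟨h1.mem_powerset, ?_, (Finset.insert_erase hP).symm⟩
    rintro ⟨I, hI, h2, h3⟩
    obtain ⟨h4, h5⟩ := Finset.mem_erase.1 hI
    exact h4 (huniq I h5 h2 h3)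
  · intro e c' ha' hm
    rw [Finset.mem_singleton]
    rcases hc.move_cases hs.s_pos ha' hm with ⟨_, _, h2⟩ | ⟨rfl, h2, rfl⟩ | ⟨_, α, β, h2, h3, h4, _⟩ |
      ⟨_, _, β, h2, h3⟩ | ⟨_, _, α, h2, h3⟩ | ⟨_, _, α, β, h2, h3, h4⟩
    · exact absurd ⟨P, hP, le_rfl, le_rfl⟩ h2
    · rfl
    · exact absurd (Prod.ext_iff.1 (huniq _ h4 h2.le h3.le)).1 h2.ne
    · exact absurd (Prod.ext_iff.1 (huniq _ h3 le_rfl h2.le)).2 h2.ne'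
    · exact absurd (Prod.ext_iff.1 (huniq _ h3 h2.le le_rfl)).1 h2.ne
    · exact absurd (Prod.ext_iff.1 (huniq _ h4 h2.le h3.le)).1 h2.ne

theorem ruleC (hs : IsSlope m n s ε) (hc : Crosses m n s h h' P) (ha : Adm m n s h c) {β : ℕ}
    (hI : (P.1, β) ∈ c) (hβ : P.2 < β) :
    Adm m n s h' c ∧
      coloringD m n s h c = (q ^ startsRight c P)⁻¹ • corner (coloringD m n s h' c) := by
  have huniq : ∀ I ∈ c, I.1 ≤ P.1 → P.2 ≤ I.2 → I = (P.1, β) := fun I hJ h2 h3 =>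
    hc.eq_of_meets hs.s_pos ha hJ hI h2 h3 le_rfl hβ.le
  have hP : P ∉ c := fun h1 => hβ.ne (Prod.ext_iff.1 (huniq P h1 le_rfl le_rfl)).2
  have ha₁ := hc.adm_up ha hP
  refine ⟨ha₁, ?_⟩
  rw [hc.coloringD_eq_sum hs ha.mem_powerset {(c, .C)}, Finset.sum_singleton]
  · rfl
  · intro x hx
    rw [Finset.mem_singleton.1 hx]
    refine ⟨ha.mem_powerset, ⟨β, hI⟩, ?_, rfl⟩
    rintro ⟨α, h2⟩
    exact hβ.ne (Prod.ext_iff.1 (huniq _ h2 (hc.fst_lt hs.s_pos (ha₁.pos _ h2)).le le_rfl)).2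
  · intro e c' ha' hm
    rw [Finset.mem_singleton]
    rcases hc.move_cases hs.s_pos ha' hm with ⟨_, _, h2⟩ | ⟨_, h2, _⟩ | ⟨_, α, β, h2, h3, h4, _⟩ |
      ⟨rfl, rfl, _⟩ | ⟨_, _, α, h2, h3⟩ | ⟨_, _, α, β, h2, h3, h4⟩
    · exact absurd ⟨_, hI, le_rfl, hβ.le⟩ h2
    · exact absurd h2 hP
    · exact absurd (Prod.ext_iff.1 (huniq _ h4 h2.le h3.le)).1 h2.ne
    · rfl
    · exact absurd (Prod.ext_iff.1 (huniq _ h3 h2.le le_rfl)).1 h2.ne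
    · exact absurd (Prod.ext_iff.1 (huniq _ h4 h2.le h3.le)).1 h2.ne

theorem ruleD (hs : IsSlope m n s ε) (hc : Crosses m n s h h' P) (ha : Adm m n s h c) {α : ℕ}
    (hI : (α, P.2) ∈ c) (hα : α < P.1) :
    Adm m n s h' c ∧ coloringD m n s h c = q ^ startsRight c P • coloringD m n s h' c := by
  have huniq : ∀ I ∈ c, I.1 ≤ P.1 → P.2 ≤ I.2 → I = (α, P.2) := fun I hJ h2 h3 =>
    hc.eq_of_meets hs.s_pos ha hJ hI h2 h3 hα.le le_rfl
  have hP : P ∉ c := fun h1 => hα.ne' (Prod.ext_iff.1 (huniq P h1 le_rfl le_rfl)).1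
  have ha₁ := hc.adm_up ha hP
  refine ⟨ha₁, ?_⟩
  rw [hc.coloringD_eq_sum hs ha.mem_powerset {(c, .D)}, Finset.sum_singleton]
  · rfl
  · intro x hx
    rw [Finset.mem_singleton.1 hx]
    refine ⟨ha.mem_powerset, ⟨α, hI⟩, ?_, rfl⟩
    rintro ⟨β, h2⟩
    exact hα.ne' (Prod.ext_iff.1 (huniq _ h2 le_rfl (hc.snd_lt (ha₁.pos _ h2)).le)).1
  · intro e c' ha' hm
    rw [Finset.mem_singleton]
    rcases hc.move_cases hs.s_pos ha' hm with ⟨_, _, h2⟩ | ⟨_, h2, _⟩ | ⟨_, α, β, h2, h3, h4, _⟩ |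
      ⟨_, _, β, h2, h3⟩ | ⟨rfl, rfl, _⟩ | ⟨_, _, α, β, h2, h3, h4⟩
    · exact absurd ⟨_, hI, hα.le, le_rfl⟩ h2
    · exact absurd h2 hP
    · exact absurd (Prod.ext_iff.1 (huniq _ h4 h2.le h3.le)).2 h3.ne'
    · exact absurd (Prod.ext_iff.1 (huniq _ h3 le_rfl h2.le)).2 h2.ne'
    · rfl
    · exact absurd (Prod.ext_iff.1 (huniq _ h4 h2.le h3.le)).2 h3.ne'

/-- The two pieces are apart because P is below the upper line, and they inherit the distance to the
other intervals from the whole. -/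
theorem adm_cut (hs : 0 < s) (hc : Crosses m n s h h' P) (ha : Adm m n s h c) {α β : ℕ}
    (hI : (α, β) ∈ c) (hα : α < P.1) (hβ : P.2 < β) (ha₁ : Adm m n s h' c) :
    Adm m n s h' (insert (α, P.2) (insert (P.1, β) (c.erase (α, β)))) := by
  have hIR := mem_rect.1 (ha.mem _ hI)
  have hPR := mem_rect.1 hc.mem
  have hcut : height s (P.1, P.2) ≤ h' := hc.lt'.le
  have hapart : ∀ J ∈ c, J ≠ (α, β) → (height s (J.1, P.2) ≤ h' ∨ height s (α, J.2) ≤ h') ∧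
      (height s (J.1, β) ≤ h' ∨ height s (P.1, J.2) ≤ h') := by
    intro J hJ hne
    have h1 := ha₁.apart (α, β) hI J hJ hne.symm
    exact ⟨h1.imp_left (height_le_height hs le_rfl hβ.le).trans,
      h1.imp_right (height_le_height hs hα.le le_rfl).trans⟩
  refine ⟨?_, ?_, ?_⟩
  · rw [Finset.forall_mem_insert, Finset.forall_mem_insert]
    exact ⟨mem_rect.2 ⟨hIR.1, hPR.2⟩, mem_rect.2 ⟨hPR.1, hIR.2⟩,
      fun J hJ => ha.mem J (Finset.mem_of_mem_erase hJ)⟩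
  · rw [Finset.forall_mem_insert, Finset.forall_mem_insert]
    exact ⟨hc.above hs hα.le le_rfl hPR.2 (Or.inl hα), hc.above hs le_rfl hβ.le hIR.2 (Or.inr hβ),
      fun J hJ => ha₁.pos J (Finset.mem_of_mem_erase hJ)⟩
  · intro I hI' J hJ hne
    rw [Finset.mem_insert, Finset.mem_insert, Finset.mem_erase] at hI' hJ
    rcases hI' with rfl | rfl | ⟨hI1, hI2⟩ <;> rcases hJ with rfl | rfl | ⟨hJ1, hJ2⟩
    · exact absurd rfl hne
    · exact Or.inl hcut
    · exact (hapart J hJ2 hJ1).1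
    · exact Or.inr hcut
    · exact absurd rfl hne
    · exact (hapart J hJ2 hJ1).2
    · exact (hapart I hI2 hI1).1.symm
    · exact (hapart I hI2 hI1).2.symm
    · exact ha₁.apart I hI2 J hJ2 hne

/-- An interval around P arises either by joining two intervals at P or by continuing one; these are
the only predecessors, and they differ. -/
theorem ruleBE (hs : IsSlope m n s ε) (hc : Crosses m n s h h' P) (ha : Adm m n s h c) {α β : ℕ}
    (hI : (α, β) ∈ c) (hα : α < P.1) (hβ : P.2 < β) :
    Adm m n s h' (insert (α, P.2) (insert (P.1, β) (c.erase (α, β)))) ∧ Adm m n s h' c ∧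
      coloringD m n s h c =
        dMinus (coloringD m n s h' (insert (α, P.2) (insert (P.1, β) (c.erase (α, β))))) +
          t • coloringD m n s h' c := by
  have huniq : ∀ I ∈ c, I.1 ≤ P.1 → P.2 ≤ I.2 → I = (α, β) := fun I hJ h2 h3 =>
    hc.eq_of_meets hs.s_pos ha hJ hI h2 h3 hα.le hβ.le
  have hP : P ∉ c := fun h1 => hα.ne' (Prod.ext_iff.1 (huniq P h1 le_rfl le_rfl)).1
  have ha₁ := hc.adm_up ha hP
  have ha₂ := hc.adm_cut hs.s_pos ha hI hα hβ ha₁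
  have h1 : (α, P.2) ∉ c := fun h2 => hβ.ne (Prod.ext_iff.1 (huniq _ h2 hα.le le_rfl)).2
  have h1' : (P.1, β) ∉ c := fun h2 => hα.ne' (Prod.ext_iff.1 (huniq _ h2 le_rfl hβ.le)).1
  have hne : ((α, P.2) : ℕ × ℕ) ≠ (P.1, β) := fun h2 => hα.ne (Prod.ext_iff.1 h2).1
  refine ⟨ha₂, ha₁, ?_⟩
  rw [hc.coloringD_eq_sum hs ha.mem_powerset
    {(insert (α, P.2) (insert (P.1, β) (c.erase (α, β))), .B), (c, .E)}, Finset.sum_pair (by simp)]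
  · rfl
  · intro x hx
    rw [Finset.mem_insert, Finset.mem_singleton] at hx
    rcases hx with rfl | rfl
    · refine ⟨ha₂.mem_powerset, α, β, Finset.mem_insert_self _ _,
        Finset.mem_insert_of_mem (Finset.mem_insert_self _ _), ?_⟩
      rw [Finset.erase_insert, Finset.erase_insert, Finset.insert_erase hI]
      · exact fun h2 => h1' (Finset.mem_of_mem_erase h2)
      · rw [Finset.mem_insert]
        rintro (h2 | h2)
        · exact hne h2
        · exact h1 (Finset.mem_of_mem_erase h2)
    · exact ⟨ha.mem_powerset, ⟨_, hI, hα, hβ⟩, rfl⟩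
  · intro e c' ha' hm
    rw [Finset.mem_insert, Finset.mem_singleton]
    rcases hc.move_cases hs.s_pos ha' hm with ⟨_, _, h2⟩ | ⟨_, h2, _⟩ | ⟨rfl, α', β', h2, h3, h4, rfl⟩ |
      ⟨_, _, β, h2, h3⟩ | ⟨_, _, α, h2, h3⟩ | ⟨rfl, rfl, _⟩
    · exact absurd ⟨_, hI, hα.le, hβ.le⟩ h2
    · exact absurd h2 hP
    · obtain ⟨rfl, rfl⟩ := Prod.ext_iff.1 (huniq _ h4 h2.le h3.le)
      exact Or.inl rfl
    · exact absurd (Prod.ext_iff.1 (huniq _ h3 le_rfl h2.le)).1 hα.ne'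
    · exact absurd (Prod.ext_iff.1 (huniq _ h3 h2.le le_rfl)).2 hβ.ne
    · exact Or.inr rfl

end Crosses

/-- Nothing happens before the first hit. -/
theorem FirstHit.exists_crosses (hs : IsSlope m n s ε) (hf : FirstHit m n s h h' c P) :
    ∃ h₁, Crosses m n s h₁ h' P ∧ Adm m n s h₁ c ∧ coloringD m n s h c = coloringD m n s h₁ c := by
  have ha := (isAdmissible_iff hf.start).1 hf.admissible
  -- The lattice points below P do not meet c, so the line can be raised past them without a change,
  -- up to some h₁ with only P between it and the line at h'.
  have key : ∀ h₀ : ℝ, h ≤ h₀ → h₀ < height s P →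
      ∃ h₁, Crosses m n s h₁ h' P ∧ h ≤ h₁ ∧ coloringD m n s h₀ c = coloringD m n s h₁ c := by
    intro h₀
    refine descend hs (motive := fun h₀ : ℝ => h ≤ h₀ → h₀ < height s P →
      ∃ h₁, Crosses m n s h₁ h' P ∧ h ≤ h₁ ∧ coloringD m n s h₀ c = coloringD m n s h₁ c) (fun h₀ hh _ h1 => absurd h1 (hh P hf.mem)) (fun h₀ h₂ Q hc ih h1 h2 => ?_) h₀
    by_cases hQ : Q = P
    · subst hQ
      refine ⟨h₀, ⟨hf.mem, h2, hf.above, fun R hR h3 hne => ?_⟩, h1, rfl⟩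
      have h4 := hc.next R hR h3 hne
      refine lt_of_le_of_ne (not_lt.1 fun h5 => ?_) (hf.generic' R hR).symm
      exact hf.next R hR ⟨hc.lt'.trans h4, h5⟩
    · have h3 := hc.next P hf.mem h2 (Ne.symm hQ)
      rw [hc.coloringD_eq_of_not_meets hs ha.mem_powerset
        (hf.first Q hc.mem (h1.trans_lt hc.lt) (hc.lt'.trans h3))]
      exact ih (h1.trans (hc.lt.trans hc.lt').le) h3
  obtain ⟨h₁, hc, h1, h2⟩ := key h le_rfl hf.below
  refine ⟨h₁, hc, ⟨ha.mem, fun I hI => ?_, fun I hI J hJ hne => ?_⟩, h2⟩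
  -- The pair I is itself a lattice point meeting c, the one to which the interval shrinks, so it
  -- cannot be lower than the first hit P.
  · refine hc.lt.trans_le (not_lt.1 fun h3 => ?_)
    exact hf.first I (ha.mem I hI) (ha.pos I hI) h3 ⟨I, hI, le_rfl, le_rfl⟩
  · exact (ha.apart I hI J hJ hne).imp (fun h3 => h3.trans h1) fun h3 => h3.trans h1

theorem recursion_coloringD (hs : IsSlope m n s ε) : Recursion m n s (coloringD m n s) := by
  have hadm : ∀ {h h' : ℝ} {c : Coloring} {P : ℕ × ℕ}, FirstHit m n s h h' c P → ∀ c',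
      Adm m n s h' c' → IsAdmissible m n s h' c' := fun hf c' =>
    (isAdmissible_iff (hf.start.trans (hf.below.trans hf.above))).2
  refine ⟨fun h _ _ => coloringD_empty hs h, ?_, ?_, ?_, ?_⟩
  · intro h h' c P hf hP
    obtain ⟨h₁, hc, ha, h1⟩ := hf.exists_crosses hs
    obtain ⟨h2, h3⟩ := hc.ruleA hs ha hP
    exact ⟨hadm hf _ h2, h1.trans h3⟩
  · intro h h' c P β hf hI hβ
    obtain ⟨h₁, hc, ha, h1⟩ := hf.exists_crosses hs
    obtain ⟨h2, h3⟩ := hc.ruleC hs ha hI hβ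
    exact ⟨hadm hf _ h2, h1.trans h3⟩
  · intro h h' c P α hf hI hα
    obtain ⟨h₁, hc, ha, h1⟩ := hf.exists_crosses hs
    obtain ⟨h2, h3⟩ := hc.ruleD hs ha hI hα
    exact ⟨hadm hf _ h2, h1.trans h3⟩
  · intro h h' c P α β hf hI hα hβ
    obtain ⟨h₁, hc, ha, h1⟩ := hf.exists_crosses hs
    obtain ⟨h2, h3, h4⟩ := hc.ruleBE hs ha hI hα hβ
    exact ⟨hadm hf _ h2, hadm hf _ h3, h1.trans h4⟩

theorem exists_firstHit (hh : height s (m, n) < h) (hg : IsGeneric m n s h)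
    (ha : IsAdmissible m n s h c) (hne : c.Nonempty) : ∃ h' P, FirstHit m n s h h' c P := by
  classical
  have ha' := (isAdmissible_iff hh).1 ha
  obtain ⟨I, hI⟩ := hne
  obtain ⟨P, hP, hmin⟩ := ((rect m n).filter fun P => h < height s P ∧ Meets c P).exists_min_image
    (height s) ⟨I, Finset.mem_filter.2 ⟨ha'.mem I hI, ha'.pos I hI, I, hI, le_rfl, le_rfl⟩⟩
  obtain ⟨hP1, hP2, hP3⟩ := Finset.mem_filter.1 hP
  obtain ⟨h', h1, h2⟩ := exists_just_above m n s P
  refine ⟨h', P, hh, hg, fun Q hQ h3 => ?_, ha, hP1, hP3, hP2, h1, fun Q hQ h3 h4 h5 => ?_,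
    fun Q hQ h3 => lt_asymm (h2 Q hQ h3.1) h3.2⟩
  · have := h2 Q hQ (by rw [h3]; exact h1)
    exact this.ne' h3
  · exact not_lt.2 (hmin Q (Finset.mem_filter.2 ⟨hQ, h3, h5⟩)) h4

/-- Induction on the number of lattice points above the line: every nonempty coloring has a first
hit, and the rules lead to admissible colorings of a higher line. -/
theorem recursion_unique {E E' : ℝ → Coloring → VStar}
    (hE : Recursion m n s E) (hE' : Recursion m n s E') (h : ℝ) (c : Coloring)
    (hh : height s (m, n) < h) (hg : IsGeneric m n s h) (ha : IsAdmissible m n s h c) :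
    E h c = E' h c := by
  induction hN : numAbove m n s h using Nat.strong_induction_on generalizing h c with
  | _ N ih =>
    rcases c.eq_empty_or_nonempty with rfl | hne
    · rw [hE.empty h hh hg, hE'.empty h hh hg]
    · obtain ⟨h', P, hf⟩ := exists_firstHit hh hg ha hne
      have key : ∀ c', IsAdmissible m n s h' c' → E h' c' = E' h' c' := fun c' h1 =>
        ih _ (by rw [← hN]; exact numAbove_lt hf.mem hf.below hf.above) h' c'
          (hh.trans (hf.below.trans hf.above)) hf.generic' h1 rfl
      obtain ⟨⟨α, β⟩, hI, h1, h2⟩ := hf.meets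
      -- P is the whole interval, its left end, its right end or an inner point; each case has its
      -- rule.
      rcases eq_or_lt_of_le h1 with rfl | h1 <;> rcases eq_or_lt_of_le h2 with h2 | h2
      · simp only at h2
        rw [← h2] at hI
        obtain ⟨h3, h4⟩ := hE.ruleA h h' c P hf hI
        rw [h4, (hE'.ruleA h h' c P hf hI).2, key _ h3]
      · obtain ⟨h3, h4⟩ := hE.ruleC h h' c P β hf hI h2
        rw [h4, (hE'.ruleC h h' c P β hf hI h2).2, key _ h3]
      · simp only at h2
        rw [← h2] at hI
        obtain ⟨h3, h4⟩ := hE.ruleD h h' c P α hf hI h1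
        rw [h4, (hE'.ruleD h h' c P α hf hI h1).2, key _ h3]
      · obtain ⟨h3, h4, h5⟩ := hE.ruleBE h h' c P α β hf hI h1 h2
        rw [h5, (hE'.ruleBE h h' c P α β hf hI h1 h2).2.2, key _ h3, key _ h4]

end Slope
end SweepProcess
end

/-! ### The main theorem -/

theorem mainTheorem7 (m₁ n₁ g : ℕ) (hm : 0 < m₁) (hn : 0 < n₁) (hg : 0 < g)
    (hcop : Nat.Coprime m₁ n₁) (m n : ℕ) (hmg : m = g * m₁) (hng : n = g * n₁)
    (ε : ℝ) (hε : 0 < ε) (hsmall : ε * ((m₁ : ℝ) * ((m : ℝ) + 1)) < 1)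
    (s : ℝ) (hs : s = (n₁ : ℝ) / (m₁ : ℝ) - ε) :
    (∀ π : SweepProcess.DyckPath m n, ∃ F : SweepProcess.SymFun,
      SweepProcess.toSeries F = π.D s ∧ π.sweep s (-ε) = SweepProcess.ofSym F) ∧
    (∀ (h : ℝ) (c : SweepProcess.Coloring), SweepProcess.height s (m, n) < h →
      SweepProcess.IsGeneric m n s h → SweepProcess.IsAdmissible m n s h c →
      SweepProcess.coloringD m n s h c ∈ SweepProcess.summand c.card) ∧
    SweepProcess.Recursion m n s (SweepProcess.coloringD m n s) ∧
    ∀ E : ℝ → SweepProcess.Coloring → SweepProcess.VStar, SweepProcess.Recursion m n s E →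
      ∀ (h : ℝ) (c : SweepProcess.Coloring), SweepProcess.height s (m, n) < h →
        SweepProcess.IsGeneric m n s h → SweepProcess.IsAdmissible m n s h c →
        E h c = SweepProcess.coloringD m n s h c := by
  subst hmg hng hs
  have hs := SweepProcess.isSlope_of_small hm hn hg hε hsmall
  refine ⟨fun π => π.sweep_eq_D hs, fun h c hh _ hc => ?_, SweepProcess.recursion_coloringD hs,
    fun E hE h c hh hg hc =>
      SweepProcess.recursion_unique hE (SweepProcess.recursion_coloringD hs) h c hh hg hc⟩
  exact SweepProcess.coloringD_mem_summand hs h c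
    ((SweepProcess.isAdmissible_iff hh).1 hc).mem_powerset
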